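/- For integers $a\le b$ with $a\ge 1$ let $[a,b]=\{a,a+1,\dots,b\}$ (an \emph{interval}), and let $[n]=\{1,\dots,n\}$. A \emph{partition} of an interval $I$ is a sequence $I_1<\dots<I_s$ of disjoint intervals with union $I$, where $[a,b]<[a',b']$ means $b<a'$. An \emph{$r\times s$-gridding} of a rectangle $I\times J$ ($I,J$ intervals) is a pair consisting of a partition $(I_1,\dots,I_r)$ of $I$ and a partition $(J_1,\dots,J_s)$ of $J$; its cells are the sets $I_x\times J_y$. A finite set $M\subseteq\mathbb N^2$ \emph{contains an $r\times s$-grid} if there is an $r\times s$-gridding of some rectangle all of whose cells intersect $M$; such a gridding is called an $r\times s$-grid in $M$. Let $f(r)=r^4\binom{r^2}{r}$. \textbf{Theorem.} Let $p,q,r$ be nonnegative integers with $r\ge 1$ and $p+q>2$, and let $M\subseteq[p]\times[q]$ with $|M|>f(r)\,(p+q-2)$. Then $M$ contains an $r\times r$-grid. Moreover, such a grid can be found in time $O(|M|)$: there is an algorithm (a program for a unit-cost random access machine with words of $O(\log|M|)$ bits and with addition, subtraction, multiplication, division and comparison of words) that, given any such $p,q,r$ and $M$, where $M$ is given as a list of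 its points in arbitrary order without repetitions, outputs the endpoints of the column intervals and of the row intervals of an $r\times r$-grid in $M$ after at most $c\,|M|$ steps. The program, the constant $c$ and the constant in the word length do not depend on $p,q,r$ or $M$. -/

import Mathlib

namespace GridFinding

/-! ## Intervals, griddings and grids -/

/-- A discrete interval `[lo, hi] = {lo, lo + 1, …, hi}` with positive integer endpoints
`lo ≤ hi`. -/
structure Interval where
  lo : ℕ
  hi : ℕ
  one_le_lo : 1 ≤ lo
  lo_le_hi : lo ≤ hi

/-- The set of integers in an interval. -/
def Interval.toFinset (I : Interval) : Finset ℕ := Finset.Icc I.lo I.hi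

/-- `I < I'` for intervals: every element of `I` is smaller than every element of `I'`. -/
def Interval.Before (I I' : Interval) : Prop := I.hi < I'.lo

/-- The sequence `P = (I₁, …, I_s)` of intervals is a partition of the interval `I`: its members
are disjoint, their union is `I`, and `I₁ < I₂ < … < I_s`. -/
def IsPartition {s : ℕ} (P : Fin s → Interval) (I : Interval) : Prop :=
  (∀ i j, i ≠ j → Disjoint (P i).toFinset (P j).toFinset) ∧
  (∀ n, n ∈ I.toFinset ↔ ∃ i, n ∈ (P i).toFinset) ∧
  (∀ i j, i < j → (P i).Before (P j))

/-- An `r × s`-gridding of the rectangle `I × J`: a partition of `I` into `r` intervals (the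
columns) and a partition of `J` into `s` intervals (the rows). -/
structure Gridding (r s : ℕ) (I J : Interval) where
  cols : Fin r → Interval
  rows : Fin s → Interval
  cols_partition : IsPartition cols I
  rows_partition : IsPartition rows J

/-- The `(x, y)`-th cell of a gridding: the rectangle `I_x × J_y`. -/
def Gridding.cell {r s : ℕ} {I J : Interval} (G : Gridding r s I J) (x : Fin r) (y : Fin s) :
    Finset (ℕ × ℕ) :=
  (G.cols x).toFinset ×ˢ (G.rows y).toFinset

/-- Every cell of the gridding `G` intersects the point set `M`. -/
def Gridding.IsGridOf {r s : ℕ} {I J : Interval} (G : Gridding r s I J)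
    (M : Finset (ℕ × ℕ)) : Prop :=
  ∀ x y, ∃ z ∈ M, z ∈ G.cell x y

/-- The point set `M` contains an `r × s`-grid. -/
def ContainsGrid (M : Finset (ℕ × ℕ)) (r s : ℕ) : Prop :=
  ∃ (I J : Interval) (G : Gridding r s I J), G.IsGridOf M

/-- `f(r) = r⁴ · C(r², r)`. -/
def f (r : ℕ) : ℕ := r ^ 4 * Nat.choose (r ^ 2) r

/-! ## The machine model: a random access machine with bounded words and unit costs

A machine state consists of registers, which instructions name directly, and of a random access
memory, which is addressed through registers. A program is a finite structured program (so it
uses finitely many registers). Every instruction, and every evaluation of the test of a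
conditional or of a loop, takes one unit of time. -/

/-- Machine states. -/
structure State where
  reg : ℕ → ℕ
  mem : ℕ → ℕ

/-- The arithmetic operations of the machine: addition, subtraction (truncated at `0`),
multiplication, and division (rounded down; division by `0` gives `0`). -/
inductive Op where
  | add | sub | mul | div

/-- The result of an arithmetic operation. -/
def Op.eval : Op → ℕ → ℕ → ℕ
  | .add, a, b => a + b
  | .sub, a, b => a - b
  | .mul, a, b => a * b
  | .div, a, b => a / b

/-- The tests of the machine compare the contents of two registers. -/
inductive Test where
  | lt (i j : ℕ)
  | eq (i j : ℕ)

/-- The truth of a test in a state. -/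
def Test.Holds : Test → State → Prop
  | .lt i j, σ => σ.reg i < σ.reg j
  | .eq i j, σ => σ.reg i = σ.reg j

/-- Programs:
* `const i n`: set register `i` to the constant `n`;
* `arith o i j k`: set register `i` to the result of `o` on registers `j` and `k`;
* `load i j`: set register `i` to the memory word whose address is in register `j`;
* `store i j`: write register `j` to the memory word whose address is in register `i`;
* `skip`, sequencing, conditionals and while loops. -/
inductive Program where
  | skip
  | const (i n : ℕ)
  | arith (o : Op) (i j k : ℕ)
  | load (i j : ℕ)
  | store (i j : ℕ)
  | seq (a b : Program)
  | ite (b : Test) (a a' : Program)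
  | while (b : Test) (a : Program)

/-- Overwrite one register. -/
def State.setReg (σ : State) (i v : ℕ) : State := { σ with reg := Function.update σ.reg i v }

/-- Overwrite one memory word. -/
def State.setMem (σ : State) (i v : ℕ) : State := { σ with mem := Function.update σ.mem i v }

/-- `Runs W a σ t τ`: on a machine whose words hold the integers `0, …, W`, the program `a`
started in state `σ` halts in state `τ` after exactly `t` units of time. An instruction with a
result larger than `W` has no successor state: a run that overflows never halts. -/
inductive Runs (W : ℕ) : Program → State → ℕ → State → Prop where
  | skip (σ : State) : Runs W .skip σ 1 σ
  | const (i n : ℕ) (σ : State) (h : n ≤ W) : Runs W (.const i n) σ 1 (σ.setReg i n)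
  | arith (o : Op) (i j k : ℕ) (σ : State) (h : o.eval (σ.reg j) (σ.reg k) ≤ W) :
      Runs W (.arith o i j k) σ 1 (σ.setReg i (o.eval (σ.reg j) (σ.reg k)))
  | load (i j : ℕ) (σ : State) (h : σ.reg j ≤ W) (h' : σ.mem (σ.reg j) ≤ W) :
      Runs W (.load i j) σ 1 (σ.setReg i (σ.mem (σ.reg j)))
  | store (i j : ℕ) (σ : State) (h : σ.reg i ≤ W) (h' : σ.reg j ≤ W) :
      Runs W (.store i j) σ 1 (σ.setMem (σ.reg i) (σ.reg j))
  | seq {a b : Program} {σ ρ τ : State} {t u : ℕ} (h : Runs W a σ t ρ) (h' : Runs W b ρ u τ) :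
      Runs W (.seq a b) σ (t + u) τ
  | ite_true {b : Test} {a a' : Program} {σ τ : State} {t : ℕ} (hb : b.Holds σ)
      (h : Runs W a σ t τ) : Runs W (.ite b a a') σ (t + 1) τ
  | ite_false {b : Test} {a a' : Program} {σ τ : State} {t : ℕ} (hb : ¬ b.Holds σ)
      (h : Runs W a' σ t τ) : Runs W (.ite b a a') σ (t + 1) τ
  | while_true {b : Test} {a : Program} {σ ρ τ : State} {t u : ℕ} (hb : b.Holds σ)
      (h : Runs W a σ t ρ) (h' : Runs W (.while b a) ρ u τ) :
      Runs W (.while b a) σ (t + 1 + u) τ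
  | while_false {b : Test} {a : Program} {σ : State} (hb : ¬ b.Holds σ) :
      Runs W (.while b a) σ 1 σ

/-- The machine is deterministic: running time and final state are determined by the program and
the initial state. -/
theorem Runs.unique {W : ℕ} {a : Program} {σ τ : State} {t : ℕ} (h : Runs W a σ t τ) :
    ∀ {τ' : State} {t' : ℕ}, Runs W a σ t' τ' → t = t' ∧ τ = τ' := by
  induction h with
  | skip | const | arith | load | store => intro _ _ h'; cases h'; exact ⟨rfl, rfl⟩
  | seq _ _ ih ih' =>
    intro _ _ h'
    cases h' with
    | seq k k' =>
      obtain ⟨rfl, rfl⟩ := ih k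
      obtain ⟨rfl, rfl⟩ := ih' k'
      exact ⟨rfl, rfl⟩
  | ite_true hb _ ih =>
    intro _ _ h'
    cases h' with
    | ite_true _ k => obtain ⟨rfl, rfl⟩ := ih k; exact ⟨rfl, rfl⟩
    | ite_false hb' _ => exact absurd hb hb'
  | ite_false hb _ ih =>
    intro _ _ h'
    cases h' with
    | ite_true hb' _ => exact absurd hb' hb
    | ite_false _ k => obtain ⟨rfl, rfl⟩ := ih k; exact ⟨rfl, rfl⟩
  | while_true hb _ _ ih ih' =>
    intro _ _ h'
    cases h' with
    | while_true _ k k' =>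
      obtain ⟨rfl, rfl⟩ := ih k
      obtain ⟨rfl, rfl⟩ := ih' k'
      exact ⟨rfl, rfl⟩
    | while_false hb' => exact absurd hb hb'
  | while_false hb =>
    intro _ _ h'
    cases h' with
    | while_true hb' _ _ => exact absurd hb' hb
    | while_false _ => exact ⟨rfl, rfl⟩

/-! ## Input and output of the grid-finding problem -/

/-- The initial state on input `(p, q, r, L)`, where `L` is a list of points: the registers
`0, 1, 2, 3` hold `p`, `q`, `r` and the length of `L`; the memory holds the coordinates
`x₀, y₀, x₁, y₁, …` of the points of `L` from address `0` on; everything else is `0`. -/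
def initState (p q r : ℕ) (L : List (ℕ × ℕ)) : State where
  reg i := [p, q, r, L.length].getD i 0
  mem a := (L.flatMap fun z => [z.1, z.2]).getD a 0

/-- The state `τ` describes the `r × s`-gridding `G`: from the address in register `0` on, the
memory lists the lower and upper endpoint of every column of `G`, then those of every row. -/
def Describes (τ : State) {r s : ℕ} {I J : Interval} (G : Gridding r s I J) : Prop :=
  (∀ x : Fin r, τ.mem (τ.reg 0 + 2 * x) = (G.cols x).lo ∧
    τ.mem (τ.reg 0 + 2 * x + 1) = (G.cols x).hi) ∧
  (∀ y : Fin s, τ.mem (τ.reg 0 + 2 * r + 2 * y) = (G.rows y).lo ∧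
    τ.mem (τ.reg 0 + 2 * r + 2 * y + 1) = (G.rows y).hi)

end GridFinding

/-! The proof is the Marcus–Tardos contraction argument, carried out by a program; existence of the
grid is read off from the program's correctness. For `r = 1` the whole rectangle is a grid, so let
`r ≥ 2`, and let `S` be a set of `N + 1` points in `[x] × [y]` with `f r * (x + y - 2) ≤ N`. Cut the
rectangle into blocks of side `r²`, and call a block wide (tall) if at least `r` of its columns
(rows) are nonempty. If no `r` wide blocks above each other agree in their first `r` nonempty
columns, the pigeonhole principle leaves at most `(r - 1) * C(r², r)` wide blocks per block column;
likewise for tall blocks and block rows. Wide or tall blocks hold at most `r⁴` points, all others at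
most `(r - 1)²`.

Hence one of two things happens. If more than `N / r²` blocks are nonempty, the contracted set
satisfies the hypothesis again, because `x + y - 2` also shrinks by the factor `r²`. Otherwise the
count gives `r` similar wide blocks in `S` or in its transpose (`dense_or_dense`). Their common
columns and their block rows span an `r × r`-grid, which survives undoing the contractions because
blocks of blocks are blocks (`up_up`, `ListsGrid.of_lines`).

The time is linear since only `N / r² + 1` points are kept after a contraction, so the costs form a
geometric series (`shrinkProg_spec`), and since the final search spends `O(r²)` steps on each of at
most `N / r²` blocks (`searchProg_spec`). Memory is initially zero and every round works in unused
tables, so nothing is ever cleared. Codes of column sets are below `(r²)^r`, which is at most the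
square of the number of points, so words of logarithmic length suffice.

The programs are written in a small language with variables and tables. `Expr.runs_compile`
justifies its translation to machine code, and `WP` is a total correctness calculus that also counts
time, in units of 64 machine steps. -/

set_option linter.constructorNameAsVariable false

namespace GridFinding

/-! ## A small imperative language on top of the machine -/

/-- The program variables. -/
inductive Var
  | p | q | r | n | R | s | a | g | j | cnt | X | Y | N | dx | dy | lim | found | FX | FY | FK
  | c | k | key | v | cur | prev | out | done | b
  deriving DecidableEq

/-- The register of a variable. -/
def Var.idx (v : Var) : ℕ := v.ctorIdx

/-- Register 60 stays zero, 61 to 63 hold the layout, and those from 64 on are scratch space. The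
constructors `p`, `q`, `r`, `n` come first so that their registers 0 to 3 are those of the input. -/
theorem Var.idx_lt (v : Var) : v.idx < 60 := by cases v <;> decide

theorem Var.idx_injective : Function.Injective Var.idx := by
  have h : ∀ v : Var, Var.ofNat v.idx = v := by intro v; cases v <;> rfl
  exact Function.LeftInverse.injective h

/-- Expressions: `low a` is the word at address `a` of the input area, and `tab t u v` is the
entry in row `u` and column `v` of the table number `t`. -/
inductive Expr
  | var (v : Var)
  | const (n : ℕ)
  | bin (o : Op) (a b : Expr)
  | low (a : Expr)
  | tab (t u v : Expr)

instance : Coe Var Expr := ⟨Expr.var⟩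
instance : Add Expr := ⟨Expr.bin .add⟩
instance : Sub Expr := ⟨Expr.bin .sub⟩
instance : Mul Expr := ⟨Expr.bin .mul⟩
instance : Div Expr := ⟨Expr.bin .div⟩
instance (n : ℕ) : OfNat Expr n := ⟨Expr.const n⟩

/-- The contents of the variables, of the input area and of the tables. -/
structure AState where
  reg : Var → ℕ
  low : ℕ → ℕ
  tab : ℕ → ℕ → ℕ → ℕ

namespace AState

/-- Assign a variable. -/
def set (s : AState) (v : Var) (x : ℕ) : AState := { s with reg := Function.update s.reg v x }

/-- Overwrite a word of the input area. -/
def setLow (s : AState) (a x : ℕ) : AState := { s with low := Function.update s.low a x }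

/-- Overwrite a table entry. -/
def setTab (s : AState) (t u v x : ℕ) : AState :=
  { s with tab := fun t' u' v' => if t' = t ∧ u' = u ∧ v' = v then x else s.tab t' u' v' }

@[simp] theorem reg_set (s : AState) (v w : Var) (x : ℕ) :
    (s.set v x).reg w = if w = v then x else s.reg w := by
  simp [set, Function.update_apply]
@[simp] theorem low_set (s : AState) (v : Var) (x : ℕ) : (s.set v x).low = s.low := rfl
@[simp] theorem tab_set (s : AState) (v : Var) (x : ℕ) : (s.set v x).tab = s.tab := rfl
@[simp] theorem reg_setLow (s : AState) (a x : ℕ) : (s.setLow a x).reg = s.reg := rfl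
@[simp] theorem low_setLow (s : AState) (a x b : ℕ) :
    (s.setLow a x).low b = if b = a then x else s.low b := by
  simp [setLow, Function.update_apply]
@[simp] theorem tab_setLow (s : AState) (a x : ℕ) : (s.setLow a x).tab = s.tab := rfl
@[simp] theorem reg_setTab (s : AState) (t u v x : ℕ) : (s.setTab t u v x).reg = s.reg := rfl
@[simp] theorem low_setTab (s : AState) (t u v x : ℕ) : (s.setTab t u v x).low = s.low := rfl
@[simp] theorem tab_setTab (s : AState) (t u v x t' u' v' : ℕ) :
    (s.setTab t u v x).tab t' u' v' =
      if t' = t ∧ u' = u ∧ v' = v then x else s.tab t' u' v' := rfl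

end AState

/-- The memory layout: the input area has length `T`, there are `E` tables with `Z` columns each,
and variables and memory words are at most `B`. -/
structure Layout where
  T : ℕ
  Z : ℕ
  E : ℕ
  B : ℕ
  two_le : 2 ≤ B
  T_le : T ≤ B
  Z_le : Z ≤ B
  E_le : E ≤ B

/-- The word size of the machine. -/
def Layout.W (P : Layout) : ℕ := P.B ^ 64

/-- The machine state `σ` represents the abstract state `s`. -/
structure Rel (P : Layout) (s : AState) (σ : State) : Prop where
  reg : ∀ v : Var, σ.reg v.idx = s.reg v
  zero : σ.reg 60 = 0
  regT : σ.reg 61 = P.T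
  regZ : σ.reg 62 = P.Z
  regE : σ.reg 63 = P.E
  low : ∀ a < P.T, σ.mem a = s.low a
  tab : ∀ t u v, t < P.E → v < P.Z → σ.mem (P.T + ((u * P.Z + v) * P.E + t)) = s.tab t u v
  reg_le : ∀ v, s.reg v ≤ P.B
  mem_le : ∀ a, σ.mem a ≤ P.B

namespace Expr

/-- The value of an expression. -/
def eval : Expr → AState → ℕ
  | var v, s => s.reg v
  | const n, _ => n
  | bin o a b, s => o.eval (a.eval s) (b.eval s)
  | low a, s => s.low (a.eval s)
  | tab t u v, s => s.tab (t.eval s) (u.eval s) (v.eval s)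

/-- All memory accesses of an expression are in range. -/
def Valid (P : Layout) : Expr → AState → Prop
  | var _, _ => True
  | const _, _ => True
  | bin _ a b, s => a.Valid P s ∧ b.Valid P s
  | low a, s => a.Valid P s ∧ a.eval s < P.T
  | tab t u v, s => t.Valid P s ∧ u.Valid P s ∧ v.Valid P s ∧ t.eval s < P.E ∧ v.eval s < P.Z

/-- All intermediate results of the evaluation of `e` are at most `B ^ e.deg`. -/
def deg : Expr → ℕ
  | var _ => 1
  | const n => n
  | bin _ a b => a.deg + b.deg + 1
  | low a => a.deg + 1
  | tab t u v => t.deg + u.deg + v.deg + 8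

/-- The number of machine steps of the evaluation. -/
def cost : Expr → ℕ
  | var _ => 1
  | const _ => 1
  | bin _ a b => a.cost + (b.cost + 1)
  | low a => a.cost + 1
  | tab t u v => t.cost + (u.cost + (v.cost + 6))

/-- Machine code that evaluates an expression into register `d`, with registers from `d` on as
scratch space. -/
def compile : Expr → ℕ → Program
  | var v, d => .arith .add d v.idx 60
  | const n, d => .const d n
  | bin o a b, d => .seq (a.compile d) (.seq (b.compile (d + 1)) (.arith o d d (d + 1)))
  | low a, d => .seq (a.compile d) (.load d d)
  | tab t u v, d => .seq (t.compile d) (.seq (u.compile (d + 1)) (.seq (v.compile (d + 2))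
      (.seq (.arith .mul (d + 1) (d + 1) 62) (.seq (.arith .add (d + 1) (d + 1) (d + 2))
      (.seq (.arith .mul (d + 1) (d + 1) 63) (.seq (.arith .add d d (d + 1))
      (.seq (.arith .add d d 61) (.load d d))))))))

@[simp] theorem eval_var (v : Var) (s : AState) : (var v).eval s = s.reg v := rfl
@[simp] theorem eval_const (n : ℕ) (s : AState) : (const n).eval s = n := rfl
@[simp] theorem eval_zero (s : AState) : (0 : Expr).eval s = 0 := rfl
@[simp] theorem eval_one (s : AState) : (1 : Expr).eval s = 1 := rfl
@[simp] theorem eval_two (s : AState) : (2 : Expr).eval s = 2 := rfl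
@[simp] theorem eval_three (s : AState) : (3 : Expr).eval s = 3 := rfl
@[simp] theorem eval_add (a b : Expr) (s : AState) : (a + b).eval s = a.eval s + b.eval s := rfl
@[simp] theorem eval_sub (a b : Expr) (s : AState) : (a - b).eval s = a.eval s - b.eval s := rfl
@[simp] theorem eval_mul (a b : Expr) (s : AState) : (a * b).eval s = a.eval s * b.eval s := rfl
@[simp] theorem eval_div (a b : Expr) (s : AState) : (a / b).eval s = a.eval s / b.eval s := rfl
@[simp] theorem eval_low (a : Expr) (s : AState) : (low a).eval s = s.low (a.eval s) := rfl
@[simp] theorem eval_tab (t u v : Expr) (s : AState) :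
    (tab t u v).eval s = s.tab (t.eval s) (u.eval s) (v.eval s) := rfl

variable {P : Layout}

@[simp] theorem valid_var (v : Var) (s : AState) : (var v).Valid P s := trivial
@[simp] theorem valid_const (n : ℕ) (s : AState) : (const n).Valid P s := trivial
@[simp] theorem valid_zero (s : AState) : (0 : Expr).Valid P s := trivial
@[simp] theorem valid_one (s : AState) : (1 : Expr).Valid P s := trivial
@[simp] theorem valid_two (s : AState) : (2 : Expr).Valid P s := trivial
@[simp] theorem valid_three (s : AState) : (3 : Expr).Valid P s := trivial
@[simp] theorem valid_add (a b : Expr) (s : AState) :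
    (a + b).Valid P s ↔ a.Valid P s ∧ b.Valid P s := Iff.rfl
@[simp] theorem valid_sub (a b : Expr) (s : AState) :
    (a - b).Valid P s ↔ a.Valid P s ∧ b.Valid P s := Iff.rfl
@[simp] theorem valid_mul (a b : Expr) (s : AState) :
    (a * b).Valid P s ↔ a.Valid P s ∧ b.Valid P s := Iff.rfl
@[simp] theorem valid_div (a b : Expr) (s : AState) :
    (a / b).Valid P s ↔ a.Valid P s ∧ b.Valid P s := Iff.rfl
@[simp] theorem valid_low (a : Expr) (s : AState) :
    (low a).Valid P s ↔ a.Valid P s ∧ a.eval s < P.T := Iff.rfl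
@[simp] theorem valid_tab (t u v : Expr) (s : AState) :
    (tab t u v).Valid P s ↔
      t.Valid P s ∧ u.Valid P s ∧ v.Valid P s ∧ t.eval s < P.E ∧ v.eval s < P.Z := Iff.rfl

end Expr

/-! ### Absence of overflow and correctness of compiled expressions -/

theorem Op.eval_le_pow {B x y m n : ℕ} (o : Op) (hB : 2 ≤ B) (hx : x ≤ B ^ m) (hy : y ≤ B ^ n) :
    o.eval x y ≤ B ^ (m + n + 1) := by
  have h1 : 1 ≤ B ^ m := Nat.one_le_pow _ _ (by omega)
  have h2 : 1 ≤ B ^ n := Nat.one_le_pow _ _ (by omega)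
  have e : B ^ (m + n + 1) = B ^ m * B ^ n * B := by ring
  -- The spare factor `B ≥ 2` is there for addition: each summand is at most the product of the two
  -- bounds.
  have h3 : B ^ m * B ^ n * 2 ≤ B ^ (m + n + 1) := by rw [e]; gcongr
  have h4 : B ^ m ≤ B ^ m * B ^ n := Nat.le_mul_of_pos_right _ h2
  have h5 : B ^ n ≤ B ^ m * B ^ n := Nat.le_mul_of_pos_left _ h1
  cases o with
  | add => simp only [Op.eval]; omega
  | sub => simp only [Op.eval]; omega
  | mul =>
    simp only [Op.eval]
    have := Nat.mul_le_mul hx hy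
    omega
  | div =>
    simp only [Op.eval]
    have := Nat.div_le_self x y
    omega

/-- The address of a table entry is a polynomially bounded number. -/
theorem Layout.addr_le (P : Layout) {t u v a b c : ℕ} (ht : t ≤ P.B ^ a) (hu : u ≤ P.B ^ b)
    (hv : v ≤ P.B ^ c) :
    u * P.Z ≤ P.B ^ (b + 2) ∧ u * P.Z + v ≤ P.B ^ (b + c + 3) ∧
    (u * P.Z + v) * P.E ≤ P.B ^ (b + c + 5) ∧
    t + (u * P.Z + v) * P.E ≤ P.B ^ (a + b + c + 6) ∧
    t + (u * P.Z + v) * P.E + P.T ≤ P.B ^ (a + b + c + 8) := by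
  have hB := P.two_le
  have hZ : P.Z ≤ P.B ^ 1 := by simpa using P.Z_le
  have hE : P.E ≤ P.B ^ 1 := by simpa using P.E_le
  have hT : P.T ≤ P.B ^ 1 := by simpa using P.T_le
  have h1 := Op.eval_le_pow .mul hB hu hZ
  have h2 := Op.eval_le_pow .add hB h1 hv
  have h3 := Op.eval_le_pow .mul hB h2 hE
  have h4 := Op.eval_le_pow .add hB ht h3
  have h5 := Op.eval_le_pow .add hB h4 hT
  simp only [Op.eval] at h1 h2 h3 h4 h5
  refine ⟨h1, ?_, ?_, ?_, ?_⟩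
  · convert h2 using 2; ring
  · convert h3 using 2; ring
  · convert h4 using 2; ring
  · convert h5 using 2; ring

/-- Two divisions with remainder, by `E` and by `Z`, recover the entry from its address. The row
needs no bound, which later allows codes of column sets to serve as row numbers. -/
theorem Layout.addr_injective (P : Layout) {t u v t' u' v' : ℕ} (ht : t < P.E) (hv : v < P.Z)
    (ht' : t' < P.E) (hv' : v' < P.Z)
    (h : (u * P.Z + v) * P.E + t = (u' * P.Z + v') * P.E + t') : t = t' ∧ u = u' ∧ v = v' := by
  have h1 : t = t' := by
    have := congrArg (· % P.E) h
    simpa [Nat.add_mod, Nat.mod_eq_of_lt ht, Nat.mod_eq_of_lt ht'] using this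
  subst h1
  have h2 : u * P.Z + v = u' * P.Z + v' :=
    Nat.eq_of_mul_eq_mul_right (by omega : 0 < P.E) (by omega)
  have h3 : v = v' := by
    have := congrArg (· % P.Z) h2
    simpa [Nat.add_mod, Nat.mod_eq_of_lt hv, Nat.mod_eq_of_lt hv'] using this
  subst h3
  exact ⟨rfl, Nat.eq_of_mul_eq_mul_right (by omega : 0 < P.Z) (by omega), rfl⟩

variable {P : Layout} {s : AState} {σ : State}

theorem Rel.eval_le (h : Rel P s σ) : ∀ (e : Expr), e.Valid P s → e.eval s ≤ P.B ^ e.deg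
  | .var v, _ => by simpa [Expr.deg] using h.reg_le v
  | .const n, _ => by
    simp only [Expr.eval_const, Expr.deg]
    -- A constant `n` has degree `n` because `n < 2 ^ n ≤ B ^ n`.
    exact (Nat.lt_two_pow_self).le.trans (Nat.pow_le_pow_left P.two_le n)
  | .bin o a b, hv => Op.eval_le_pow o P.two_le (h.eval_le a hv.1) (h.eval_le b hv.2)
  | .low a, hv => by
    simp only [Expr.eval_low, Expr.deg]
    rw [← h.low _ hv.2]
    exact (h.mem_le _).trans (Nat.le_self_pow (by omega) _)
  | .tab t u v, hv => by
    simp only [Expr.eval_tab, Expr.deg]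
    rw [← h.tab _ _ _ hv.2.2.2.1 hv.2.2.2.2]
    exact (h.mem_le _).trans (Nat.le_self_pow (by omega) _)

/-- Scratch registers are irrelevant. -/
theorem Rel.congr (h : Rel P s σ) {τ : State} (hr : ∀ i < 64, τ.reg i = σ.reg i)
    (hm : τ.mem = σ.mem) : Rel P s τ where
  reg v := by rw [hr _ (by have := v.idx_lt; omega)]; exact h.reg v
  zero := by rw [hr _ (by omega)]; exact h.zero
  regT := by rw [hr _ (by omega)]; exact h.regT
  regZ := by rw [hr _ (by omega)]; exact h.regZ
  regE := by rw [hr _ (by omega)]; exact h.regE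
  low := by rw [hm]; exact h.low
  tab := by rw [hm]; exact h.tab
  reg_le := h.reg_le
  mem_le := by rw [hm]; exact h.mem_le

/-- The code of an expression computes its value. -/
theorem Expr.runs_compile : ∀ (e : Expr) {d : ℕ} {σ : State}, Rel P s σ → e.Valid P s →
    e.deg ≤ 64 → 64 ≤ d → ∃ τ, Runs P.W (e.compile d) σ e.cost τ ∧ τ.reg d = e.eval s ∧
      (∀ i < d, τ.reg i = σ.reg i) ∧ τ.mem = σ.mem
  | .var v, d, σ, h, _, _, hd => by
    have e : Op.eval .add (σ.reg v.idx) (σ.reg 60) = s.reg v := by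
      simp [Op.eval, h.reg, h.zero]
    refine ⟨_, Runs.arith .add d v.idx 60 σ ?_, ?_, ?_, rfl⟩
    · rw [e]; exact (h.reg_le v).trans (Nat.le_self_pow (by omega) _)
    · simp [State.setReg, e]
    · intro i hi; simp [State.setReg, hi.ne]
  | .const n, d, σ, h, hv, hd', hd => by
    refine ⟨_, Runs.const d n σ ?_, ?_, ?_, rfl⟩
    · exact (h.eval_le (.const n) hv).trans (Nat.pow_le_pow_right (by have := P.two_le; omega) hd')
    · simp [State.setReg]
    · intro i hi; simp [State.setReg, hi.ne]
  | .bin o a b, d, σ, h, hv, hd', hd => by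
    have hle := (h.eval_le (.bin o a b) hv).trans
      (Nat.pow_le_pow_right (by have := P.two_le; omega) hd')
    simp only [Expr.deg] at hd'
    obtain ⟨τ, r1, e1, f1, m1⟩ := a.runs_compile h hv.1 (by omega) hd
    have h1 := h.congr (fun i hi => f1 i (by omega)) m1
    obtain ⟨ρ, r2, e2, f2, m2⟩ := b.runs_compile h1 hv.2 (by omega) (by omega : 64 ≤ d + 1)
    have e3 : ρ.reg d = a.eval s := by rw [f2 d (by omega), e1]
    refine ⟨_, Runs.seq r1 (Runs.seq r2 (Runs.arith o d d (d + 1) ρ ?_)), ?_, ?_, ?_⟩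
    · rw [e3, e2]; exact hle
    · simp [State.setReg, e3, e2, Expr.eval]
    · intro i hi
      simp only [State.setReg, Function.update_apply, hi.ne, if_false]
      rw [f2 i (by omega), f1 i hi]
    · simp [State.setReg, m2, m1]
  | .low a, d, σ, h, hv, hd', hd => by
    simp only [Expr.deg] at hd'
    obtain ⟨τ, r1, e1, f1, m1⟩ := a.runs_compile h hv.1 (by omega) hd
    refine ⟨_, Runs.seq r1 (Runs.load d d τ ?_ ?_), ?_, ?_, ?_⟩
    · rw [e1]
      exact hv.2.le.trans (P.T_le.trans (Nat.le_self_pow (by omega) _))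
    · rw [e1, m1]
      exact (h.mem_le _).trans (Nat.le_self_pow (by omega) _)
    · simp [State.setReg, e1, m1, h.low _ hv.2]
    · intro i hi
      simp only [State.setReg, Function.update_apply, hi.ne, if_false]
      exact f1 i hi
    · simp [State.setReg, m1]
  | .tab t u v, d, σ, h, hv, hd', hd => by
    simp only [Expr.deg] at hd'
    obtain ⟨vt, vu, vv, ht, hvz⟩ := hv
    obtain ⟨b1, b2, b3, b4, b5⟩ := P.addr_le (h.eval_le t vt) (h.eval_le u vu) (h.eval_le v vv)
    have hW : ∀ {x k}, x ≤ P.B ^ k → k ≤ 64 → x ≤ P.W := fun hx hk =>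
      hx.trans (Nat.pow_le_pow_right (by have := P.two_le; omega) hk)
    obtain ⟨σ1, r1, e1, f1, m1⟩ := t.runs_compile h vt (by omega) hd
    have h1 := h.congr (fun i hi => f1 i (by omega)) m1
    obtain ⟨σ2, r2, e2, f2, m2⟩ := u.runs_compile h1 vu (by omega) (by omega : 64 ≤ d + 1)
    have h2 := h1.congr (fun i hi => f2 i (by omega)) m2
    obtain ⟨σ3, r3, e3, f3, m3⟩ := v.runs_compile h2 vv (by omega) (by omega : 64 ≤ d + 2)
    have h3 := h2.congr (fun i hi => f3 i (by omega)) m3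
    have c1 : σ3.reg d = t.eval s := by rw [f3 d (by omega), f2 d (by omega), e1]
    have c2 : σ3.reg (d + 1) = u.eval s := by rw [f3 _ (by omega), e2]
    have n2 : ¬ 63 = d + 1 := by omega
    have n3 : ¬ 61 = d + 1 := by omega
    have n4 : ¬ 61 = d := by omega
    have n5 : ¬ d = d + 1 := by omega
    have n6 : ¬ d + 2 = d + 1 := by omega
    have haddr := h3.tab _ (u.eval s) _ ht hvz
    rw [show P.T + ((u.eval s * P.Z + v.eval s) * P.E + t.eval s)
      = t.eval s + (u.eval s * P.Z + v.eval s) * P.E + P.T by ring] at haddr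
    refine ⟨_, Runs.seq r1 (Runs.seq r2 (Runs.seq r3 (Runs.seq (Runs.arith .mul _ _ _ _ ?_)
      (Runs.seq (Runs.arith .add _ _ _ _ ?_) (Runs.seq (Runs.arith .mul _ _ _ _ ?_)
      (Runs.seq (Runs.arith .add _ _ _ _ ?_) (Runs.seq (Runs.arith .add _ _ _ _ ?_)
      (Runs.load d d _ ?_ ?_)))))))), ?_, ?_, ?_⟩
    all_goals
      simp only [State.setReg, Function.update_apply, Op.eval, c1, c2, e3, h3.regZ, h3.regE,
        h3.regT, n2, n3, n4, n5, n6, if_true, if_false, haddr]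
    · exact hW b1 (by omega)
    · exact hW b2 (by omega)
    · exact hW b3 (by omega)
    · exact hW b4 (by omega)
    · exact hW b5 (by omega)
    · exact hW b5 (by omega)
    · rw [← haddr]; exact (h3.mem_le _).trans (Nat.le_self_pow (by omega) _)
    · rfl
    · intro i hi
      have k1 : ¬ i = d := by omega
      have k2 : ¬ i = d + 1 := by omega
      simp only [k1, k2, if_false]
      rw [f3 i (by omega), f2 i (by omega), f1 i hi]
    · rw [m3, m2, m1]

/-! ### Commands and their weakest preconditions -/

/-- `v := e`. -/
def assign (v : Var) (e : Expr) : Program := .seq (e.compile 64) (.arith .add v.idx 64 60)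

/-- Write `e` to address `a` of the input area. -/
def putLow (a e : Expr) : Program := .seq (a.compile 64) (.seq (e.compile 65) (.store 64 65))

/-- Write `e` to the entry `(u, v)` of table `t`. -/
def putTab (t u v e : Expr) : Program :=
  .seq (t.compile 64) (.seq (u.compile 65) (.seq (v.compile 66) (.seq (e.compile 67)
    (.seq (.arith .mul 65 65 62) (.seq (.arith .add 65 65 66) (.seq (.arith .mul 65 65 63)
    (.seq (.arith .add 64 64 65) (.seq (.arith .add 64 64 61) (.store 64 67)))))))))

/-- `if a < b then x else y`. -/
def ifLt (a b : Expr) (x y : Program) : Program :=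
  .seq (a.compile 64) (.seq (b.compile 65) (.ite (.lt 64 65) x y))

/-- `if a = b then x else y`. -/
def ifEq (a b : Expr) (x y : Program) : Program :=
  .seq (a.compile 64) (.seq (b.compile 65) (.ite (.eq 64 65) x y))

/-- `while a < b do x`, for variables `a`, `b`. -/
def whileLt (a b : Var) (x : Program) : Program := .while (.lt a.idx b.idx) x

/-- Every run of `a` from a state that represents `s` ends in a state that represents some `s'`
with `Q k s'`, after at most `64 * k` steps. -/
def WP (P : Layout) (a : Program) (s : AState) (Q : ℕ → AState → Prop) : Prop :=
  ∀ σ, Rel P s σ → ∃ k s' u τ, Runs P.W a σ u τ ∧ u ≤ 64 * k ∧ Rel P s' τ ∧ Q k s'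

theorem WP.mono {a : Program} {Q Q' : ℕ → AState → Prop} (h : WP P a s Q)
    (hQ : ∀ k s', Q k s' → Q' k s') : WP P a s Q' := by
  intro σ hσ
  obtain ⟨k, s', u, τ, h1, h2, h3, h4⟩ := h σ hσ
  exact ⟨k, s', u, τ, h1, h2, h3, hQ _ _ h4⟩

theorem WP.skip {Q : ℕ → AState → Prop} (h : Q 1 s) : WP P .skip s Q :=
  fun σ hσ => ⟨1, s, 1, σ, Runs.skip σ, by omega, hσ, h⟩

theorem WP.seq {a b : Program} {Q : ℕ → AState → Prop}
    (h : WP P a s fun k s' => WP P b s' fun l s'' => Q (k + l) s'') : WP P (.seq a b) s Q := by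
  intro σ hσ
  obtain ⟨k, s', u, τ, h1, h2, h3, h4⟩ := h σ hσ
  obtain ⟨l, s'', w, ρ, k1, k2, k3, k4⟩ := h4 τ h3
  exact ⟨k + l, s'', u + w, ρ, Runs.seq h1 k1, by omega, k3, k4⟩

/-! ### Rules for the single commands -/

theorem Rel.set (h : Rel P s σ) {v : Var} {x : ℕ} (hx : x ≤ P.B) {τ : State}
    (hv : τ.reg v.idx = x) (hr : ∀ i < 64, i ≠ v.idx → τ.reg i = σ.reg i)
    (hm : τ.mem = σ.mem) : Rel P (s.set v x) τ := by
  have hlt := v.idx_lt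
  refine ⟨?_, ?_, ?_, ?_, ?_, ?_, ?_, ?_, ?_⟩
  · intro w
    by_cases hw : w = v
    · subst hw; simp [hv]
    · have hlt' := w.idx_lt
      rw [hr _ (by omega) (fun e => hw (Var.idx_injective e)), h.reg]
      simp [hw]
  · rw [hr _ (by omega) (by omega)]; exact h.zero
  · rw [hr _ (by omega) (by omega)]; exact h.regT
  · rw [hr _ (by omega) (by omega)]; exact h.regZ
  · rw [hr _ (by omega) (by omega)]; exact h.regE
  · rw [hm]; exact h.low
  · rw [hm]; exact h.tab
  · intro w
    by_cases hw : w = v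
    · subst hw; simpa using hx
    · simpa [hw] using h.reg_le w
  · rw [hm]; exact h.mem_le

/-- Degree at most 64 keeps intermediate results within the word size `B ^ 64`, and cost at most 50
leaves room for the fixed instructions of a command within one unit of time. For concrete
expressions both are decided by evaluation. -/
theorem WP.assign (x : ℕ) {v : Var} {e : Expr} {Q : ℕ → AState → Prop} (hv : e.Valid P s)
    (hx : e.eval s = x) (hB : x ≤ P.B) (h : Q 1 (s.set v x))
    (hd : e.deg ≤ 64 ∧ e.cost ≤ 50 := by decide) : WP P (assign v e) s Q := by
  subst hx
  intro σ hσ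
  obtain ⟨τ, r1, e1, f1, m1⟩ := e.runs_compile hσ hv hd.1 le_rfl
  have hlt := v.idx_lt
  have e2 : Op.eval .add (τ.reg 64) (τ.reg 60) = e.eval s := by
    simp [Op.eval, e1, f1, hσ.zero]
  refine ⟨1, _, _, _, Runs.seq r1 (Runs.arith .add _ _ _ τ ?_), by omega, ?_, h⟩
  · rw [e2]; exact hB.trans (Nat.le_self_pow (by omega) _)
  · refine hσ.set hB ?_ ?_ ?_
    · simp [State.setReg, e2]
    · intro i hi hne
      simp only [State.setReg, Function.update_apply, hne, if_false]
      exact f1 i hi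
    · simp [State.setReg, m1]

theorem WP.putLow (y x : ℕ) {a e : Expr} {Q : ℕ → AState → Prop} (ha : a.Valid P s)
    (hv : e.Valid P s) (hy : a.eval s = y) (hx : e.eval s = x) (hT : y < P.T) (hB : x ≤ P.B)
    (h : Q 1 (s.setLow y x))
    (hd : (a.deg ≤ 64 ∧ e.deg ≤ 64) ∧ a.cost + e.cost ≤ 50 := by decide) :
    WP P (putLow a e) s Q := by
  subst hx hy
  intro σ hσ
  obtain ⟨τ, r1, e1, f1, m1⟩ := a.runs_compile hσ ha hd.1.1 le_rfl
  have h1 := hσ.congr f1 m1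
  obtain ⟨ρ, r2, e2, f2, m2⟩ := e.runs_compile h1 hv hd.1.2 (by omega : 64 ≤ 65)
  have h2 := h1.congr (fun i hi => f2 i (by omega)) m2
  have e3 : ρ.reg 64 = a.eval s := by rw [f2 _ (by omega), e1]
  refine ⟨1, _, _, _, Runs.seq r1 (Runs.seq r2 (Runs.store _ _ _ ?_ ?_)), by omega, ?_, h⟩
  · rw [e3]; exact hT.le.trans (P.T_le.trans (Nat.le_self_pow (by omega) _))
  · rw [e2]; exact hB.trans (Nat.le_self_pow (by omega) _)
  · refine ⟨h2.reg, h2.zero, h2.regT, h2.regZ, h2.regE, ?_, ?_, h2.reg_le, ?_⟩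
    · intro b hb
      simp only [State.setMem, Function.update_apply, AState.low_setLow, e3, e2, h2.low b hb]
    · intro t u v ht hv
      simp only [State.setMem, Function.update_apply, e3, AState.tab_setLow]
      -- The tables start at address `T`, beyond the input area.
      rw [if_neg (by omega), h2.tab _ _ _ ht hv]
    · intro b
      simp only [State.setMem, Function.update_apply, e2]
      split_ifs
      · exact hB
      · exact h2.mem_le b

/-- The total degree of the three indices is limited to 50 since the exponent bounding the address
is larger by 8 (`Layout.addr_le`). -/
theorem WP.putTab (t' u' v' x : ℕ) {t u v e : Expr} {Q : ℕ → AState → Prop} (ht : t.Valid P s)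
    (hu : u.Valid P s) (hv : v.Valid P s) (he : e.Valid P s)
    (h' : t.eval s = t' ∧ u.eval s = u' ∧ v.eval s = v' ∧ e.eval s = x) (hE : t' < P.E)
    (hZ : v' < P.Z) (hB : x ≤ P.B) (h : Q 1 (s.setTab t' u' v' x))
    (hd : (t.deg + u.deg + v.deg ≤ 50 ∧ e.deg ≤ 64) ∧ t.cost + u.cost + v.cost + e.cost ≤ 50 :=
      by decide) :
    WP P (putTab t u v e) s Q := by
  obtain ⟨rfl, rfl, rfl, rfl⟩ := h'
  intro σ hσ
  obtain ⟨b1, b2, b3, b4, b5⟩ :=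
    P.addr_le (hσ.eval_le t ht) (hσ.eval_le u hu) (hσ.eval_le v hv)
  have hW : ∀ {x k}, x ≤ P.B ^ k → k ≤ 64 → x ≤ P.W := fun hx hk =>
    hx.trans (Nat.pow_le_pow_right (by have := P.two_le; omega) hk)
  obtain ⟨σ1, r1, e1, f1, m1⟩ := t.runs_compile hσ ht (by omega) le_rfl
  have h1 := hσ.congr f1 m1
  obtain ⟨σ2, r2, e2, f2, m2⟩ := u.runs_compile h1 hu (by omega) (by omega : 64 ≤ 65)
  have h2 := h1.congr (fun i hi => f2 i (by omega)) m2
  obtain ⟨σ3, r3, e3, f3, m3⟩ := v.runs_compile h2 hv (by omega) (by omega : 64 ≤ 66)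
  have h3 := h2.congr (fun i hi => f3 i (by omega)) m3
  obtain ⟨σ4, r4, e4, f4, m4⟩ := e.runs_compile h3 he (by omega) (by omega : 64 ≤ 67)
  have h4 := h3.congr (fun i hi => f4 i (by omega)) m4
  have c1 : σ4.reg 64 = t.eval s := by
    rw [f4 _ (by omega), f3 _ (by omega), f2 _ (by omega), e1]
  have c2 : σ4.reg 65 = u.eval s := by rw [f4 _ (by omega), f3 _ (by omega), e2]
  have c3 : σ4.reg 66 = v.eval s := by rw [f4 _ (by omega), e3]
  refine ⟨1, _, _, _, Runs.seq r1 (Runs.seq r2 (Runs.seq r3 (Runs.seq r4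
    (Runs.seq (Runs.arith .mul _ _ _ _ ?_) (Runs.seq (Runs.arith .add _ _ _ _ ?_)
    (Runs.seq (Runs.arith .mul _ _ _ _ ?_) (Runs.seq (Runs.arith .add _ _ _ _ ?_)
    (Runs.seq (Runs.arith .add _ _ _ _ ?_) (Runs.store _ _ _ ?_ ?_))))))))), by omega, ?_, h⟩
  on_goal 8 =>
    refine Rel.mk ?_ ?_ ?_ ?_ ?_ ?_ ?_ ?_ ?_
    · intro w
      have := w.idx_lt
      have k1 : ¬ w.idx = 64 := by omega
      have k2 : ¬ w.idx = 65 := by omega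
      simp [State.setReg, State.setMem, k1, k2, h4.reg]
    · simp [State.setReg, State.setMem, h4.zero]
    · simp [State.setReg, State.setMem, h4.regT]
    · simp [State.setReg, State.setMem, h4.regZ]
    · simp [State.setReg, State.setMem, h4.regE]
    · intro b hb
      simp [State.setReg, State.setMem, Function.update_apply, Op.eval, h4.regZ, h4.regE,
        h4.regT, c1, c2, c3, e4]
      rw [if_neg (by omega), h4.low b hb]
    · intro t' u' v' ht' hv'
      simp [State.setReg, State.setMem, Function.update_apply, Op.eval, h4.regZ, h4.regE,
        h4.regT, c1, c2, c3, e4]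
      rw [h4.tab _ _ _ ht' hv']
      refine if_congr ⟨fun hh => ?_, ?_⟩ rfl rfl
      · exact P.addr_injective ht' hv' hE hZ (by omega)
      · rintro ⟨rfl, rfl, rfl⟩; ring
    · exact h4.reg_le
    · intro b
      simp [State.setReg, State.setMem, Function.update_apply, e4]
      split_ifs
      · exact hB
      · exact h4.mem_le b
  all_goals
    simp [State.setReg, Op.eval, c1, c2, c3, e4, h4.regZ, h4.regE, h4.regT]
  · exact hW b1 (by omega)
  · exact hW b2 (by omega)
  · exact hW b3 (by omega)
  · exact hW b4 (by omega)
  · exact hW b5 (by omega)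
  · exact hW b5 (by omega)
  · exact hB.trans (Nat.le_self_pow (by omega) _)

theorem WP.ifLt {a b : Expr} {x y : Program} {Q : ℕ → AState → Prop} (ha : a.Valid P s)
    (hb : b.Valid P s) (h1 : a.eval s < b.eval s → WP P x s fun k => Q (k + 1))
    (h2 : b.eval s ≤ a.eval s → WP P y s fun k => Q (k + 1))
    (hd : (a.deg ≤ 64 ∧ b.deg ≤ 64) ∧ a.cost + b.cost ≤ 50 := by decide) :
    WP P (ifLt a b x y) s Q := by
  intro σ hσ
  obtain ⟨τ, r1, e1, f1, m1⟩ := a.runs_compile hσ ha hd.1.1 le_rfl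
  have k1 := hσ.congr f1 m1
  obtain ⟨ρ, r2, e2, f2, m2⟩ := b.runs_compile k1 hb hd.1.2 (by omega : 64 ≤ 65)
  have k2 := k1.congr (fun i hi => f2 i (by omega)) m2
  have e3 : ρ.reg 64 = a.eval s := by rw [f2 _ (by omega), e1]
  rcases lt_or_ge (a.eval s) (b.eval s) with hlt | hle
  · obtain ⟨k, s', u, τ', q1, q2, q3, q4⟩ := h1 hlt ρ k2
    exact ⟨k + 1, s', _, τ', Runs.seq r1 (Runs.seq r2 (Runs.ite_true
      (by simpa [Test.Holds, e3, e2] using hlt) q1)), by omega, q3, q4⟩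
  · obtain ⟨k, s', u, τ', q1, q2, q3, q4⟩ := h2 hle ρ k2
    exact ⟨k + 1, s', _, τ', Runs.seq r1 (Runs.seq r2 (Runs.ite_false
      (by simpa [Test.Holds, e3, e2] using hle) q1)), by omega, q3, q4⟩

theorem WP.ifEq {a b : Expr} {x y : Program} {Q : ℕ → AState → Prop} (ha : a.Valid P s)
    (hb : b.Valid P s) (h1 : a.eval s = b.eval s → WP P x s fun k => Q (k + 1))
    (h2 : a.eval s ≠ b.eval s → WP P y s fun k => Q (k + 1))
    (hd : (a.deg ≤ 64 ∧ b.deg ≤ 64) ∧ a.cost + b.cost ≤ 50 := by decide) :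
    WP P (ifEq a b x y) s Q := by
  intro σ hσ
  obtain ⟨τ, r1, e1, f1, m1⟩ := a.runs_compile hσ ha hd.1.1 le_rfl
  have k1 := hσ.congr f1 m1
  obtain ⟨ρ, r2, e2, f2, m2⟩ := b.runs_compile k1 hb hd.1.2 (by omega : 64 ≤ 65)
  have k2 := k1.congr (fun i hi => f2 i (by omega)) m2
  have e3 : ρ.reg 64 = a.eval s := by rw [f2 _ (by omega), e1]
  by_cases heq : a.eval s = b.eval s
  · obtain ⟨k, s', u, τ', q1, q2, q3, q4⟩ := h1 heq ρ k2
    exact ⟨k + 1, s', _, τ', Runs.seq r1 (Runs.seq r2 (Runs.ite_true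
      (by simpa [Test.Holds, e3, e2] using heq) q1)), by omega, q3, q4⟩
  · obtain ⟨k, s', u, τ', q1, q2, q3, q4⟩ := h2 heq ρ k2
    exact ⟨k + 1, s', _, τ', Runs.seq r1 (Runs.seq r2 (Runs.ite_false
      (by simpa [Test.Holds, e3, e2] using heq) q1)), by omega, q3, q4⟩

/-- The rule for loops. The invariant `I φ` includes a time credit `φ` for the remaining
iterations. -/
theorem WP.whileLt {a b : Var} {x : Program} {Q : ℕ → AState → Prop} (I : ℕ → AState → Prop)
    {φ : ℕ} (h0 : I φ s)
    (hstep : ∀ φ s, I φ s → s.reg a < s.reg b →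
      WP P x s fun k s' => ∃ ψ, k + 1 + ψ ≤ φ ∧ I ψ s')
    (hend : ∀ k ψ s', k ≤ φ + 1 → I ψ s' → s'.reg b ≤ s'.reg a → Q k s') :
    WP P (whileLt a b x) s Q := by
  -- Every iteration consumes at least one unit of credit, so the credit also proves termination.
  induction φ using Nat.strong_induction_on generalizing s Q with
  | _ φ ih =>
    intro σ hσ
    rcases lt_or_ge (s.reg a) (s.reg b) with hlt | hle
    · obtain ⟨k, s', u, τ, r1, hu, h1, ψ, hψ, hI⟩ := hstep φ s h0 hlt σ hσ
      obtain ⟨l, s'', w, ρ, r2, hw, h2, hQ⟩ := ih ψ (by omega) hI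
        (Q := fun l s'' => Q (k + 1 + l) s'')
        (fun l ψ' s'' hl hI' hle' => hend _ ψ' s'' (by omega) hI' hle') τ h1
      exact ⟨k + 1 + l, s'', u + 1 + w, ρ, Runs.while_true
        (by simpa [Test.Holds, hσ.reg] using hlt) r1 r2, by omega, h2, hQ⟩
    · exact ⟨1, s, 1, σ, Runs.while_false (by simpa [Test.Holds, hσ.reg] using hle), by omega, hσ,
        hend 1 φ s (by omega) h0 hle⟩

/-- `for v = 0, …, lim - 1 do x`. -/
def forLoop (v lim : Var) (x : Program) : Program :=
  .seq (assign v 0) (whileLt v lim (.seq x (assign v (v + 1 : Expr))))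

/-- The rule for counting loops; `b` bounds the time of the body. -/
theorem WP.forLoop {v lim : Var} {x : Program} {Q : ℕ → AState → Prop} (I : ℕ → AState → Prop)
    (b m : ℕ) (hne : lim ≠ v) (hlim : s.reg lim = m) (h0 : I 0 (s.set v 0))
    (hstep : ∀ i < m, ∀ s, s.reg v = i → s.reg lim = m → I i s →
      WP P x s fun k s' => k ≤ b ∧ s'.reg v = i ∧ s'.reg lim = m ∧ I (i + 1) (s'.set v (i + 1)))
    (hend : ∀ k s', k ≤ m * (b + 2) + 2 → s'.reg v = m → s'.reg lim = m → I m s' → Q k s') :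
    WP P (forLoop v lim x) s Q := by
  refine WP.seq (WP.assign 0 (by simp) (by simp) (by simp) ?_)
  refine WP.whileLt (φ := m * (b + 2)) (fun φ s => ∃ i, i ≤ m ∧ φ = (m - i) * (b + 2) ∧
    s.reg v = i ∧ s.reg lim = m ∧ I i s) ?_ ?_ ?_
  · exact ⟨0, by omega, by simp, by simp, by simp [hne, hlim], h0⟩
  · rintro φ s ⟨i, him, rfl, hv, hl, hI⟩ hlt
    have hi : i < m := by omega
    have key : (m - i) * (b + 2) = (m - (i + 1)) * (b + 2) + (b + 2) := by
      rw [show m - i = (m - (i + 1)) + 1 by omega]; ring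
    have hd : (v + 1 : Expr).deg ≤ 64 ∧ (v + 1 : Expr).cost ≤ 50 :=
      ⟨by change 1 + 1 + 1 ≤ 64; decide, by change 1 + (1 + 1) ≤ 50; decide⟩
    refine WP.seq ((hstep i hi s hv hl hI).mono ?_)
    rintro k s' ⟨hk, hv', hl', hI'⟩ σ hσ
    have hmB : m ≤ P.B := hl' ▸ hσ.reg_le lim
    refine WP.assign (i + 1) (by simp) (by simp [hv']) (by omega) ?_ hd σ hσ
    refine ⟨(m - (i + 1)) * (b + 2), by omega, i + 1, by omega, rfl, by simp,
      by simp [hne, hl'], hI'⟩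
  · rintro k ψ s' hk ⟨i, him, rfl, hv, hl, hI⟩ hle
    have : i = m := by omega
    subst this
    exact hend _ _ (by omega) hv hl hI

end GridFinding

namespace GridFinding

/-! ## Partitions from chains of endpoints -/

/-- `lo i, hi i` for `i < r` are the endpoints of consecutive intervals. -/
def Chain (r : ℕ) (lo hi : ℕ → ℕ) : Prop :=
  (∀ i < r, 1 ≤ lo i ∧ lo i ≤ hi i) ∧ ∀ i, i + 1 < r → lo (i + 1) = hi i + 1

theorem Chain.hi_lt_lo {r : ℕ} {lo hi : ℕ → ℕ} (h : Chain r lo hi) {i j : ℕ} (hij : i < j)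
    (hj : j < r) : hi i < lo j := by
  induction j, hij using Nat.le_induction with
  | base => rw [h.2 i hj]; omega
  | succ j hij ih =>
    have := ih (by omega)
    have := h.1 j (by omega)
    rw [h.2 j hj]; omega

theorem Chain.exists_mem {r : ℕ} {lo hi : ℕ → ℕ} (h : Chain r lo hi) {n : ℕ} (h1 : lo 0 ≤ n)
    {k : ℕ} (hk : k < r) (h2 : n ≤ hi k) : ∃ i < r, lo i ≤ n ∧ n ≤ hi i := by
  induction k with
  | zero => exact ⟨0, hk, h1, h2⟩
  | succ k ih =>
    rcases le_or_gt n (hi k) with hle | hgt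
    · exact ih (by omega) hle
    · exact ⟨k + 1, hk, by rw [h.2 k hk]; omega, h2⟩

theorem Chain.exists_isPartition {r : ℕ} {lo hi : ℕ → ℕ} (h : Chain r lo hi) (hr : 1 ≤ r) :
    ∃ (I : Interval) (P : Fin r → Interval), IsPartition P I ∧
      ∀ i, (P i).lo = lo i ∧ (P i).hi = hi i := by
  have h0 := h.1 0 (by omega)
  have hlast := h.1 (r - 1) (by omega)
  have hle : lo 0 ≤ hi (r - 1) := by
    rcases Nat.eq_zero_or_pos (r - 1) with e | e
    · rw [e]; exact h0.2
    · have := h.hi_lt_lo e (by omega); omega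
  refine ⟨⟨lo 0, hi (r - 1), h0.1, hle⟩,
    fun i => ⟨lo i, hi i, (h.1 i i.2).1, (h.1 i i.2).2⟩, ⟨?_, ?_, ?_⟩, fun i => ⟨rfl, rfl⟩⟩
  · intro i j hij
    rw [Finset.disjoint_left]
    intro a ha hb
    simp only [Interval.toFinset, Finset.mem_Icc] at ha hb
    rcases lt_or_gt_of_ne hij with hlt | hlt
    · have := h.hi_lt_lo hlt j.2; omega
    · have := h.hi_lt_lo hlt i.2; omega
  · intro n
    simp only [Interval.toFinset, Finset.mem_Icc]
    constructor
    · rintro ⟨h1, h2⟩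
      obtain ⟨i, hi, h3⟩ := h.exists_mem h1 (by omega : r - 1 < r) h2
      exact ⟨⟨i, hi⟩, h3⟩
    · rintro ⟨i, h1, h2⟩
      constructor
      · rcases Nat.eq_zero_or_pos (i : ℕ) with e | e
        · rwa [e] at h1
        · have := h.hi_lt_lo e i.2; omega
      · rcases Nat.lt_or_ge (i : ℕ) (r - 1) with e | e
        · have := h.hi_lt_lo e (by omega); omega
        · rwa [show r - 1 = i by omega]
  · intro i j hij
    exact h.hi_lt_lo hij j.2

/-! ## Blocks -/

/-- The number of the block of length `R` that contains the positive integer `x`. -/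
def up (R x : ℕ) : ℕ := (x - 1) / R + 1

/-- This makes iterated contraction a single contraction at a coarser scale, so that only the scale
has to be remembered. -/
theorem up_up (R s x : ℕ) : up R (up s x) = up (s * R) x := by
  simp [up, Nat.div_div_eq_div_mul]

theorem up_one {x : ℕ} (hx : 1 ≤ x) : up 1 x = x := by simp [up]; omega

theorem one_le_up (R x : ℕ) : 1 ≤ up R x := by simp [up]

theorem up_mono (R : ℕ) {x y : ℕ} (h : x ≤ y) : up R x ≤ up R y :=
  Nat.succ_le_succ (Nat.div_le_div_right (by omega))

theorem up_eq_iff {R x X : ℕ} (hR : 0 < R) (hx : 1 ≤ x) (hX : 1 ≤ X) :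
    up R x = X ↔ R * (X - 1) < x ∧ x ≤ R * X := by
  obtain ⟨Y, rfl⟩ : ∃ Y, X = Y + 1 := ⟨X - 1, by omega⟩
  simp only [up, Nat.add_sub_cancel, Nat.add_right_cancel_iff, Nat.div_eq_iff hR]
  have e : R * (Y + 1) = Y * R + R := by ring
  have e' : R * Y = Y * R := by ring
  rw [e, e']
  omega

/-- The reason for the term `p + q - 2`: in `(p - 1) + (q - 1)` both summands are divided by `R` and
rounded down, so contraction loses nothing to rounding. -/
theorem mul_up_sub_le {R : ℕ} {p q : ℕ} (hp : 1 ≤ p) (hq : 1 ≤ q) :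
    R * (up R p + up R q - 2) ≤ p + q - 2 := by
  have h1 := Nat.mul_div_le (p - 1) R
  have h2 := Nat.mul_div_le (q - 1) R
  have e : up R p + up R q - 2 = (p - 1) / R + (q - 1) / R := by
    simp only [up]
    generalize (p - 1) / R = a
    generalize (q - 1) / R = b
    omega
  rw [e, Nat.mul_add]
  omega

/-- The nonempty blocks of a point set. -/
def blocks (R : ℕ) (S : Finset (ℕ × ℕ)) : Finset (ℕ × ℕ) :=
  S.image fun z => (up R z.1, up R z.2)

/-- The first `r` elements of `{0, …, m - 1}` that satisfy `G`. -/
noncomputable def firstN (r : ℕ) (G : ℕ → Prop) (m : ℕ) : Finset ℕ := by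
  classical
  exact (Finset.range m).filter fun c => G c ∧ ((Finset.range c).filter G).card < r

open Classical in
theorem mem_firstN {r : ℕ} {G : ℕ → Prop} {m c : ℕ} :
    c ∈ firstN r G m ↔ c < m ∧ G c ∧ ((Finset.range c).filter G).card < r := by
  simp [firstN]

theorem firstN_succ_of_not {r : ℕ} {G : ℕ → Prop} {m : ℕ} (h : ¬ m ∈ firstN r G (m + 1)) :
    firstN r G (m + 1) = firstN r G m := by
  ext c
  simp only [mem_firstN] at h ⊢
  constructor
  · rintro ⟨h1, h2⟩
    rcases Nat.lt_or_ge c m with h3 | h3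
    · exact ⟨h3, h2⟩
    · obtain rfl : c = m := by omega
      exact absurd ⟨h1, h2⟩ h
  · rintro ⟨h1, h2⟩
    exact ⟨by omega, h2⟩

theorem firstN_succ_of_mem {r : ℕ} {G : ℕ → Prop} {m : ℕ} (h : m ∈ firstN r G (m + 1)) :
    firstN r G (m + 1) = insert m (firstN r G m) := by
  ext c
  simp only [mem_firstN, Finset.mem_insert] at h ⊢
  constructor
  · rintro ⟨h1, h2⟩
    rcases Nat.lt_or_ge c m with h3 | h3
    · exact Or.inr ⟨h3, h2⟩
    · exact Or.inl (by omega)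
  · rintro (rfl | ⟨h1, h2⟩)
    · exact h
    · exact ⟨by omega, h2⟩

open Classical in
theorem card_firstN (r : ℕ) (G : ℕ → Prop) (m : ℕ) :
    (firstN r G m).card = min r ((Finset.range m).filter G).card := by
  induction m with
  | zero => simp [firstN]
  | succ m ih =>
    have hm : m ∉ firstN r G m := by simp [mem_firstN]
    have hm' : m ∉ (Finset.range m).filter G := by simp
    rw [Finset.range_add_one, Finset.filter_insert]
    by_cases h : m ∈ firstN r G (m + 1)
    · rw [firstN_succ_of_mem h, Finset.card_insert_of_notMem hm, ih]
      obtain ⟨-, h1, h2⟩ := mem_firstN.1 h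
      rw [if_pos h1, Finset.card_insert_of_notMem hm']
      omega
    · rw [firstN_succ_of_not h, ih]
      by_cases h1 : G m
      · rw [if_pos h1, Finset.card_insert_of_notMem hm']
        have : ¬ ((Finset.range m).filter G).card < r := fun h2 =>
          h (mem_firstN.2 ⟨by omega, h1, h2⟩)
        omega
      · rw [if_neg h1]

theorem card_firstN_le (r : ℕ) (G : ℕ → Prop) (m : ℕ) : (firstN r G m).card ≤ r := by
  classical
  rw [card_firstN]; omega

/-- The right-hand side is what a loop that counts the elements selected so far can test. -/
theorem mem_firstN_succ {r : ℕ} {G : ℕ → Prop} {m : ℕ} :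
    m ∈ firstN r G (m + 1) ↔ G m ∧ (firstN r G m).card < r := by
  classical
  rw [mem_firstN, card_firstN]
  constructor
  · rintro ⟨-, h1, h2⟩; exact ⟨h1, by omega⟩
  · rintro ⟨h1, h2⟩; exact ⟨by omega, h1, by omega⟩

theorem firstN_subset (r : ℕ) (G : ℕ → Prop) (m : ℕ) : firstN r G m ⊆ Finset.range m := by
  intro c hc
  exact Finset.mem_range.2 (mem_firstN.1 hc).1

/-! ### Codes of sets -/

/-- The set `A ∩ {0, …, m - 1}`, written as a number in base `R`. -/
def code (R : ℕ) (A : Finset ℕ) : ℕ → ℕ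
  | 0 => 0
  | m + 1 => if m ∈ A then code R A m * R + m else code R A m

theorem code_eq_ofDigits (R : ℕ) (A : Finset ℕ) (m : ℕ) :
    code R A m = Nat.ofDigits R ((List.range m).filter (· ∈ A)).reverse := by
  induction m with
  | zero => simp [code]
  | succ m ih =>
    rw [List.range_succ, List.filter_append, List.reverse_append, code]
    by_cases h : m ∈ A
    · simp [h, ih, Nat.ofDigits_cons]; ring
    · simp [h, ih]

theorem length_filter_range (A : Finset ℕ) {m : ℕ} (hA : A ⊆ Finset.range m) :
    ((List.range m).filter (· ∈ A)).length = A.card := by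
  rw [← List.toFinset_card_of_nodup (List.nodup_range.filter _)]
  congr 1
  ext c
  simp only [List.mem_toFinset, List.mem_filter, List.mem_range, decide_eq_true_eq]
  exact ⟨fun h => h.2, fun h => ⟨Finset.mem_range.1 (hA h), h⟩⟩

theorem code_lt {R : ℕ} {A : Finset ℕ} (hA : A ⊆ Finset.range R) (hR : 2 ≤ R) :
    code R A R < R ^ A.card := by
  rw [code_eq_ofDigits]
  have := Nat.ofDigits_lt_base_pow_length (l := ((List.range R).filter (· ∈ A)).reverse)
    (b := R) (by omega) (by intro x hx; simp at hx; exact hx.1)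
  rwa [List.length_reverse, length_filter_range A hA] at this

theorem code_le_of_le (R : ℕ) (hR : 1 ≤ R) (A : Finset ℕ) {m n : ℕ} (h : m ≤ n) :
    code R A m ≤ code R A n := by
  induction n, h using Nat.le_induction with
  | base => rfl
  | succ n _ ih =>
    rw [code]
    split_ifs
    · have := Nat.le_mul_of_pos_right (code R A n) hR
      omega
    · exact ih

/-- The elements are the base-`R` digits in order. Equal cardinality is needed because the element 0
is a leading zero digit and does not change the number. -/
theorem code_injective {R : ℕ} {A A' : Finset ℕ} (hA : A ⊆ Finset.range R)
    (hA' : A' ⊆ Finset.range R) (hR : 2 ≤ R) (hcard : A.card = A'.card)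
    (h : code R A R = code R A' R) : A = A' := by
  rw [code_eq_ofDigits, code_eq_ofDigits] at h
  have := Nat.ofDigits_inj_of_len_eq (b := R) (by omega)
    (by rw [List.length_reverse, List.length_reverse, length_filter_range A hA,
      length_filter_range A' hA', hcard])
    (by intro x hx; simp at hx; exact hx.1) (by intro x hx; simp at hx; exact hx.1) h
  rw [List.reverse_inj] at this
  ext c
  have h1 : c ∈ (List.range R).filter (· ∈ A) ↔ c ∈ (List.range R).filter (· ∈ A') := by
    rw [this]
  simp only [List.mem_filter, List.mem_range, decide_eq_true_eq] at h1
  constructor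
  · intro h2; exact (h1.1 ⟨Finset.mem_range.1 (hA h2), h2⟩).2
  · intro h2; exact (h1.2 ⟨Finset.mem_range.1 (hA' h2), h2⟩).2

theorem code_congr {R : ℕ} {A A' : Finset ℕ} {m : ℕ} (h : ∀ c < m, c ∈ A ↔ c ∈ A') :
    code R A m = code R A' m := by
  induction m with
  | zero => rfl
  | succ m ih => rw [code, code, ih fun c hc => h c (by omega)]; simp [h m (by omega)]

/-! ### Wide blocks -/

/-- Column `x` of the point set `S` contains a point in the `Y`-th block of rows. -/
def Occ (R : ℕ) (S : Finset (ℕ × ℕ)) (x Y : ℕ) : Prop := ∃ z ∈ S, z.1 = x ∧ up R z.2 = Y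

/-- The first `r` nonempty columns of block `(X, Y)`, numbered from `0` on within the block. -/
noncomputable def sel (r : ℕ) (S : Finset (ℕ × ℕ)) (X Y : ℕ) : Finset ℕ :=
  firstN r (fun c => Occ (r ^ 2) S ((X - 1) * r ^ 2 + 1 + c) Y) (r ^ 2)

/-- The code of the first `r` nonempty columns of a block. -/
noncomputable def selCode (r : ℕ) (S : Finset (ℕ × ℕ)) (X Y : ℕ) : ℕ :=
  code (r ^ 2) (sel r S X Y) (r ^ 2)

/-- The blocks in `B` in the `X`-th block of columns with `r` nonempty columns of code `K`. -/
noncomputable def alikeIn (r : ℕ) (S B : Finset (ℕ × ℕ)) (X K : ℕ) : Finset (ℕ × ℕ) := by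
  classical
  exact B.filter fun b => b.1 = X ∧ (sel r S b.1 b.2).card = r ∧ selCode r S b.1 b.2 = K

theorem mem_alikeIn {r : ℕ} {S B : Finset (ℕ × ℕ)} {X K : ℕ} {b : ℕ × ℕ} :
    b ∈ alikeIn r S B X K ↔ b ∈ B ∧ b.1 = X ∧ (sel r S b.1 b.2).card = r ∧
      selCode r S b.1 b.2 = K := by
  simp [alikeIn]

theorem alikeIn_subset (r : ℕ) (S B : Finset (ℕ × ℕ)) (X K : ℕ) : alikeIn r S B X K ⊆ B :=
  fun _ hb => (mem_alikeIn.1 hb).1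

theorem alikeIn_empty (r : ℕ) (S : Finset (ℕ × ℕ)) (X K : ℕ) : alikeIn r S ∅ X K = ∅ := by
  simp [alikeIn]

theorem alikeIn_insert_of_pos {r : ℕ} {S B : Finset (ℕ × ℕ)} {b : ℕ × ℕ}
    (h : (sel r S b.1 b.2).card = r) :
    alikeIn r S (insert b B) b.1 (selCode r S b.1 b.2) =
      insert b (alikeIn r S B b.1 (selCode r S b.1 b.2)) := by
  classical
  simp [alikeIn, Finset.filter_insert, h]

theorem alikeIn_insert_of_neg {r : ℕ} {S B : Finset (ℕ × ℕ)} {X K : ℕ} {b : ℕ × ℕ}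
    (h : ¬ (b.1 = X ∧ (sel r S b.1 b.2).card = r ∧ selCode r S b.1 b.2 = K)) :
    alikeIn r S (insert b B) X K = alikeIn r S B X K := by
  classical
  simp only [alikeIn, Finset.filter_insert, if_neg h]

/-- `r` blocks above each other have nonempty columns in the same `r` places. -/
def Dense (r : ℕ) (S : Finset (ℕ × ℕ)) : Prop := ∃ X K, r ≤ (alikeIn r S (blocks (r ^ 2) S) X K).card

theorem sel_subset (r : ℕ) (S : Finset (ℕ × ℕ)) (X Y : ℕ) : sel r S X Y ⊆ Finset.range (r ^ 2) :=
  firstN_subset _ _ _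

/-- The nonempty blocks with at least `r` nonempty columns. -/
noncomputable def wide (r : ℕ) (S : Finset (ℕ × ℕ)) : Finset (ℕ × ℕ) := by
  classical
  exact (blocks (r ^ 2) S).filter fun b => (sel r S b.1 b.2).card = r

/-- Pigeonhole twice: over the block columns, and within one over the `C(r², r)` possible sets of
selected columns, each of which occurs fewer than `r` times. -/
theorem card_wide_le {r p q : ℕ} (hr : 1 ≤ r) {S : Finset (ℕ × ℕ)}
    (hS : S ⊆ Finset.Icc 1 p ×ˢ Finset.Icc 1 q) (h : ¬ Dense r S) :
    (wide r S).card ≤ (r - 1) * (r ^ 2).choose r * up (r ^ 2) p := by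
  classical
  have hmem : ∀ b ∈ wide r S, b.1 ∈ Finset.Icc 1 (up (r ^ 2) p) := by
    intro b hb
    simp only [wide, blocks, Finset.mem_filter, Finset.mem_image] at hb
    obtain ⟨⟨z, hz, rfl⟩, -⟩ := hb
    have := hS hz
    simp only [Finset.mem_product, Finset.mem_Icc] at this
    exact Finset.mem_Icc.2 ⟨one_le_up _ _, up_mono _ this.1.2⟩
  have h1 := Finset.card_le_mul_card_image_of_maps_to hmem ((r - 1) * (r ^ 2).choose r) ?_
  · simpa using h1
  intro X _
  have hmem' : ∀ b ∈ (wide r S).filter (fun b => b.1 = X),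
      sel r S b.1 b.2 ∈ (Finset.range (r ^ 2)).powersetCard r := by
    intro b hb
    simp only [wide, Finset.mem_filter] at hb
    exact Finset.mem_powersetCard.2 ⟨sel_subset _ _ _ _, hb.1.2⟩
  have h2 := Finset.card_le_mul_card_image_of_maps_to hmem' (r - 1) ?_
  · simpa using h2
  intro A _
  refine le_trans (Finset.card_le_card (t := alikeIn r S (blocks (r ^ 2) S) X (code (r ^ 2) A (r ^ 2))) ?_) ?_
  · intro b hb
    simp only [wide, Finset.mem_filter] at hb
    rw [mem_alikeIn]
    exact ⟨hb.1.1.1, hb.1.2, hb.1.1.2, by rw [selCode, hb.2]⟩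
  · by_contra hlt
    exact h ⟨X, code (r ^ 2) A (r ^ 2), by omega⟩

/-! ### Counting points block by block -/

/-- The points of a block. -/
def fiber (R : ℕ) (S : Finset (ℕ × ℕ)) (b : ℕ × ℕ) : Finset (ℕ × ℕ) :=
  S.filter fun z => (up R z.1, up R z.2) = b

theorem exists_local {R x X : ℕ} (hR : 0 < R) (hx : 1 ≤ x) (h : up R x = X) :
    ∃ c < R, x = (X - 1) * R + 1 + c := by
  refine ⟨(x - 1) % R, Nat.mod_lt _ hR, ?_⟩
  rw [← h, up, Nat.add_sub_cancel]
  have := Nat.div_add_mod' (x - 1) R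
  omega

open Classical in
-- Each point of a block lies in a nonempty column and in a nonempty row of it.
theorem card_fiber_le {R : ℕ} (hR : 0 < R) {S : Finset (ℕ × ℕ)}
    (hS : ∀ z ∈ S, 1 ≤ z.1 ∧ 1 ≤ z.2) (X Y : ℕ) :
    (fiber R S (X, Y)).card ≤
      ((Finset.range R).filter fun c => Occ R S ((X - 1) * R + 1 + c) Y).card *
      ((Finset.range R).filter fun c =>
        Occ R (S.image Prod.swap) ((Y - 1) * R + 1 + c) X).card := by
  rw [← Finset.card_product]
  refine Finset.card_le_card_of_surjOn
    (fun c => ((X - 1) * R + 1 + c.1, (Y - 1) * R + 1 + c.2)) ?_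
  intro z hz
  simp only [fiber, Finset.coe_filter, Set.mem_ofPred_eq, Prod.mk.injEq] at hz
  obtain ⟨hz, h1, h2⟩ := hz
  obtain ⟨c, hc, e1⟩ := exists_local hR (hS z hz).1 h1
  obtain ⟨d, hd, e2⟩ := exists_local hR (hS z hz).2 h2
  refine ⟨(c, d), ?_, by simp [← e1, ← e2]⟩
  simp only [Finset.coe_product, Finset.coe_filter, Set.mem_prod, Set.mem_ofPred_eq,
    Finset.mem_range]
  exact ⟨⟨hc, z, hz, e1, h2⟩, hd, z.swap, Finset.mem_image_of_mem _ hz, e2, h1⟩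

/-- The binomial coefficient is the product of the fractions `(r² - k) / (r - k)` for `k < r`, each
at least `r`. Besides a lower bound for `f`, this shows that codes of column sets fit into words. -/
theorem pow_self_le_choose (r : ℕ) : r ^ r ≤ (r ^ 2).choose r := by
  have key : ∀ k ≤ r, r.descFactorial k * r ^ k ≤ (r ^ 2).descFactorial k := by
    intro k hk
    induction k with
    | zero => simp
    | succ k ih =>
      rw [Nat.descFactorial_succ, Nat.descFactorial_succ, pow_succ]
      have h1 : (r - k) * r ≤ r ^ 2 - k := by
        rw [Nat.sub_mul, sq]
        have : k * 1 ≤ k * r := Nat.mul_le_mul_left k (by omega)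
        omega
      calc (r - k) * r.descFactorial k * (r ^ k * r)
          = ((r - k) * r) * (r.descFactorial k * r ^ k) := by ring
        _ ≤ (r ^ 2 - k) * (r ^ 2).descFactorial k := Nat.mul_le_mul h1 (ih (by omega))
  have h := key r le_rfl
  rw [Nat.descFactorial_self, Nat.descFactorial_eq_factorial_mul_choose] at h
  exact Nat.le_of_mul_le_mul_left h (Nat.factorial_pos r)

theorem sixteen_mul_le_f {r : ℕ} (hr : 2 ≤ r) : 16 * r ^ 2 ≤ f r := by
  have h1 := pow_self_le_choose r
  have h2 : 2 ^ 2 ≤ r ^ 2 := Nat.pow_le_pow_left hr 2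
  have h3 : r ^ 2 ≤ r ^ r := Nat.pow_le_pow_right (by omega) hr
  calc 16 * r ^ 2 = 4 * 4 * r ^ 2 := by ring
    _ ≤ (r ^ 2) * (r ^ 2).choose r * r ^ 2 := by gcongr <;> omega
    _ = f r := by simp only [f]; ring

/-- A small rectangle cannot hold so many points: with `a = p - 1` and `b = q - 1`, the area gives
`N ≤ a * b + a + b`, which for `a + b < 2 * r²` is below `16 * r² * (a + b) ≤ N`. -/
theorem two_mul_le_of_card {r p q N : ℕ} (hr : 2 ≤ r) (hpq : 1 ≤ p + q - 2)
    (hN : f r * (p + q - 2) ≤ N) (hcard : N + 1 ≤ p * q) (hp : 1 ≤ p) (hq : 1 ≤ q) :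
    2 * r ^ 2 ≤ p + q - 2 := by
  by_contra hlt
  push Not at hlt
  have h16 := sixteen_mul_le_f hr
  obtain ⟨a, rfl⟩ : ∃ a, p = a + 1 := ⟨p - 1, by omega⟩
  obtain ⟨b, rfl⟩ : ∃ b, q = b + 1 := ⟨q - 1, by omega⟩
  have e : a + 1 + (b + 1) - 2 = a + b := by omega
  rw [e] at hpq hN hlt
  have h1 : (a + 1) * (b + 1) = a * b + (a + b) + 1 := by ring
  have h2 : a * b ≤ (a + b) * (a + b) := by nlinarith
  have h3 : (a + b) * (a + b) ≤ 2 * r ^ 2 * (a + b) := Nat.mul_le_mul_right _ hlt.le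
  have h4 : 16 * r ^ 2 * (a + b) ≤ f r * (a + b) := Nat.mul_le_mul_right _ h16
  have h5 : 1 * (a + b) ≤ r ^ 2 * (a + b) := Nat.mul_le_mul_right _ (by nlinarith)
  nlinarith

/-- Sum over the nonempty blocks: `(r - 1)²` for each, plus `r⁴` for each wide and each tall block.
The factor `r⁴ * C(r², r)` from the latter is `f r`. -/
theorem card_le_of_not_dense {r p q : ℕ} (hr : 2 ≤ r) {S : Finset (ℕ × ℕ)}
    (hS : S ⊆ Finset.Icc 1 p ×ˢ Finset.Icc 1 q) (h : ¬ Dense r S)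
    (h' : ¬ Dense r (S.image Prod.swap)) :
    S.card ≤ (r - 1) ^ 2 * (blocks (r ^ 2) S).card +
      f r * (r - 1) * (up (r ^ 2) p + up (r ^ 2) q) := by
  classical
  have hR : 0 < r ^ 2 := by positivity
  have hpos : ∀ z ∈ S, 1 ≤ z.1 ∧ 1 ≤ z.2 := by
    intro z hz
    have := hS hz
    simp only [Finset.mem_product, Finset.mem_Icc] at this
    exact ⟨this.1.1, this.2.1⟩
  have hS' : S.image Prod.swap ⊆ Finset.Icc 1 q ×ˢ Finset.Icc 1 p := by
    intro z hz
    obtain ⟨w, hw, rfl⟩ := Finset.mem_image.1 hz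
    have := hS hw
    simp only [Finset.mem_product, Finset.mem_Icc] at this ⊢
    exact ⟨this.2, this.1⟩
  have hw1 := card_wide_le (by omega) hS h
  have hw2 := card_wide_le (by omega) hS' h'
  -- Tall blocks are the wide blocks of the transpose, here counted in the original coordinates.
  have hw2' : ((blocks (r ^ 2) S).filter fun b =>
      (sel r (S.image Prod.swap) b.2 b.1).card = r).card ≤ (wide r (S.image Prod.swap)).card := by
    refine Finset.card_le_card_of_injOn Prod.swap ?_ Prod.swap_injective.injOn
    intro b hb
    simp only [Finset.coe_filter, Set.mem_ofPred_eq, blocks, Finset.mem_image] at hb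
    obtain ⟨⟨z, hz, rfl⟩, hb⟩ := hb
    simp only [wide, blocks, Finset.coe_filter, Set.mem_ofPred_eq, Finset.mem_image]
    exact ⟨⟨z.swap, ⟨z, hz, rfl⟩, rfl⟩, hb⟩
  have hsum : S.card = ∑ b ∈ blocks (r ^ 2) S, (fiber (r ^ 2) S b).card :=
    Finset.card_eq_sum_card_image _ _
  have hfib : ∀ b ∈ blocks (r ^ 2) S, (fiber (r ^ 2) S b).card ≤ (r - 1) ^ 2 +
      ((if (sel r S b.1 b.2).card = r then r ^ 4 else 0) +
      (if (sel r (S.image Prod.swap) b.2 b.1).card = r then r ^ 4 else 0)) := by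
    rintro ⟨X, Y⟩ -
    have h1 := card_fiber_le hR hpos X Y
    set A := (Finset.range (r ^ 2)).filter fun c => Occ (r ^ 2) S ((X - 1) * r ^ 2 + 1 + c) Y
    set A' := (Finset.range (r ^ 2)).filter fun c =>
      Occ (r ^ 2) (S.image Prod.swap) ((Y - 1) * r ^ 2 + 1 + c) X
    have a1 : (sel r S X Y).card = min r A.card := card_firstN _ _ _
    have a2 : (sel r (S.image Prod.swap) Y X).card = min r A'.card := card_firstN _ _ _
    have b1 : A.card ≤ r ^ 2 := by simpa using Finset.card_filter_le (Finset.range (r ^ 2)) _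
    have b2 : A'.card ≤ r ^ 2 := by simpa using Finset.card_filter_le (Finset.range (r ^ 2)) _
    have b3 : A.card * A'.card ≤ r ^ 4 := by
      calc A.card * A'.card ≤ r ^ 2 * r ^ 2 := Nat.mul_le_mul b1 b2
        _ = r ^ 4 := by ring
    simp only [a1, a2]
    split_ifs with c1 c2
    · omega
    · omega
    · omega
    · have : A.card * A'.card ≤ (r - 1) ^ 2 := by
        rw [sq]; exact Nat.mul_le_mul (by omega) (by omega)
      omega
  have htot := Finset.sum_le_sum hfib
  rw [← hsum, Finset.sum_add_distrib, Finset.sum_add_distrib, ← Finset.sum_filter,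
    ← Finset.sum_filter, Finset.sum_const, Finset.sum_const, Finset.sum_const] at htot
  simp only [smul_eq_mul] at htot
  have k1 : ((blocks (r ^ 2) S).filter fun b => (sel r S b.1 b.2).card = r).card * r ^ 4 ≤
      (r - 1) * (r ^ 2).choose r * up (r ^ 2) p * r ^ 4 := Nat.mul_le_mul_right _ hw1
  have k2 := Nat.mul_le_mul_right (r ^ 4) (hw2'.trans hw2)
  have e : f r * (r - 1) * (up (r ^ 2) p + up (r ^ 2) q) =
      (r - 1) * (r ^ 2).choose r * up (r ^ 2) p * r ^ 4 +
      (r - 1) * (r ^ 2).choose r * up (r ^ 2) q * r ^ 4 := by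
    simp only [f]; ring
  rw [e]
  calc S.card ≤ _ := htot
    _ ≤ _ := by rw [mul_comm (blocks (r ^ 2) S).card]; omega

theorem subset_bounds {p q N : ℕ} {S : Finset (ℕ × ℕ)}
    (hS : S ⊆ Finset.Icc 1 p ×ˢ Finset.Icc 1 q) (hcard : S.card = N + 1) :
    1 ≤ p ∧ 1 ≤ q ∧ N + 1 ≤ p * q := by
  have h1 := Finset.card_le_card hS
  simp only [Finset.card_product, Nat.card_Icc, Nat.add_sub_cancel, hcard] at h1
  refine ⟨?_, ?_, h1⟩
  · by_contra h; obtain rfl : p = 0 := by omega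
    omega
  · by_contra h; obtain rfl : q = 0 := by omega
    omega

/-- The counting argument of Marcus and Tardos: if contracting blocks reduces the number of points
too much, then the point set or its transpose is dense. -/
theorem dense_or_dense {r p q N : ℕ} (hr : 2 ≤ r) {S : Finset (ℕ × ℕ)}
    (hS : S ⊆ Finset.Icc 1 p ×ˢ Finset.Icc 1 q) (hcard : S.card = N + 1) (hpq : 1 ≤ p + q - 2)
    (hN : f r * (p + q - 2) ≤ N) (hB : (blocks (r ^ 2) S).card ≤ N / r ^ 2) :
    Dense r S ∨ Dense r (S.image Prod.swap) := by
  by_contra hcon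
  push Not at hcon
  have h1 := card_le_of_not_dense hr hS hcon.1 hcon.2
  obtain ⟨hp, hq, hle⟩ := subset_bounds hS hcard
  have h2 := two_mul_le_of_card hr hpq hN hle hp hq
  have h3 := mul_up_sub_le (R := r ^ 2) hp hq
  have hR : 0 < r ^ 2 := by positivity
  have u1 := one_le_up (r ^ 2) p
  have u2 := one_le_up (r ^ 2) q
  set P := p + q - 2
  set D := N / r ^ 2 with hD
  obtain ⟨P', hP'⟩ : ∃ P', up (r ^ 2) p + up (r ^ 2) q = P' + 2 :=
    ⟨up (r ^ 2) p + up (r ^ 2) q - 2, by omega⟩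
  rw [hP', Nat.add_sub_cancel] at h3
  rw [hP', hcard] at h1
  have h4 : f r * P' ≤ D := by
    rw [hD, Nat.le_div_iff_mul_le hR]
    calc f r * P' * r ^ 2 = f r * (r ^ 2 * P') := by ring
      _ ≤ f r * P := Nat.mul_le_mul_left _ h3
      _ ≤ N := hN
  have h5 : r ^ 2 * D ≤ N := Nat.mul_div_le _ _
  have h6 : f r * (2 * r ^ 2) ≤ N := (Nat.mul_le_mul_left _ h2).trans hN
  obtain ⟨k, rfl⟩ : ∃ k, r = k + 1 := ⟨r - 1, by omega⟩
  rw [Nat.add_sub_cancel] at h1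
  -- Here `r = k + 1`. The two terms in `D` add up to `k * r * D`, slightly less than `r² * D ≤ N`.
  -- Multiplying by `r` shows that the gap exceeds the error term `2 * k * f r`, since `2 * r² * f r
  -- ≤ N`.
  have h7 : N + 1 ≤ k ^ 2 * D + k * (D + 2 * f (k + 1)) := by
    calc N + 1 ≤ _ := h1
      _ ≤ k ^ 2 * D + f (k + 1) * k * (P' + 2) := by gcongr
      _ = k ^ 2 * D + k * (f (k + 1) * P' + 2 * f (k + 1)) := by ring
      _ ≤ _ := by gcongr
  have h8 : (k + 1) * (N + 1) ≤ k * ((k + 1) ^ 2 * D) + k * (f (k + 1) * (2 * (k + 1))) := by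
    calc (k + 1) * (N + 1) ≤ (k + 1) * (k ^ 2 * D + k * (D + 2 * f (k + 1))) :=
          Nat.mul_le_mul_left _ h7
      _ = _ := by ring
  have h9 : k * ((k + 1) ^ 2 * D) ≤ k * N := Nat.mul_le_mul_left _ h5
  have h10 : k * (f (k + 1) * (2 * (k + 1))) ≤ f (k + 1) * (2 * (k + 1) ^ 2) := by
    calc k * (f (k + 1) * (2 * (k + 1))) = k * (2 * f (k + 1) * (k + 1)) := by ring
      _ ≤ (k + 1) * (2 * f (k + 1) * (k + 1)) := by gcongr; omega
      _ = _ := by ring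
  have e : (k + 1) * (N + 1) = k * N + N + k + 1 := by ring
  omega

end GridFinding

namespace GridFinding

/-! ## The contraction step -/

infixr:60 " ;; " => Program.seq

/-- Represented states have bounded variables; this makes the bounds available for ruling out
overflow. -/
theorem WP.of_bounds {P : Layout} {s : AState} {a : Program} {Q : ℕ → AState → Prop}
    (h : (∀ v, s.reg v ≤ P.B) → WP P a s Q) : WP P a s Q :=
  fun σ hσ => h hσ.reg_le σ hσ

/-- Only the variables in `l` differ. -/
def Frame (l : List Var) (s s' : AState) : Prop := ∀ v, v ∉ l → s'.reg v = s.reg v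

/-- The `k`-th point of the list in table `t`, with coordinates in columns `d` and `e`. -/
def AState.pt (s : AState) (t d e k : ℕ) : ℕ × ℕ := (s.tab t k d, s.tab t k e)

/-- The set of the first `m` points of the list in table `t`. -/
def AState.pts (s : AState) (t d e m : ℕ) : Finset (ℕ × ℕ) := (Finset.range m).image (s.pt t d e)

theorem AState.pts_succ (s : AState) (t d e m : ℕ) :
    s.pts t d e (m + 1) = insert (s.pt t d e m) (s.pts t d e m) := by
  simp [pts, Finset.range_add_one, Finset.image_insert]

theorem AState.pts_congr {s s' : AState} {t d e m : ℕ}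
    (h : ∀ k < m, s'.tab t k d = s.tab t k d ∧ s'.tab t k e = s.tab t k e) :
    s'.pts t d e m = s.pts t d e m := by
  refine Finset.image_congr ?_
  intro k hk
  have := h k (by simpa using hk)
  simp [pt, this]

theorem AState.pts_congr_tab {s s' : AState} {t d e m : ℕ} (h : s'.tab t = s.tab t) :
    s'.pts t d e m = s.pts t d e m := AState.pts_congr fun k _ => by simp [h]

theorem AState.mem_pts {s : AState} {t d e m k : ℕ} (h : k < m) : s.pt t d e k ∈ s.pts t d e m :=
  Finset.mem_image_of_mem _ (Finset.mem_range.2 h)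

section Programs

open Var

/-- Copy the input to table `0`. -/
def copyProg : Program :=
  forLoop j n (putTab 0 j 0 (.low (2 * j)) ;; putTab 0 j 1 (.low (2 * j + 1)))

/-- List the nonempty blocks of the points in table `a` in table `g + 1`. -/
def contractProg : Program :=
  assign cnt 0 ;;
  forLoop j n
    (assign X ((.tab a j 0 - 1) / R + 1) ;;
     assign Y ((.tab a j 1 - 1) / R + 1) ;;
     ifEq (.tab g X Y) 0
       (putTab g X Y 1 ;; putTab (g + 1) cnt 0 X ;; putTab (g + 1) cnt 1 Y ;; assign cnt (cnt + 1))
       .skip)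

end Programs

variable {P : Layout} {s : AState}

/-- The copy frees the input area, into which the grid is finally written. -/
theorem copyProg_spec {m : ℕ} (hn : s.reg .n = m) (hT : 2 * m ≤ P.T) (hZ : 1 < P.Z) (hE : 0 < P.E)
    (hB : ∀ i < 2 * m, s.low i ≤ P.B) :
    WP P copyProg s fun k s' => k ≤ 4 * m + 2 ∧ Frame [.j] s s' ∧ s'.low = s.low ∧
      (∀ t, t ≠ 0 → s'.tab t = s.tab t) ∧
      ∀ i < m, s'.tab 0 i 0 = s.low (2 * i) ∧ s'.tab 0 i 1 = s.low (2 * i + 1) := by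
  refine WP.forLoop (fun i s' => Frame [.j] s s' ∧ s'.low = s.low ∧
      (∀ t, t ≠ 0 → s'.tab t = s.tab t) ∧
      ∀ k < i, s'.tab 0 k 0 = s.low (2 * k) ∧ s'.tab 0 k 1 = s.low (2 * k + 1)) 2 m (by decide) hn
      ⟨?_, rfl, by simp, by simp⟩ ?_ ?_
  · intro v hv
    simp at hv
    simp [hv]
  · rintro i hi s₁ hj hm ⟨hf, hl, ht, hk⟩
    refine WP.seq (WP.putTab 0 i 0 (s.low (2 * i)) (by simp) (by simp) (by simp)
      (by simp [hj]; omega) (by simp [hj, hl]) hE (by omega) (hB _ (by omega)) ?_)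
    refine WP.putTab 0 i 1 (s.low (2 * i + 1)) (by simp) (by simp) (by simp)
      (by simp [hj]; omega) (by simp [hj, hl]) hE (by omega) (hB _ (by omega)) ?_
    refine ⟨by simp, by simpa using hj, by simpa using hm, ?_, by simpa, ?_, ?_⟩
    · intro v hv
      have := hf v hv
      simp at hv
      simp [hv, this]
    · intro t h0
      funext u v
      simp [h0, ht t h0]
    · intro k hki
      rcases Nat.lt_succ_iff_lt_or_eq.1 hki with h | rfl
      · simp [h.ne, hk k h]
      · simp
  · rintro k s' hk - - ⟨hf, hl, ht, h⟩
    exact ⟨by omega, hf, hl, ht, h⟩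

theorem blocks_insert (R : ℕ) (z : ℕ × ℕ) (S : Finset (ℕ × ℕ)) :
    blocks R (insert z S) = insert (up R z.1, up R z.2) (blocks R S) := by
  simp [blocks, Finset.image_insert]

/-- Table `G` is the characteristic function of the blocks met so far, so each block is listed once.
As it is initially zero, the time depends on the number of points but not on the size of the
rectangle. -/
theorem contractProg_spec {A G m p q R : ℕ} (ha : s.reg .a = A) (hg : s.reg .g = G)
    (hn : s.reg .n = m) (hRr : s.reg .R = R) (hAG : A < G) (hE : G + 1 < P.E)
    (hin : s.pts A 0 1 m ⊆ Finset.Icc 1 p ×ˢ Finset.Icc 1 q) (hp : p < P.Z) (hq : q < P.Z)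
    (hZ : 1 < P.Z) (hfresh : ∀ t, G ≤ t → ∀ u v, s.tab t u v = 0) :
    WP P contractProg s fun k s' => k ≤ 10 * m + 3 ∧ Frame [.j, .X, .Y, .cnt] s s' ∧
      s'.low = s.low ∧ (∀ t, t ≠ G → t ≠ G + 1 → s'.tab t = s.tab t) ∧
      s'.reg .cnt = (blocks R (s.pts A 0 1 m)).card ∧
      s'.pts (G + 1) 0 1 (s'.reg .cnt) = blocks R (s.pts A 0 1 m) := by
  have hZB := P.Z_le
  refine WP.of_bounds fun hB => ?_
  have hmB : m ≤ P.B := hn ▸ hB .n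
  refine WP.seq (WP.assign 0 (by simp) (by simp) (by simp) ?_)
  refine WP.forLoop (fun i s' => Frame [.j, .X, .Y, .cnt] s s' ∧ s'.low = s.low ∧
    (∀ t, t ≠ G → t ≠ G + 1 → s'.tab t = s.tab t) ∧
    s'.reg .cnt = (blocks R (s.pts A 0 1 i)).card ∧
    s'.pts (G + 1) 0 1 (s'.reg .cnt) = blocks R (s.pts A 0 1 i) ∧
    ∀ u v, s'.tab G u v = if (u, v) ∈ blocks R (s.pts A 0 1 i) then 1 else 0) 8 m (by decide)
    (by simp [hn]) ⟨?_, rfl, by simp, by simp [blocks, AState.pts],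
      by simp [blocks, AState.pts], ?_⟩ ?_ ?_
  · intro v hv
    simp at hv
    simp [hv]
  · intro u v
    simp [blocks, AState.pts, hfresh G le_rfl]
  · rintro i hi s₁ hj hm ⟨hf, hl, ht, hc, hpts, hseen⟩
    have ha₁ : s₁.reg .a = A := (hf .a (by decide)).trans ha
    have hg₁ : s₁.reg .g = G := (hf .g (by decide)).trans hg
    have hR₁ : s₁.reg .R = R := (hf .R (by decide)).trans hRr
    have htA : s₁.tab A = s.tab A := ht A (by omega) (by omega)
    have hmem := hin (AState.mem_pts (t := A) (d := 0) (e := 1) (s := s) hi)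
    simp only [AState.pt, Finset.mem_product, Finset.mem_Icc] at hmem
    have hx : up R (s.tab A i 0) ≤ p := by
      have := Nat.div_le_self (s.tab A i 0 - 1) R
      simp only [up]; omega
    have hy : up R (s.tab A i 1) ≤ q := by
      have := Nat.div_le_self (s.tab A i 1 - 1) R
      simp only [up]; omega
    have hb := blocks_insert R (s.pt A 0 1 i) (s.pts A 0 1 i)
    rw [← AState.pts_succ] at hb
    simp only [AState.pt] at hb
    set x := up R (s.tab A i 0) with hxdef
    set y := up R (s.tab A i 1) with hydef
    have hcard : (blocks R (s.pts A 0 1 i)).card ≤ i :=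
      Finset.card_image_le.trans (Finset.card_image_le.trans (by simp))
    refine WP.seq (WP.assign x (by simp [ha₁]; omega) (by simp [ha₁, hj, hR₁, htA, hxdef, up])
      (by omega) ?_)
    refine WP.seq (WP.assign y (by simp [ha₁]; omega) (by simp [ha₁, hj, hR₁, htA, hydef, up])
      (by omega) ?_)
    set C := (blocks R (s.pts A 0 1 i)).card
    refine WP.ifEq (by simp [hg₁]; omega) (by simp) ?_ ?_
    · intro h0
      have hnot : (x, y) ∉ blocks R (s.pts A 0 1 i) := by
        intro hin
        simp [hg₁, hseen, hin] at h0
      refine WP.seq (WP.putTab G x y 1 (by simp) (by simp) (by simp) (by simp) (by simp [hg₁])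
        (by omega) (by omega) (by omega) ?_)
      refine WP.seq (WP.putTab (G + 1) C 0 x (by simp) (by simp) (by simp) (by simp)
        (by simp [hg₁, hc]) (by omega) (by omega) (by omega) ?_)
      refine WP.seq (WP.putTab (G + 1) C 1 y (by simp) (by simp) (by simp) (by simp)
        (by simp [hg₁, hc]) (by omega) (by omega) (by omega) ?_)
      refine WP.assign (C + 1) (by simp) (by simp [hc]) (by omega) ?_
      refine ⟨by omega, by simpa using hj, by simpa using hm, ?_, by simpa, ?_, ?_, ?_, ?_⟩
      · intro v hv
        have := hf v hv
        simp at hv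
        simp [hv, this]
      · intro t h1 h2
        funext u v
        simp [h1, h2, ht t h1 h2]
      · rw [hb, Finset.card_insert_of_notMem hnot]
        simp [C]
      · rw [hb, ← hpts, hc]
        simp only [AState.reg_set, AState.reg_setTab, reduceCtorEq, if_true, if_false]
        rw [AState.pts_succ]
        congr 1
        · simp [AState.pt]
        · refine AState.pts_congr ?_
          intro k hk
          simp [hk.ne]
      · intro u v
        rw [hb]
        simp [hseen]
        split_ifs <;> simp_all
    · intro h0
      have hyes : (x, y) ∈ blocks R (s.pts A 0 1 i) := by
        by_contra hin
        simp [hg₁, hseen, hin] at h0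
      rw [Finset.insert_eq_of_mem hyes] at hb
      refine WP.skip ⟨by omega, by simpa using hj, by simpa using hm, ?_, by simpa, ?_, ?_, ?_, ?_⟩
      · intro v hv
        have := hf v hv
        simp at hv
        simp [hv, this]
      · intro t h1 h2
        simp [ht t h1 h2]
      · rw [hb]
        simp [hc, C]
      · rw [hb, ← hpts]
        exact AState.pts_congr_tab rfl
      · intro u v
        rw [hb]
        simp [hseen]
  · rintro k s' hk - - ⟨hf, hl, ht, hc, hpts, -⟩
    exact ⟨by omega, hf, hl, ht, hc, hpts⟩

end GridFinding

namespace GridFinding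

/-! ## The search for similar wide blocks -/

section Programs

open Var

/-- Mark in table `g` which lines meet which blocks of crossing lines. The coordinates of points
are in columns `dx` and `dy`. -/
def fillProg : Program :=
  forLoop j n (putTab g (.tab a j dx) ((.tab a j dy - 1) / R + 1) 1)

/-- Count and encode the first `r` nonempty columns of block `(X, Y)`. -/
def keyProg : Program :=
  assign k 0 ;; assign key 0 ;;
  forLoop c R
    (ifLt k r
      (ifEq (.tab g ((X - 1) * R + 1 + c) Y) 1 (assign key (key * R + c) ;; assign k (k + 1)) .skip)
      .skip)

/-- Search the blocks in table `b` for `r` similar wide ones above each other. -/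
def scanProg : Program :=
  assign found 0 ;;
  forLoop j cnt
    (assign X (.tab b j dx) ;; assign Y (.tab b j dy) ;; keyProg ;;
      ifEq k r
        (putTab (g + 1) X Y (key + 1) ;; assign v (.tab (g + 2) key X + 1) ;;
          putTab (g + 2) key X v ;;
          ifEq v r (assign found 1 ;; assign FX X ;; assign FY Y ;; assign FK key) .skip)
        .skip)

end Programs

variable {P : Layout} {s : AState}

theorem occ_insert {R : ℕ} {z : ℕ × ℕ} {S : Finset (ℕ × ℕ)} {x Y : ℕ} :
    Occ R (insert z S) x Y ↔ (z.1 = x ∧ up R z.2 = Y) ∨ Occ R S x Y := by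
  simp [Occ]

theorem fillProg_spec {A G m p q R d e : ℕ} (ha : s.reg .a = A) (hg : s.reg .g = G)
    (hn : s.reg .n = m) (hR : s.reg .R = R) (hdx : s.reg .dx = d) (hdy : s.reg .dy = e)
    (hAG : A ≠ G) (hAE : A < P.E) (hGE : G < P.E) (hd : d < P.Z) (he : e < P.Z)
    (hin : s.pts A d e m ⊆ Finset.Icc 1 p ×ˢ Finset.Icc 1 q) (hq : q < P.Z)
    (hfresh : ∀ u v, s.tab G u v = 0) :
    WP P fillProg s fun k s' => k ≤ 3 * m + 2 ∧ Frame [.j] s s' ∧ s'.low = s.low ∧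
      (∀ t, t ≠ G → s'.tab t = s.tab t) ∧
      ∀ u v, s'.tab G u v = 1 ↔ Occ R (s.pts A d e m) u v := by
  have hZB := P.Z_le
  refine WP.forLoop (fun i s' => Frame [.j] s s' ∧ s'.low = s.low ∧
      (∀ t, t ≠ G → s'.tab t = s.tab t) ∧
      ∀ u v, s'.tab G u v = 1 ↔ Occ R (s.pts A d e i) u v) 1 m (by decide) hn
      ⟨?_, rfl, by simp, by simp [AState.pts, Occ, hfresh]⟩ ?_ ?_
  · intro v hv
    simp at hv
    simp [hv]
  · rintro i hi s₁ hj hm ⟨hf, hl, ht, hocc⟩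
    have ha₁ : s₁.reg .a = A := (hf .a (by decide)).trans ha
    have hg₁ : s₁.reg .g = G := (hf .g (by decide)).trans hg
    have hR₁ : s₁.reg .R = R := (hf .R (by decide)).trans hR
    have hdx₁ : s₁.reg .dx = d := (hf .dx (by decide)).trans hdx
    have hdy₁ : s₁.reg .dy = e := (hf .dy (by decide)).trans hdy
    have htA : s₁.tab A = s.tab A := ht A hAG
    have hmem := hin (AState.mem_pts (t := A) (d := d) (e := e) (s := s) hi)
    simp only [AState.pt, Finset.mem_product, Finset.mem_Icc] at hmem
    have hy : up R (s.tab A i e) ≤ q := by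
      have := Nat.div_le_self (s.tab A i e - 1) R
      simp only [up]; omega
    refine WP.putTab G (s.tab A i d) (up R (s.tab A i e)) 1 (by simp) (by simp [ha₁, hdx₁, hAE, hd])
      (by simp [ha₁, hdy₁, hAE, he]) (by simp) (by simp [hg₁, ha₁, hj, hdx₁, hdy₁, htA, hR₁, up])
      hGE (by omega) (by omega) ?_
    refine ⟨by simp, by simpa using hj, by simpa using hm, ?_, by simpa, ?_, ?_⟩
    · intro v hv
      have := hf v hv
      simp at hv
      simp [hv, this]
    · intro t h0
      funext u v
      simp [h0, ht t h0]
    · intro u v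
      rw [AState.pts_succ, occ_insert, ← hocc]
      simp only [AState.tab_set, AState.tab_setTab, AState.pt, true_and]
      split_ifs with h
      · simp [h]
      · rw [or_iff_right]
        rintro ⟨rfl, rfl⟩
        exact h ⟨rfl, rfl⟩
  · rintro k s' hk - - ⟨hf, hl, ht, h⟩
    exact ⟨by omega, hf, hl, ht, h⟩

/-- The invariant after `i` columns is stated with `firstN r F i`, whose recursion matches the
nested tests, and `code` is computed by Horner's scheme. -/
theorem keyProg_spec {G x y r : ℕ} {S : Finset (ℕ × ℕ)} (hr : 2 ≤ r) (hg : s.reg .g = G)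
    (hrr : s.reg .r = r) (hR : s.reg .R = r ^ 2) (hx : s.reg .X = x) (hy : s.reg .Y = y)
    (hGE : G < P.E) (hyZ : y < P.Z) (hB : (r ^ 2) ^ r ≤ P.B)
    (hocc : ∀ u v, s.tab G u v = 1 ↔ Occ (r ^ 2) S u v) :
    WP P keyProg s fun k s' => k ≤ 8 * r ^ 2 + 4 ∧ Frame [.k, .key, .c] s s' ∧ s'.low = s.low ∧
      s'.tab = s.tab ∧ s'.reg .k = (sel r S x y).card ∧ s'.reg .key = selCode r S x y := by
  refine WP.of_bounds fun hbd => ?_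
  have hrB : r ≤ P.B := hrr ▸ hbd .r
  have hR2 : 2 ≤ r ^ 2 := by nlinarith
  refine WP.seq (WP.assign 0 (by simp) (by simp) (by simp) ?_)
  refine WP.seq (WP.assign 0 (by simp) (by simp) (by simp) ?_)
  set F := fun c => Occ (r ^ 2) S ((x - 1) * r ^ 2 + 1 + c) y
  refine WP.forLoop (fun i s' => Frame [.k, .key, .c] s s' ∧ s'.low = s.low ∧
    s'.tab = s.tab ∧ s'.reg .k = (firstN r F i).card ∧
    s'.reg .key = code (r ^ 2) (firstN r F i) i) 6 (r ^ 2) (by decide)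
    (by simp [hR]) ⟨?_, rfl, rfl, by simp [firstN], by simp [code]⟩ ?_ ?_
  · intro v hv
    simp at hv
    simp [hv]
  · rintro i hi s₁ hj hm ⟨hf, hl, ht, hk, hkey⟩
    have hg₁ : s₁.reg .g = G := (hf .g (by decide)).trans hg
    have hR₁ : s₁.reg .R = r ^ 2 := (hf .R (by decide)).trans hR
    have hr₁ : s₁.reg .r = r := (hf .r (by decide)).trans hrr
    have hx₁ : s₁.reg .X = x := (hf .X (by decide)).trans hx
    have hy₁ : s₁.reg .Y = y := (hf .Y (by decide)).trans hy
    have hframe : ∀ w, w ∉ [Var.k, .key, .c] → s₁.reg w = s.reg w := hf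
    have hskip : ¬ (F i ∧ (firstN r F i).card < r) →
        (firstN r F (i + 1)).card = (firstN r F i).card ∧
        code (r ^ 2) (firstN r F (i + 1)) (i + 1) = code (r ^ 2) (firstN r F i) i := by
      intro h
      have h' : i ∉ firstN r F (i + 1) := fun h'' => h (mem_firstN_succ.1 h'')
      have e := firstN_succ_of_not h'
      have h2 : i ∉ firstN r F i := by simp [mem_firstN]
      exact ⟨by rw [e], by rw [e, code, if_neg h2]⟩
    have hins : F i → (firstN r F i).card < r →
        (firstN r F (i + 1)).card = (firstN r F i).card + 1 ∧
        code (r ^ 2) (firstN r F (i + 1)) (i + 1) = code (r ^ 2) (firstN r F i) i * r ^ 2 + i ∧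
        code (r ^ 2) (firstN r F i) i * r ^ 2 + i ≤ P.B := by
      intro h1 h2
      have h' : i ∈ firstN r F (i + 1) := mem_firstN_succ.2 ⟨h1, h2⟩
      have e := firstN_succ_of_mem h'
      have hnot : i ∉ firstN r F i := by simp [mem_firstN]
      have e2 : code (r ^ 2) (firstN r F (i + 1)) (i + 1) =
          code (r ^ 2) (firstN r F i) i * r ^ 2 + i := by
        rw [code, if_pos h', e]
        congr 2
        refine code_congr fun c hc => ?_
        simp [hc.ne]
      refine ⟨by rw [e, Finset.card_insert_of_notMem hnot], e2, ?_⟩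
      rw [← e2]
      have hsub : firstN r F (i + 1) ⊆ Finset.range (r ^ 2) :=
        (firstN_subset _ _ _).trans (Finset.range_mono hi)
      -- Padding to all `r²` positions only increases the code, so the bound for complete codes with
      -- at most `r` digits applies to every intermediate value.
      refine (code_le_of_le (r ^ 2) (by omega) _ (show i + 1 ≤ r ^ 2 from hi)).trans ?_
      refine (code_lt hsub hR2).le.trans ((Nat.pow_le_pow_right (by omega) ?_).trans hB)
      exact card_firstN_le _ _ _
    refine WP.ifLt (by simp) (by simp) (fun h1 => ?_) (fun h1 => ?_)
    · simp only [Expr.eval_var, hk, hr₁] at h1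
      refine WP.ifEq (by simp [hg₁, hy₁, hGE, hyZ]) (by simp) (fun h2 => ?_) (fun h2 => ?_)
      · have h2 : F i := by
          change Occ _ _ _ _
          rw [← hocc]
          simpa [hg₁, hx₁, hR₁, hj, hy₁, ht] using h2
        obtain ⟨i1, i2, i3⟩ := hins h2 h1
        refine WP.seq (WP.assign (code (r ^ 2) (firstN r F i) i * r ^ 2 + i) (by simp)
          (by simp [hkey, hR₁, hj]) i3 ?_)
        refine WP.assign ((firstN r F i).card + 1) (by simp) (by simp [hk]) (by omega) ?_
        refine ⟨by omega, by simpa using hj, by simpa using hm, ?_, by simpa, by simpa,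
          by simp [i1], by simp [i2]⟩
        intro w hw
        have := hframe w hw
        simp at hw
        simp [hw, this]
      · have h2 : ¬ F i := by
          change ¬ Occ _ _ _ _
          rw [← hocc]
          simpa [hg₁, hx₁, hR₁, hj, hy₁, ht] using h2
        obtain ⟨i1, i2⟩ := hskip fun h => h2 h.1
        refine WP.skip ⟨by omega, by simpa using hj, by simpa using hm, ?_, by simpa, by simpa,
          by simp [i1, hk], by simp [i2, hkey]⟩
        intro w hw
        have := hframe w hw
        simp at hw
        simp [hw, this]
    · simp only [Expr.eval_var, hk, hr₁] at h1
      obtain ⟨i1, i2⟩ := hskip fun h => by omega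
      refine WP.skip ⟨by omega, by simpa using hj, by simpa using hm, ?_, by simpa, by simpa,
        by simp [i1, hk], by simp [i2, hkey]⟩
      intro w hw
      have := hframe w hw
      simp at hw
      simp [hw, this]
  · rintro k s' hk - - ⟨hf, hl, ht, h1, h2⟩
    exact ⟨by omega, hf, hl, ht, h1, h2⟩

theorem AState.pt_notMem_pts {t d e m : ℕ} (h : (s.pts t d e m).card = m) {i : ℕ} (hi : i < m) :
    s.pt t d e i ∉ s.pts t d e i := by
  have hinj : Set.InjOn (s.pt t d e) (Finset.range m) :=
    Finset.card_image_iff.1 (by rw [← AState.pts, h, Finset.card_range])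
  intro hmem
  obtain ⟨k, hk, he⟩ := Finset.mem_image.1 hmem
  have hk' := Finset.mem_range.1 hk
  have := hinj (by simp; omega) (by simpa using hi) he
  omega

/-- Table `G + 1` stores the code of each wide block plus one, since unwritten entries are 0; table
`G + 2` counts wide blocks by code and block column. Counts grow in steps of one, so some count
reaches `r` exactly if any becomes that large. -/
theorem scanProg_spec {G Bt m x₀ r d e : ℕ} {S : Finset (ℕ × ℕ)} (hr : 2 ≤ r)
    (hb : s.reg .b = Bt) (hg : s.reg .g = G) (hcnt : s.reg .cnt = m)
    (hrr : s.reg .r = r) (hR : s.reg .R = r ^ 2) (hdx : s.reg .dx = d) (hdy : s.reg .dy = e)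
    (hBG : Bt < G) (hGE : G + 2 < P.E) (hd : d < P.Z) (he : e < P.Z)
    (hin : s.pts Bt d e m ⊆ Finset.Icc 1 x₀ ×ˢ Finset.Icc 1 x₀) (hx₀ : x₀ < P.Z)
    (hcard : (s.pts Bt d e m).card = m) (hB : (r ^ 2) ^ r ≤ P.B)
    (hocc : ∀ u v, s.tab G u v = 1 ↔ Occ (r ^ 2) S u v)
    (hfresh1 : ∀ u v, s.tab (G + 1) u v = 0) (hfresh2 : ∀ u v, s.tab (G + 2) u v = 0) :
    WP P scanProg s fun k s' => k ≤ m * (8 * r ^ 2 + 20) + 3 ∧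
      Frame [.j, .X, .Y, .k, .key, .c, .v, .found, .FX, .FY, .FK] s s' ∧ s'.low = s.low ∧
      (∀ t, t ≠ G + 1 → t ≠ G + 2 → s'.tab t = s.tab t) ∧
      (∀ u v K, s'.tab (G + 1) u v = K + 1 ↔ (u, v) ∈ alikeIn r S (s.pts Bt d e m) u K) ∧
      ((s'.reg .found = 0 ∧ ∀ X K, (alikeIn r S (s.pts Bt d e m) X K).card < r) ∨
       (s'.reg .found = 1 ∧
        (s'.reg .FX, s'.reg .FY) ∈ alikeIn r S (s.pts Bt d e m) (s'.reg .FX) (s'.reg .FK) ∧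
        r ≤ (alikeIn r S (s.pts Bt d e m) (s'.reg .FX) (s'.reg .FK)).card)) := by
  refine WP.of_bounds fun hbd => ?_
  have hZB := P.Z_le
  have hmB : m ≤ P.B := hcnt ▸ hbd .cnt
  have hB2 := P.two_le
  have hR2 : 2 ≤ r ^ 2 := by nlinarith
  refine WP.seq (WP.assign 0 (by simp) (by simp) (by simp) ?_)
  refine WP.forLoop (fun i s' =>
      Frame [.j, .X, .Y, .k, .key, .c, .v, .found, .FX, .FY, .FK] s s' ∧ s'.low = s.low ∧
      (∀ t, t ≠ G + 1 → t ≠ G + 2 → s'.tab t = s.tab t) ∧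
      (∀ u v K, s'.tab (G + 1) u v = K + 1 ↔ (u, v) ∈ alikeIn r S (s.pts Bt d e i) u K) ∧
      (∀ u v, s'.tab (G + 2) u v = (alikeIn r S (s.pts Bt d e i) v u).card) ∧
      ((s'.reg .found = 0 ∧ ∀ X K, (alikeIn r S (s.pts Bt d e i) X K).card < r) ∨
       (s'.reg .found = 1 ∧
        (s'.reg .FX, s'.reg .FY) ∈ alikeIn r S (s.pts Bt d e i) (s'.reg .FX) (s'.reg .FK) ∧
        r ≤ (alikeIn r S (s.pts Bt d e i) (s'.reg .FX) (s'.reg .FK)).card)))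
    (8 * r ^ 2 + 18) m (by decide) (by simp [hcnt]) ⟨?_, rfl, by simp, ?_, ?_, ?_⟩ ?_ ?_
  · intro v hv
    simp at hv
    simp [hv]
  · simp [AState.pts, alikeIn_empty, hfresh1]
  · simp [AState.pts, alikeIn_empty, hfresh2]
  · left
    simp [AState.pts, alikeIn_empty]
    omega
  · rintro i hi s₁ hj hm ⟨hf, hl, ht, htab1, htab2, hfound⟩
    have hb₁ : s₁.reg .b = Bt := (hf .b (by decide)).trans hb
    have hg₁ : s₁.reg .g = G := (hf .g (by decide)).trans hg
    have hR₁ : s₁.reg .R = r ^ 2 := (hf .R (by decide)).trans hR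
    have hr₁ : s₁.reg .r = r := (hf .r (by decide)).trans hrr
    have hdx₁ : s₁.reg .dx = d := (hf .dx (by decide)).trans hdx
    have hdy₁ : s₁.reg .dy = e := (hf .dy (by decide)).trans hdy
    have htB : s₁.tab Bt = s.tab Bt := ht Bt (by omega) (by omega)
    have htG : s₁.tab G = s.tab G := ht G (by omega) (by omega)
    have hmem := hin (AState.mem_pts (t := Bt) (d := d) (e := e) (s := s) hi)
    simp only [AState.pt, Finset.mem_product, Finset.mem_Icc] at hmem
    -- The list has no repetitions, so a block is never counted twice.
    have hnot := AState.pt_notMem_pts hcard hi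
    have hsucc := AState.pts_succ s Bt d e i
    simp only [AState.pt] at hnot hsucc
    set x := s.tab Bt i d
    set y := s.tab Bt i e
    set Bi := s.pts Bt d e i with hBi
    have hBicard : Bi.card ≤ i := Finset.card_image_le.trans (by simp)
    rw [hsucc]
    refine WP.seq (WP.assign x (by simp [hb₁, hdx₁, hd]; omega) (by simp [hb₁, hj, hdx₁, htB, x])
      (by omega) ?_)
    refine WP.seq (WP.assign y (by simp [hb₁, hdy₁, he]; omega) (by simp [hb₁, hj, hdy₁, htB, y])
      (by omega) ?_)
    refine WP.seq ((keyProg_spec (S := S) (G := G) (x := x) (y := y) hr (by simp [hg₁])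
      (by simp [hr₁]) (by simp [hR₁]) (by simp) (by simp) (by omega) (by omega) hB
      (by simpa [htG] using hocc)).mono ?_)
    rintro k s₂ ⟨hk, hf2, hl2, ht2, hk2, hkey2⟩
    simp only [AState.tab_set, AState.low_set] at hl2 ht2
    have hf3 : ∀ w, w ∉ [Var.X, .Y, .k, .key, .c] → s₂.reg w = s₁.reg w := by
      intro w hw
      rw [hf2 w (by simp at hw ⊢; tauto)]
      simp at hw
      simp [hw]
    have hX2 : s₂.reg .X = x := by rw [hf2 .X (by decide)]; simp
    have hY2 : s₂.reg .Y = y := by rw [hf2 .Y (by decide)]; simp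
    have hj2 : s₂.reg .j = i := by rw [hf3 .j (by decide), hj]
    have hc2 : s₂.reg .cnt = m := by rw [hf3 .cnt (by decide), hm]
    have hg2 : s₂.reg .g = G := by rw [hf3 .g (by decide), hg₁]
    have hr2 : s₂.reg .r = r := by rw [hf3 .r (by decide), hr₁]
    have hf4 : ∀ w, w ∉ [Var.j, .X, .Y, .k, .key, .c, .v, .found, .FX, .FY, .FK] →
        s₂.reg w = s.reg w := fun w hw => by
      rw [hf3 w (by simp at hw ⊢; tauto), hf w hw]
    have hlow : s₂.low = s.low := by rw [hl2, hl]
    refine WP.ifEq (by simp) (by simp) (fun h1 => ?_) (fun h1 => ?_)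
    · simp only [Expr.eval_var, hk2, hr2] at h1
      have hins := alikeIn_insert_of_pos (B := Bi) (S := S) (r := r) (b := (x, y)) h1
      simp only at hins
      set K := selCode r S x y with hK
      have hKB : K + 1 ≤ P.B := by
        have := code_lt (sel_subset r S x y) hR2
        rw [h1] at this
        rw [hK, selCode]
        omega
      have hnot' : (x, y) ∉ alikeIn r S Bi x K := fun h => hnot (alikeIn_subset _ _ _ _ _ h)
      have hneg : ∀ X' K', ¬ (X' = x ∧ K' = K) →
          alikeIn r S (insert (x, y) Bi) X' K' = alikeIn r S Bi X' K' := fun X' K' hne =>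
        alikeIn_insert_of_neg fun h => hne ⟨h.1.symm, h.2.2.symm⟩
      set C := (alikeIn r S Bi x K).card with hC
      have hC1 : C ≤ i := (Finset.card_le_card (alikeIn_subset _ _ _ _ _)).trans hBicard
      have hcardins : (alikeIn r S (insert (x, y) Bi) x K).card = C + 1 := by
        rw [hins, Finset.card_insert_of_notMem hnot']
      have hnew1 : ∀ u v K', (if u = x ∧ v = y then K + 1 else s₁.tab (G + 1) u v) = K' + 1 ↔
          (u, v) ∈ alikeIn r S (insert (x, y) Bi) u K' := by
        intro u v K'
        split_ifs with h
        · obtain ⟨rfl, rfl⟩ := h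
          by_cases hKK : K' = K
          · subst hKK
            simp [hins]
          · rw [hneg _ _ (by simp [hKK])]
            constructor
            · intro h; omega
            · intro h; exact absurd (alikeIn_subset _ _ _ _ _ h) hnot
        · rw [htab1, mem_alikeIn, mem_alikeIn, Finset.mem_insert, Prod.mk.injEq]
          simp [h]
      have hnew2 : ∀ u v, (if u = K ∧ v = x then C + 1 else s₁.tab (G + 2) u v) =
          (alikeIn r S (insert (x, y) Bi) v u).card := by
        intro u v
        split_ifs with h
        · obtain ⟨rfl, rfl⟩ := h
          exact hcardins.symm
        · rw [htab2, hneg v u (fun h' => h ⟨h'.2, h'.1⟩)]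
      have hmono : ∀ X' K', (alikeIn r S Bi X' K') ⊆ alikeIn r S (insert (x, y) Bi) X' K' := by
        intro X' K' z hz
        rw [mem_alikeIn] at hz ⊢
        exact ⟨Finset.mem_insert_of_mem hz.1, hz.2⟩
      refine WP.seq (WP.putTab (G + 1) x y (K + 1) (by simp) (by simp) (by simp) (by simp)
        (by simp [hg2, hX2, hY2, hkey2]) (by omega) (by omega) hKB ?_)
      refine WP.seq (WP.assign (C + 1) (by simp [hg2, hX2]; omega)
        (by simp [hg2, hX2, hkey2, ht2, htab2, hC]) (by omega) ?_)
      refine WP.seq (WP.putTab (G + 2) K x (C + 1) (by simp) (by simp) (by simp) (by simp)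
        (by simp [hg2, hX2, hkey2]) (by omega) (by omega) (by omega) ?_)
      refine WP.ifEq (by simp) (by simp) (fun h2 => ?_) (fun h2 => ?_)
      · simp only [Expr.eval_var, AState.reg_setTab, AState.reg_set, reduceCtorEq, if_true,
          if_false, hr2] at h2
        refine WP.seq (WP.assign 1 (by simp) (by simp) (by omega) ?_)
        refine WP.seq (WP.assign x (by simp) (by simp [hX2]) (by omega) ?_)
        refine WP.seq (WP.assign y (by simp) (by simp [hY2]) (by omega) ?_)
        refine WP.assign K (by simp) (by simp [hkey2]) (by omega) ?_
        refine ⟨by omega, by simpa using hj2, by simpa using hc2, ?_, by simpa, ?_, ?_, ?_, ?_⟩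
        · intro w hw
          have := hf4 w hw
          simp at hw
          simp [hw, this]
        · intro t h1 h2
          funext u v
          simp [h1, h2, ht2, ht t h1 h2]
        · intro u v K'
          rw [← hnew1]
          simp [ht2]
        · intro u v
          rw [← hnew2]
          simp [ht2]
        · right
          simp only [AState.reg_set, AState.reg_setTab, reduceCtorEq, if_true, if_false]
          refine ⟨trivial, ?_, by rw [hcardins]; omega⟩
          rw [hins]
          exact Finset.mem_insert_self _ _
      · simp only [Expr.eval_var, AState.reg_setTab, AState.reg_set, reduceCtorEq, if_true,
          if_false, hr2] at h2
        refine WP.skip ⟨by omega, by simpa using hj2, by simpa using hc2, ?_, by simpa, ?_, ?_, ?_,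
          ?_⟩
        · intro w hw
          have := hf4 w hw
          simp at hw
          simp [hw, this]
        · intro t h1 h2
          funext u v
          simp [h1, h2, ht2, ht t h1 h2]
        · intro u v K'
          rw [← hnew1]
          simp [ht2]
        · intro u v
          rw [← hnew2]
          simp [ht2]
        · simp only [AState.reg_set, AState.reg_setTab, reduceCtorEq, if_false,
            hf3 .found (by decide), hf3 .FX (by decide), hf3 .FY (by decide), hf3 .FK (by decide)]
          rcases hfound with ⟨h3, h4⟩ | ⟨h3, h4, h5⟩
          · left
            refine ⟨h3, fun X' K' => ?_⟩
            by_cases hXK : X' = x ∧ K' = K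
            · obtain ⟨rfl, rfl⟩ := hXK
              have := h4 x K
              rw [hcardins]
              omega
            · rw [hneg _ _ hXK]
              exact h4 _ _
          · right
            exact ⟨h3, hmono _ _ h4, h5.trans (Finset.card_le_card (hmono _ _))⟩
    · simp only [Expr.eval_var, hk2, hr2] at h1
      have hneg : ∀ X' K', alikeIn r S (insert (x, y) Bi) X' K' = alikeIn r S Bi X' K' :=
        fun X' K' => alikeIn_insert_of_neg fun h => h1 h.2.1
      refine WP.skip ⟨by omega, by simpa using hj2, by simpa using hc2, ?_, by simpa, ?_, ?_, ?_,
        ?_⟩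
      · intro w hw
        have := hf4 w hw
        simp at hw
        simp [hw, this]
      · intro t h1 h2
        simp [ht2, ht t h1 h2]
      · intro u v K'
        rw [hneg, ← htab1]
        simp [ht2]
      · intro u v
        rw [hneg, ← htab2]
        simp [ht2]
      · simp only [AState.reg_set, reduceCtorEq, if_false, hneg,
            hf3 .found (by decide), hf3 .FX (by decide), hf3 .FY (by decide), hf3 .FK (by decide)]
        exact hfound
  · rintro k s' hk - - ⟨hf, hl, ht, h1, h2, h3⟩
    exact ⟨by rw [show 8 * r ^ 2 + 20 = 8 * r ^ 2 + 18 + 2 by ring]; omega, hf, hl, ht, h1, h3⟩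

end GridFinding

namespace GridFinding

/-! ## The contraction loop -/

section Programs

open Var

/-- Contract blocks of side length `R` until this reduces the number of points by more than a
factor `R`. After each contraction, only as many points are kept as the next one needs. -/
def shrinkProg : Program :=
  assign s 1 ;; assign a 0 ;; assign g 1 ;; assign done 0 ;; assign v 1 ;;
  whileLt done v
    (contractProg ;; assign N ((n - 1) / R) ;;
      ifLt N cnt
        (assign n (N + 1) ;; assign a (g + 1) ;; assign g (g + 2) ;; assign p ((p - 1) / R + 1) ;;
          assign q ((q - 1) / R + 1) ;; assign s (s * R))
        (assign done 1))

/-- Output `r` consecutive intervals that start after `cur`. The `c`-th step of length `sc`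
completes an interval if `e` equals `e'`. -/
def emitProg (e e' : Expr) (sc m : Var) : Program :=
  assign prev cur ;; assign k 0 ;;
  forLoop c m
    (assign cur (cur + sc) ;;
      ifLt k r
        (ifEq e e'
          (putLow out (prev + 1) ;; putLow (out + 1) cur ;; assign out (out + 2) ;;
            assign prev cur ;; assign k (k + 1))
          .skip)
        .skip)

end Programs

variable {P : Layout} {s : AState}

theorem AState.card_pts_of_le {t d e m i : ℕ} (h : (s.pts t d e m).card = m) (hi : i ≤ m) :
    (s.pts t d e i).card = i := by
  have hinj : Set.InjOn (s.pt t d e) (Finset.range m) :=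
    Finset.card_image_iff.1 (by rw [← AState.pts, h, Finset.card_range])
  rw [AState.pts, Finset.card_image_of_injOn, Finset.card_range]
  exact hinj.mono (by simpa using hi)

theorem AState.pts_subset {t d e m i : ℕ} (hi : i ≤ m) : s.pts t d e i ⊆ s.pts t d e m :=
  Finset.image_subset_image (Finset.range_mono hi)

/-- The state describes a contraction of the point set `M ⊆ [p] × [q]` with blocks of side length
`c`: a set of `N + 1` points in `[x] × [y]`, listed in table `A`. -/
structure Contracted (r p q : ℕ) (M : Finset (ℕ × ℕ)) (A G N x y c : ℕ) (s : AState) :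
    Prop where
  reg_a : s.reg .a = A
  reg_g : s.reg .g = G
  reg_n : s.reg .n = N + 1
  reg_p : s.reg .p = x
  reg_q : s.reg .q = y
  reg_s : s.reg .s = c
  reg_r : s.reg .r = r
  reg_R : s.reg .R = r ^ 2
  card : (s.pts A 0 1 (N + 1)).card = N + 1
  subset : s.pts A 0 1 (N + 1) ⊆ Finset.Icc 1 x ×ˢ Finset.Icc 1 y
  le : f r * (x + y - 2) ≤ N
  pos : 1 ≤ x + y - 2
  origin : ∀ z ∈ s.pts A 0 1 (N + 1), ∃ w ∈ M, 1 ≤ w.1 ∧ 1 ≤ w.2 ∧ up c w.1 = z.1 ∧ up c w.2 = z.2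
  one_le : 1 ≤ c
  scale : c * (x + y - 2) ≤ p + q - 2
  lt : A < G
  tables : G + 2 * (x + y - 2) ≤ 2 * (p + q - 2) + 1
  x_le : x ≤ p
  y_le : y ≤ q

/-- A single block has `x - 1 < R` and `y - 1 < R`. Thus the contracted rectangle never degenerates
to one point, and the hypotheses can be re-established. -/
theorem one_le_blocks_dim {R x y : ℕ} (hR : 1 ≤ R) (h : 2 * R ≤ x + y - 2) :
    1 ≤ up R x + up R y - 2 := by
  by_contra hlt
  have h1 := one_le_up R x
  have h2 := one_le_up R y
  have e1 : up R x = 1 := by omega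
  have e2 : up R y = 1 := by omega
  have a1 : x - 1 < R := by
    by_contra h; have := Nat.div_pos (not_lt.1 h) hR; simp only [up] at e1; omega
  have a2 : y - 1 < R := by
    by_contra h; have := Nat.div_pos (not_lt.1 h) hR; simp only [up] at e2; omega
  omega

theorem up_le_self {R x : ℕ} (hx : 1 ≤ x) : up R x ≤ x := by
  have := Nat.div_le_self (x - 1) R
  simp only [up]; omega

/-- The credit is `80 * N`. A further contraction replaces `N` by `N / r² ≤ N / 4`, so at most `20 *
N` of it has to be kept and the rest pays for the round. Afterwards the number of blocks is at most
`N / r²`, as the counting argument and the time bound of the search both need. -/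
theorem shrinkProg_spec {r p q N₀ : ℕ} {M : Finset (ℕ × ℕ)} (hr : 2 ≤ r)
    (hn : s.reg .n = N₀ + 1) (hp : s.reg .p = p) (hq : s.reg .q = q) (hrr : s.reg .r = r)
    (hR : s.reg .R = r ^ 2) (hM : s.pts 0 0 1 (N₀ + 1) = M) (hcard : M.card = N₀ + 1)
    (hsub : M ⊆ Finset.Icc 1 p ×ˢ Finset.Icc 1 q) (hpos : 1 ≤ p + q - 2)
    (hN : f r * (p + q - 2) ≤ N₀) (hfresh : ∀ t, 1 ≤ t → ∀ u v, s.tab t u v = 0)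
    (hE : 2 * (p + q) + 10 ≤ P.E) (hZ : p + q + 1 ≤ P.Z) (hB : (p + q - 2) * r ^ 2 ≤ P.B) :
    WP P shrinkProg s fun k s' => k ≤ 80 * N₀ + 6 ∧ s'.low = s.low ∧
      ∃ A G N x y c, N ≤ N₀ ∧ Contracted r p q M A G N x y c s' ∧
        s'.reg .cnt = (blocks (r ^ 2) (s'.pts A 0 1 (N + 1))).card ∧
        s'.pts (G + 1) 0 1 (s'.reg .cnt) = blocks (r ^ 2) (s'.pts A 0 1 (N + 1)) ∧
        s'.reg .cnt ≤ N / r ^ 2 ∧ ∀ t, G + 2 ≤ t → ∀ u v, s'.tab t u v = 0 := by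
  refine WP.of_bounds fun hbd => ?_
  have hZB := P.Z_le
  have hEB := P.E_le
  have hn₀B : N₀ + 1 ≤ P.B := hn ▸ hbd .n
  have hR4 : 4 ≤ r ^ 2 := by nlinarith
  have hp1 := subset_bounds hsub hcard
  refine WP.seq (WP.assign 1 (by simp) (by simp) (by omega) ?_)
  refine WP.seq (WP.assign 0 (by simp) (by simp) (by omega) ?_)
  refine WP.seq (WP.assign 1 (by simp) (by simp) (by omega) ?_)
  refine WP.seq (WP.assign 0 (by simp) (by simp) (by omega) ?_)
  refine WP.seq (WP.assign 1 (by simp) (by simp) (by omega) ?_)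
  refine WP.whileLt (φ := 80 * N₀) (fun φ s' => s'.reg .v = 1 ∧ s'.low = s.low ∧
    ∃ A G N x y c, N ≤ N₀ ∧ Contracted r p q M A G N x y c s' ∧
      ((s'.reg .done = 0 ∧ (∀ t, G ≤ t → ∀ u v, s'.tab t u v = 0) ∧ φ = 80 * N) ∨
        (s'.reg .done = 1 ∧ s'.reg .cnt = (blocks (r ^ 2) (s'.pts A 0 1 (N + 1))).card ∧
        s'.pts (G + 1) 0 1 (s'.reg .cnt) = blocks (r ^ 2) (s'.pts A 0 1 (N + 1)) ∧
        s'.reg .cnt ≤ N / r ^ 2 ∧ (∀ t, G + 2 ≤ t → ∀ u v, s'.tab t u v = 0)))) ?_ ?_ ?_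
  · refine ⟨by simp, by simp, 0, 1, N₀, p, q, 1, le_rfl, ?_, Or.inl ⟨by simp, by simpa, rfl⟩⟩
    have hM' : ∀ s' : AState, s'.tab = s.tab → s'.pts 0 0 1 (N₀ + 1) = M := fun s' h => by
      rw [← hM]; exact AState.pts_congr_tab (by rw [h])
    constructor
    case card => rw [hM' _ (by simp), hcard]
    case subset => rw [hM' _ (by simp)]; exact hsub
    case origin =>
      rw [hM' _ (by simp)]
      intro z hz
      have := hsub hz
      simp only [Finset.mem_product, Finset.mem_Icc] at this
      exact ⟨z, hz, this.1.1, this.2.1, up_one this.1.1, up_one this.2.1⟩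
    all_goals first | (simp; done) | omega | (simp; assumption)
  · rintro φ s₁ ⟨hv, hlow, A, G, N, x, y, c, hNle, hC, hdone⟩ hlt
    rcases hdone with ⟨hd, hfr, rfl⟩ | ⟨hd, -⟩
    swap
    · omega
    obtain ⟨hx1, hy1, hxy⟩ := subset_bounds hC.subset hC.card
    have hP2 := two_mul_le_of_card hr hC.pos hC.le hxy hx1 hy1
    have hpos' := one_le_blocks_dim (R := r ^ 2) (by omega) hP2
    have hmul := mul_up_sub_le (R := r ^ 2) hx1 hy1
    have hf16 := sixteen_mul_le_f hr
    have hN64 : 64 ≤ N := by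
      calc 64 ≤ 16 * r ^ 2 * 1 := by omega
        _ ≤ f r * (x + y - 2) := Nat.mul_le_mul hf16 hC.pos
        _ ≤ N := hC.le
    have ht := hC.tables
    have hxle := hC.x_le
    have hyle := hC.y_le
    refine WP.seq ((contractProg_spec (R := r ^ 2) hC.reg_a hC.reg_g hC.reg_n hC.reg_R
      hC.lt (by omega) hC.subset (by omega) (by omega) (by omega) hfr).mono ?_)
    rintro k s₂ ⟨hk, hf2, hl2, ht2, hcnt2, hpts2⟩
    have hA2 : s₂.pts A 0 1 (N + 1) = s₁.pts A 0 1 (N + 1) :=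
      AState.pts_congr_tab (ht2 A (by have := hC.lt; omega) (by have := hC.lt; omega))
    rw [← hA2] at hcnt2 hpts2
    have hfr2 : ∀ t, G + 2 ≤ t → ∀ u v, s₂.tab t u v = 0 := fun t h u v => by
      rw [ht2 t (by omega) (by omega), hfr t (by omega)]
    have hn2 : s₂.reg .n = N + 1 := (hf2 .n (by decide)).trans hC.reg_n
    have hR2 : s₂.reg .R = r ^ 2 := (hf2 .R (by decide)).trans hC.reg_R
    have hg2 : s₂.reg .g = G := (hf2 .g (by decide)).trans hC.reg_g
    have hp2 : s₂.reg .p = x := (hf2 .p (by decide)).trans hC.reg_p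
    have hq2 : s₂.reg .q = y := (hf2 .q (by decide)).trans hC.reg_q
    have hs2 : s₂.reg .s = c := (hf2 .s (by decide)).trans hC.reg_s
    have hdivle : N / r ^ 2 ≤ N := Nat.div_le_self _ _
    have hdiv4 : r ^ 2 * (N / r ^ 2) ≤ N := Nat.mul_div_le _ _
    have hdiv4' : 4 * (N / r ^ 2) ≤ N := (Nat.mul_le_mul_right _ hR4).trans hdiv4
    refine WP.seq (WP.assign (N / r ^ 2) (by simp) (by simp [hn2, hR2]) (by omega) ?_)
    refine WP.ifLt (by simp) (by simp) (fun h1 => ?_) (fun h1 => ?_)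
    · simp only [Expr.eval_var, AState.reg_set, reduceCtorEq, if_true, if_false] at h1
      have hxu := up_le_self (R := r ^ 2) hx1
      have hyu := up_le_self (R := r ^ 2) hy1
      -- The scale is bounded because the contracted rectangle still has `x + y - 2 ≥ 1`; hence it
      -- never overflows.
      have hcle : c ≤ p + q - 2 := by
        calc c = c * 1 := by ring
          _ ≤ c * (x + y - 2) := Nat.mul_le_mul_left _ hC.pos
          _ ≤ _ := hC.scale
      have hcB : c * r ^ 2 ≤ P.B := (Nat.mul_le_mul_right _ hcle).trans hB
      refine WP.seq (WP.assign (N / r ^ 2 + 1) (by simp) (by simp) (by omega) ?_)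
      refine WP.seq (WP.assign (G + 1) (by simp) (by simp [hg2]) (by omega) ?_)
      refine WP.seq (WP.assign (G + 2) (by simp) (by simp [hg2]) (by omega) ?_)
      refine WP.seq (WP.assign (up (r ^ 2) x) (by simp) (by simp [hp2, hR2, up]) (by omega) ?_)
      refine WP.seq (WP.assign (up (r ^ 2) y) (by simp) (by simp [hq2, hR2, up]) (by omega) ?_)
      refine WP.assign (c * r ^ 2) (by simp) (by simp [hs2, hR2]) hcB ?_
      refine ⟨80 * (N / r ^ 2), by omega, ?_, ?_, G + 1, G + 2, N / r ^ 2, up (r ^ 2) x,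
        up (r ^ 2) y, c * r ^ 2, by omega, ?_, Or.inl ⟨?_, ?_, rfl⟩⟩
      · simp [hf2 .v (by decide), hv]
      · simp [hl2, hlow]
      · have hpts' : ∀ s' : AState, s'.tab = s₂.tab →
            s'.pts (G + 1) 0 1 (N / r ^ 2 + 1) = s₂.pts (G + 1) 0 1 (N / r ^ 2 + 1) :=
          fun s' h => AState.pts_congr_tab (by rw [h])
        have hcard2 : (s₂.pts (G + 1) 0 1 (s₂.reg .cnt)).card = s₂.reg .cnt := by
          rw [hpts2, hcnt2]
        have hsub2 : s₂.pts (G + 1) 0 1 (N / r ^ 2 + 1) ⊆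
            blocks (r ^ 2) (s₁.pts A 0 1 (N + 1)) := by
          rw [← hA2, ← hpts2]
          exact AState.pts_subset h1
        constructor
        case card =>
          rw [hpts' _ (by simp)]
          exact AState.card_pts_of_le hcard2 h1
        case subset =>
          rw [hpts' _ (by simp)]
          intro z hz
          obtain ⟨w, hw, rfl⟩ := Finset.mem_image.1 (hsub2 hz)
          have := hC.subset hw
          simp only [Finset.mem_product, Finset.mem_Icc] at this ⊢
          exact ⟨⟨one_le_up _ _, up_mono _ this.1.2⟩, one_le_up _ _, up_mono _ this.2.2⟩
        case origin =>
          rw [hpts' _ (by simp)]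
          intro z hz
          obtain ⟨w, hw, rfl⟩ := Finset.mem_image.1 (hsub2 hz)
          obtain ⟨w', hw', h1, h2, h3, h4⟩ := hC.origin w hw
          exact ⟨w', hw', h1, h2, by rw [← up_up, h3], by rw [← up_up, h4]⟩
        case le =>
          rw [Nat.le_div_iff_mul_le (by omega)]
          calc f r * (up (r ^ 2) x + up (r ^ 2) y - 2) * r ^ 2
              = f r * (r ^ 2 * (up (r ^ 2) x + up (r ^ 2) y - 2)) := by ring
            _ ≤ f r * (x + y - 2) := Nat.mul_le_mul_left _ hmul
            _ ≤ N := hC.le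
        case scale =>
          rw [mul_assoc]
          exact (Nat.mul_le_mul_left _ hmul).trans hC.scale
        case tables =>
          -- Each round uses two new tables, paid for by the decrease of `x + y - 2`.
          have : 4 * (up (r ^ 2) x + up (r ^ 2) y - 2) ≤ x + y - 2 :=
            (Nat.mul_le_mul_right _ hR4).trans hmul
          omega
        case one_le => exact Nat.mul_pos hC.one_le (by omega)
        case reg_r => simp [hf2 .r (by decide), hC.reg_r]
        case reg_R => simp [hR2]
        all_goals first | (simp; done) | omega
      · simp [hf2 .done (by decide), hd]
      · simpa using hfr2
    · simp only [Expr.eval_var, AState.reg_set, reduceCtorEq, if_true, if_false] at h1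
      refine WP.assign 1 (by simp) (by simp) (by omega) ?_
      have hpts' : ∀ (s' : AState) (t m : ℕ), s'.tab = s₂.tab → s'.pts t 0 1 m = s₂.pts t 0 1 m :=
        fun s' t m h => AState.pts_congr_tab (by rw [h])
      refine ⟨0, by omega, by simp [hf2 .v (by decide), hv], by simp [hl2, hlow], A, G, N, x, y, c,
        hNle, ?_, Or.inr ⟨by simp, ?_, ?_, by simpa using h1, by simpa using hfr2⟩⟩
      · constructor
        case card => rw [hpts' _ _ _ (by simp), hA2]; exact hC.card
        case subset => rw [hpts' _ _ _ (by simp), hA2]; exact hC.subset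
        case origin => rw [hpts' _ _ _ (by simp), hA2]; exact hC.origin
        case reg_a => simp [hf2 .a (by decide), hC.reg_a]
        case reg_r => simp [hf2 .r (by decide), hC.reg_r]
        case reg_g => simp [hg2]
        case reg_n => simp [hn2]
        case reg_p => simp [hp2]
        case reg_q => simp [hq2]
        case reg_s => simp [hs2]
        case reg_R => simp [hR2]
        case le => exact hC.le
        case pos => exact hC.pos
        case one_le => exact hC.one_le
        case scale => exact hC.scale
        case lt => exact hC.lt
        case tables => exact hC.tables
        case x_le => exact hC.x_le
        case y_le => exact hC.y_le
      · rw [hpts' _ _ _ (by simp)]; simpa using hcnt2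
      · rw [hpts' _ (G + 1) _ (by simp), hpts' _ A _ (by simp)]; simpa using hpts2
  · rintro k ψ s' hk ⟨hv, hlow, A, G, N, x, y, c, hNle, hC, hdone⟩ hle
    rcases hdone with ⟨hd, -⟩ | ⟨hd, h1, h2, h3, h4⟩
    · omega
    · exact ⟨by omega, hlow, A, G, N, x, y, c, hNle, hC, h1, h2, h3, h4⟩

/-! ## Output of intervals -/

/-- From address `o` on, `w` lists the endpoints of `m` consecutive intervals that start after
`b`. Each contains one of the intervals `[b + c * i + 1, b + c * (i + 1)]` with `i ∈ A`. -/
def Lines (w : ℕ → ℕ) (o b c : ℕ) (A : Finset ℕ) (m : ℕ) : Prop :=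
  ∀ t < m, ∃ i ∈ A, w (o + 2 * t + 1) = b + c * (i + 1) ∧
    w (o + 2 * t) = (if t = 0 then b else w (o + 2 * t - 1)) + 1 ∧ w (o + 2 * t) ≤ b + c * i + 1

theorem Lines.chain {w : ℕ → ℕ} {o b c m : ℕ} {A : Finset ℕ} (h : Lines w o b c A m)
    (hc : 1 ≤ c) : Chain m (fun t => w (o + 2 * t)) (fun t => w (o + 2 * t + 1)) := by
  constructor
  · intro t ht
    obtain ⟨i, -, h1, h2, h3⟩ := h t ht
    have : c * (i + 1) = c * i + c := by ring
    exact ⟨by simp only [h2]; omega, by simp only; omega⟩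
  · intro t ht
    obtain ⟨i, -, h1, h2, h3⟩ := h (t + 1) ht
    rw [if_neg (by omega)] at h2
    simp only [h2]
    congr 2

/-- An interval is closed at the end of each selected step and the next one begins right after it.
The intervals are thus consecutive, and each contains the whole selected step that closes it. -/
theorem emitProg_spec {e e' : Expr} {sc m : Var} {r M o b c : ℕ} (F : ℕ → Prop)
    (hsc : sc ∉ [Var.prev, .cur, .k, .c, .out]) (hm : m ∉ [Var.prev, .cur, .k, .c, .out])
    (hrr : s.reg .r = r) (hmM : s.reg m = M) (hscc : s.reg sc = c) (hout : s.reg .out = o)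
    (hcur : s.reg .cur = b) (hc : 1 ≤ c) (hB : b + c * M ≤ P.B) (hT : o + 2 * r ≤ P.T)
    (he : ∀ s', Frame [.prev, .cur, .k, .c, .out] s s' → s'.tab = s.tab → s'.reg .c < M →
      e.Valid P s' ∧ e'.Valid P s' ∧ (e.eval s' = e'.eval s' ↔ F (s'.reg .c)))
    (hd : (e.deg ≤ 64 ∧ e'.deg ≤ 64) ∧ e.cost + e'.cost ≤ 50) :
    WP P (emitProg e e' sc m) s fun k s' => k ≤ 10 * M + 4 ∧
      Frame [.prev, .cur, .k, .c, .out] s s' ∧ s'.tab = s.tab ∧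
      (∀ i, i < o ∨ o + 2 * r ≤ i → s'.low i = s.low i) ∧
      Lines s'.low o b c (firstN r F M) (firstN r F M).card := by
  refine WP.of_bounds fun hbd => ?_
  have hTB := P.T_le
  have hB2 := P.two_le
  have hmc : m ≠ .c := fun h => by simp [h] at hm
  refine WP.seq (WP.assign b (by simp) (by simp [hcur]) (by omega) ?_)
  refine WP.seq (WP.assign 0 (by simp) (by simp) (by omega) ?_)
  refine WP.forLoop (fun i s' => Frame [.prev, .cur, .k, .c, .out] s s' ∧ s'.tab = s.tab ∧
      (∀ i, i < o ∨ o + 2 * r ≤ i → s'.low i = s.low i) ∧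
      Lines s'.low o b c (firstN r F i) (firstN r F i).card ∧
      s'.reg .k = (firstN r F i).card ∧ s'.reg .out = o + 2 * (firstN r F i).card ∧
      s'.reg .cur = b + c * i ∧
      s'.reg .prev = (if (firstN r F i).card = 0 then b
        else s'.low (o + 2 * (firstN r F i).card - 1)) ∧
      s'.reg .prev ≤ b + c * i) 8 M hmc ?_ ⟨?_, ?_⟩ ?_ ?_
  · simp at hm
    simp [hm, hmM]
  · intro v hv
    simp at hv
    simp [hv]
  · simp [firstN, Lines, hout, hcur]
  · rintro i hi s₁ hci hMi ⟨hf, ht, hl, hlines, hk, ho, hcu, hp, hple⟩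
    have hsc₁ : s₁.reg sc = c := (hf sc hsc).trans hscc
    have hr₁ : s₁.reg .r = r := (hf .r (by decide)).trans hrr
    have hf' : ∀ w, w ∉ [Var.prev, .cur, .k, .c, .out] → s₁.reg w = s.reg w := hf
    have hci1 : c * (i + 1) = c * i + c := by ring
    have hciM : c * (i + 1) ≤ c * M := Nat.mul_le_mul_left _ hi
    have hdsc : ((Var.cur : Expr) + (sc : Expr)).deg ≤ 64 ∧
      ((Var.cur : Expr) + (sc : Expr)).cost ≤ 50 :=
      ⟨by change 1 + 1 + 1 ≤ 64; decide, by change 1 + (1 + 1) ≤ 50; decide⟩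
    have hm' : m ≠ .prev ∧ m ≠ .cur ∧ m ≠ .k ∧ m ≠ .c ∧ m ≠ .out := by simpa using hm
    refine WP.seq (WP.assign (b + c * (i + 1)) (by simp) (by simp [hcu, hsc₁, hci1, add_assoc])
      (by omega) ?_ hdsc)
    have hframe₂ : Frame [.prev, .cur, .k, .c, .out] s (s₁.set .cur (b + c * (i + 1))) := by
      intro w hw
      have := hf' w hw
      simp at hw
      simp [hw, this]
    obtain ⟨v1, v2, v3⟩ := he _ hframe₂ (by simpa) (by simpa [hci])
    simp only [AState.reg_set, reduceCtorEq, if_false, hci] at v3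
    set K := (firstN r F i).card with hK
    have hKr : K ≤ r := card_firstN_le _ _ _
    have hskip : ¬ (F i ∧ K < r) → firstN r F (i + 1) = firstN r F i := fun h =>
      firstN_succ_of_not fun h' => h (mem_firstN_succ.1 h')
    refine WP.ifLt (by simp) (by simp) (fun h1 => ?_) (fun h1 => ?_)
    · simp only [Expr.eval_var, AState.reg_set, reduceCtorEq, if_false, hk, hr₁] at h1
      refine WP.ifEq v1 v2 (fun h2 => ?_) (fun h2 => ?_) hd
      · have hin := mem_firstN_succ.2 ⟨v3.1 h2, h1⟩
        have hnew := firstN_succ_of_mem hin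
        have hnot : i ∉ firstN r F i := by simp [mem_firstN]
        have hcardnew : (firstN r F (i + 1)).card = K + 1 := by
          rw [hnew, Finset.card_insert_of_notMem hnot]
        refine WP.seq (WP.putLow (o + 2 * K) (s₁.reg .prev + 1) (by simp) (by simp) (by simp [ho])
          (by simp) (by omega) (by omega) ?_)
        refine WP.seq (WP.putLow (o + 2 * K + 1) (b + c * (i + 1)) (by simp) (by simp)
          (by simp [ho]) (by simp) (by omega) (by omega) ?_)
        refine WP.seq (WP.assign (o + 2 * (K + 1)) (by simp) (by simp [ho]; ring) (by omega) ?_)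
        refine WP.seq (WP.assign (b + c * (i + 1)) (by simp) (by simp) (by omega) ?_)
        refine WP.assign (K + 1) (by simp) (by simp [hk]) (by omega) ?_
        rw [hcardnew]
        refine ⟨by omega, by simpa using hci, by simpa [hm'] using hMi, ?_, by simpa, ?_, ?_,
          by simp, by simp, by simp, ?_, by simp⟩
        · intro w hw
          have := hf' w hw
          simp at hw
          simp [hw, this]
        · intro a ha
          simp only [AState.low_set, AState.low_setLow]
          rw [if_neg (by omega), if_neg (by omega), hl a ha]
        · intro t ht'
          simp only [AState.low_set, AState.low_setLow]
          rcases Nat.lt_succ_iff_lt_or_eq.1 ht' with hlt | rfl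
          · obtain ⟨i', hi', a1, a2, a3⟩ := hlines t hlt
            refine ⟨i', by rw [hnew]; exact Finset.mem_insert_of_mem hi', ?_, ?_, ?_⟩
            · rw [if_neg (by omega), if_neg (by omega), a1]
            · rw [if_neg (by omega), if_neg (by omega), a2]
              split_ifs <;> first | rfl | omega
            · rw [if_neg (by omega), if_neg (by omega)]; exact a3
          · refine ⟨i, hin, by simp, ?_, ?_⟩
            · rw [if_neg (by omega), if_pos rfl, hp]
              split_ifs <;> first | rfl | omega
            · rw [if_neg (by omega), if_pos rfl]; omega
        · simp only [AState.low_set, AState.low_setLow, AState.reg_set, reduceCtorEq, if_true,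
            if_false]
          rw [if_pos (by omega)]
      · rw [hskip fun h => h2 (v3.2 h.1)]
        refine WP.skip ⟨by omega, by simpa using hci, by simpa [hm'] using hMi, ?_, by simpa,
          by simpa using hl, by simpa using hlines, by simpa using hk, by simpa using ho, by simp,
          by simpa only [AState.reg_set, AState.low_set, reduceCtorEq, if_false] using hp,
          by simp; omega⟩
        intro w hw
        have := hf' w hw
        simp at hw
        simp [hw, this]
    · simp only [Expr.eval_var, AState.reg_set, reduceCtorEq, if_false, hk, hr₁] at h1
      rw [hskip fun h => by omega]
      refine WP.skip ⟨by omega, by simpa using hci, by simpa [hm'] using hMi, ?_, by simpa,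
        by simpa using hl, by simpa using hlines, by simpa using hk, by simpa using ho, by simp,
        by simpa only [AState.reg_set, AState.low_set, reduceCtorEq, if_false] using hp,
          by simp; omega⟩
      intro w hw
      have := hf' w hw
      simp at hw
      simp [hw, this]
  · rintro k s' hk - - ⟨hf, ht, hl, hlines, -⟩
    exact ⟨by omega, hf, ht, hl, hlines⟩

end GridFinding

namespace GridFinding

/-! ## The complete algorithm -/

section Programs

open Var

/-- Output the grid that belongs to the result of a successful search. -/
def outputProg : Program :=
  assign out (2 * r * dx) ;; assign cur (s * ((FX - 1) * R)) ;;
  emitProg (.tab g ((FX - 1) * R + 1 + c) FY) 1 s R ;;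
  assign out (2 * r * dy) ;; assign cur 0 ;; assign v (s * R) ;;
  emitProg (.tab (g + 1) FX (c + 1)) (FK + 1) v lim ;;
  assign p 0

/-- Search the point set and, if this fails, its transpose. -/
def searchProg : Program :=
  assign b (g + 1) ;; assign g (g + 2) ;; assign dx 0 ;; assign dy 1 ;;
  assign lim ((q - 1) / R + 1) ;; (fillProg ;; scanProg) ;;
  ifEq found 0
    (assign g (g + 3) ;; assign dx 1 ;; assign dy 0 ;; assign lim ((p - 1) / R + 1) ;;
      fillProg ;; scanProg)
    .skip

/-- The algorithm after the initialization of the memory layout. -/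
def gridProg : Program :=
  ifLt r 2
    (putLow 0 1 ;; putLow 1 p ;; putLow 2 1 ;; putLow 3 q ;; assign p 0)
    (assign R (r * r) ;; copyProg ;; shrinkProg ;; searchProg ;; outputProg)

end Programs

variable {P : Layout} {s : AState}

/-! ### From a successful search to a grid -/

/-- The search in tables `G` and `G + 1` was successful. -/
def Found (r G : ℕ) (T : Finset (ℕ × ℕ)) (s : AState) : Prop :=
  (∀ u v, s.tab G u v = 1 ↔ Occ (r ^ 2) T u v) ∧
  (∀ u v K, s.tab (G + 1) u v = K + 1 ↔ (u, v) ∈ alikeIn r T (blocks (r ^ 2) T) u K) ∧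
  (s.reg .FX, s.reg .FY) ∈ alikeIn r T (blocks (r ^ 2) T) (s.reg .FX) (s.reg .FK) ∧
  r ≤ (alikeIn r T (blocks (r ^ 2) T) (s.reg .FX) (s.reg .FK)).card

/-- From addresses `o` and `o'` on, `w` lists the endpoints of the columns and rows of an `r × r`
grid in `M`. -/
def ListsGrid (r : ℕ) (M : Finset (ℕ × ℕ)) (w : ℕ → ℕ) (o o' : ℕ) : Prop :=
  Chain r (fun t => w (o + 2 * t)) (fun t => w (o + 2 * t + 1)) ∧
  Chain r (fun t => w (o' + 2 * t)) (fun t => w (o' + 2 * t + 1)) ∧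
  ∀ t < r, ∀ t' < r, ∃ z ∈ M, (w (o + 2 * t) ≤ z.1 ∧ z.1 ≤ w (o + 2 * t + 1)) ∧
    w (o' + 2 * t') ≤ z.2 ∧ z.2 ≤ w (o' + 2 * t' + 1)

theorem ListsGrid.swap {r o o' : ℕ} {M : Finset (ℕ × ℕ)} {w : ℕ → ℕ}
    (h : ListsGrid r (M.image Prod.swap) w o o') : ListsGrid r M w o' o := by
  refine ⟨h.2.1, h.1, fun t ht t' ht' => ?_⟩
  obtain ⟨z, hz, h1, h2⟩ := h.2.2 t' ht' t ht
  obtain ⟨z', hz', rfl⟩ := Finset.mem_image.1 hz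
  exact ⟨z', hz', h2, h1⟩

/-- A cell contains a full column line of scale `c` crossed with a full block row of scale `c * r²`.
That block has its nonempty columns in the same places as block `(X, Y)`, so it has a point on this
line, and any preimage in `M` of this point lies in the cell. -/
theorem ListsGrid.of_lines {r c o o' X Y K : ℕ} {M T A : Finset (ℕ × ℕ)} {A' : Finset ℕ}
    {w : ℕ → ℕ} (hr : 2 ≤ r) (hc : 1 ≤ c)
    (horig : ∀ z ∈ T, ∃ w ∈ M, 1 ≤ w.1 ∧ 1 ≤ w.2 ∧ up c w.1 = z.1 ∧ up c w.2 = z.2)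
    (hXY : (X, Y) ∈ alikeIn r T A X K)
    (h1 : Lines w o (c * ((X - 1) * r ^ 2)) c (sel r T X Y) r)
    (h2 : Lines w o' 0 (c * r ^ 2) A' r) (hA' : ∀ i ∈ A', (X, i + 1) ∈ alikeIn r T A X K) :
    ListsGrid r M w o o' := by
  have hR4 : 4 ≤ r ^ 2 := by nlinarith
  refine ⟨h1.chain hc, h2.chain (Nat.mul_pos hc (by omega)), fun t ht t' ht' => ?_⟩
  obtain ⟨i, hi, a1, -, a2⟩ := h1 t ht
  obtain ⟨i', hi', b1, -, b2⟩ := h2 t' ht'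
  have k1 := mem_alikeIn.1 hXY
  have k2 := mem_alikeIn.1 (hA' i' hi')
  have hsel : sel r T X (i' + 1) = sel r T X Y :=
    code_injective (sel_subset _ _ _ _) (sel_subset _ _ _ _) (by omega)
      (k2.2.2.1.trans k1.2.2.1.symm) (k2.2.2.2.trans k1.2.2.2.symm)
  rw [← hsel] at hi
  obtain ⟨z, hz, z1, z2⟩ := (mem_firstN.1 hi).2.1
  obtain ⟨w', hw', w1, w2, w3, w4⟩ := horig z hz
  -- The first coordinate is located at the scale of single columns, the second at the coarser scale
  -- of blocks.
  have e1 : up c w'.1 = (X - 1) * r ^ 2 + i + 1 := by rw [w3, z1]; ring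
  have e2 : up (c * r ^ 2) w'.2 = i' + 1 := by rw [← up_up, w4, z2]
  rw [up_eq_iff hc w1 (by omega), Nat.add_sub_cancel] at e1
  rw [up_eq_iff (Nat.mul_pos hc (by omega)) w2 (by omega), Nat.add_sub_cancel] at e2
  have e3 : c * ((X - 1) * r ^ 2 + i) = c * ((X - 1) * r ^ 2) + c * i := by ring
  have e4 : c * ((X - 1) * r ^ 2 + i + 1) = c * ((X - 1) * r ^ 2) + c * (i + 1) := by ring
  rw [e3, e4] at e1
  exact ⟨w', hw', by omega, by omega⟩

theorem ListsGrid.exists_gridding {r : ℕ} {M : Finset (ℕ × ℕ)} {τ : State} (hr : 1 ≤ r)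
    (h0 : τ.reg 0 = 0) (h : ListsGrid r M τ.mem 0 (2 * r)) :
    ∃ (I J : Interval) (G : Gridding r r I J), G.IsGridOf M ∧ Describes τ G := by
  obtain ⟨I, cs, hI, hcs⟩ := h.1.exists_isPartition hr
  obtain ⟨J, rs, hJ, hrs⟩ := h.2.1.exists_isPartition hr
  refine ⟨I, J, ⟨cs, rs, hI, hJ⟩, ?_, ?_, ?_⟩
  · intro x y
    obtain ⟨z, hz, h1, h2⟩ := h.2.2 x x.2 y y.2
    refine ⟨z, hz, ?_⟩
    simp only [Gridding.cell, Interval.toFinset, Finset.mem_product, Finset.mem_Icc,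
      (hcs x).1, (hcs x).2, (hrs y).1, (hrs y).2]
    exact ⟨h1, h2⟩
  · intro x
    simp only [h0, (hcs x).1, (hcs x).2, and_self]
  · intro y
    simp only [h0, (hrs y).1, (hrs y).2, Nat.zero_add, and_self]

/-- The last block may stick out of the rectangle, so an output endpoint may exceed the original
side lengths; this bound keeps it within a word. -/
theorem mul_up_le {R c x y p : ℕ} (hx : 1 ≤ x) (hy : 1 ≤ y) (hp : 1 ≤ x + y - 2)
    (h : c * (x + y - 2) ≤ p) : c * R * up R x ≤ p * (R + 1) := by
  have h1 : R * up R x ≤ (x + y - 2) + R := by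
    have := Nat.mul_div_le (x - 1) R
    rw [up, Nat.mul_add, Nat.mul_one]
    omega
  calc c * R * up R x = c * (R * up R x) := by ring
    _ ≤ c * ((x + y - 2) + R) := Nat.mul_le_mul_left _ h1
    _ = c * (x + y - 2) + c * 1 * R := by ring
    _ ≤ c * (x + y - 2) + c * (x + y - 2) * R := by gcongr
    _ ≤ p + p * R := by gcongr
    _ = _ := by ring

theorem outputProg_spec {r G c d e x y L p : ℕ} {M T : Finset (ℕ × ℕ)} (hr : 2 ≤ r)
    (hrr : s.reg .r = r) (hR : s.reg .R = r ^ 2) (hg : s.reg .g = G) (hs : s.reg .s = c)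
    (hdx : s.reg .dx = d) (hdy : s.reg .dy = e) (hlim : s.reg .lim = L)
    (hde : d = 0 ∧ e = 1 ∨ d = 1 ∧ e = 0) (hL : L = up (r ^ 2) y) (hc : 1 ≤ c)
    (hT : T ⊆ Finset.Icc 1 x ×ˢ Finset.Icc 1 y) (hx1 : 1 ≤ x) (hy1 : 1 ≤ y)
    (hpos : 1 ≤ x + y - 2) (hcp : c * (x + y - 2) ≤ p) (hB : p * (r ^ 2 + 1) ≤ P.B)
    (hy : y < P.Z) (hG : G + 1 < P.E) (hPT : 4 * r ≤ P.T)
    (horig : ∀ z ∈ T, ∃ w ∈ M, 1 ≤ w.1 ∧ 1 ≤ w.2 ∧ up c w.1 = z.1 ∧ up c w.2 = z.2)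
    (hF : Found r G T s) :
    WP P outputProg s fun k s' => k ≤ 10 * r ^ 2 + 10 * L + 14 ∧ s'.reg .p = 0 ∧
      ListsGrid r M s'.low (2 * r * d) (2 * r * e) := by
  have hTB := P.T_le
  have hR4 : 4 ≤ r ^ 2 := by nlinarith
  obtain ⟨f1, f2, f3, f4⟩ := hF
  set X := s.reg .FX with hX
  set Y := s.reg .FY with hY
  set K := s.reg .FK with hK
  have hm := mem_alikeIn.1 f3
  have hbl : ∀ b ∈ blocks (r ^ 2) T,
      (1 ≤ b.1 ∧ b.1 ≤ up (r ^ 2) x) ∧ 1 ≤ b.2 ∧ b.2 ≤ up (r ^ 2) y := by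
    intro b hb
    obtain ⟨z, hz, rfl⟩ := Finset.mem_image.1 hb
    have := hT hz
    simp only [Finset.mem_product, Finset.mem_Icc] at this
    exact ⟨⟨one_le_up _ _, up_mono _ this.1.2⟩, one_le_up _ _, up_mono _ this.2.2⟩
  have hXY := hbl _ hm.1
  simp only at hXY
  have hyu := up_le_self (R := r ^ 2) hy1
  have hB1 : c * ((X - 1) * r ^ 2) + c * r ^ 2 ≤ P.B := by
    calc c * ((X - 1) * r ^ 2) + c * r ^ 2 = c * r ^ 2 * (X - 1 + 1) := by ring
      _ = c * r ^ 2 * X := by rw [Nat.sub_add_cancel hXY.1.1]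
      _ ≤ c * r ^ 2 * up (r ^ 2) x := Nat.mul_le_mul_left _ hXY.1.2
      _ ≤ _ := mul_up_le hx1 hy1 hpos hcp
      _ ≤ _ := hB
  have hB2 : 0 + c * r ^ 2 * L ≤ P.B := by
    rw [hL, Nat.zero_add]
    have e1 : x + y - 2 = y + x - 2 := by omega
    exact (mul_up_le hy1 hx1 (by omega) (by rwa [← e1])).trans hB
  have ho : 2 * r * d + 2 * r ≤ P.T ∧ 2 * r * e + 2 * r ≤ P.T := by
    rcases hde with ⟨rfl, rfl⟩ | ⟨rfl, rfl⟩ <;> omega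
  refine WP.seq (WP.assign (2 * r * d) (by simp) (by simp [hrr, hdx]) (by omega) ?_)
  refine WP.seq (WP.assign (c * ((X - 1) * r ^ 2)) (by simp) (by simp [hs, hX, hR])
    (by omega) ?_)
  refine WP.seq ((emitProg_spec (M := r ^ 2) (r := r) (c := c) (o := 2 * r * d)
    (b := c * ((X - 1) * r ^ 2)) (fun i => Occ (r ^ 2) T ((X - 1) * r ^ 2 + 1 + i) Y)
    (by decide) (by decide) (by simp [hrr]) (by simp [hR]) (by simp [hs]) (by simp) (by simp)
    hc hB1 ho.1 ?_ (by decide)).mono ?_)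
  · intro s' hf ht _
    have e1 : s'.reg .g = G := by rw [hf .g (by decide)]; simpa using hg
    have e2 : s'.reg .FX = X := by rw [hf .FX (by decide)]; simp [hX]
    have e3 : s'.reg .FY = Y := by rw [hf .FY (by decide)]; simp [hY]
    have e4 : s'.reg .R = r ^ 2 := by rw [hf .R (by decide)]; simpa using hR
    refine ⟨by simp [e1, e3]; omega, by simp, ?_⟩
    rw [← f1]
    simp [e1, e2, e3, e4, ht]
  rintro k₁ s₁ ⟨hk1, hf1, ht1, hl1, hlines1⟩
  change Lines s₁.low (2 * r * d) _ c (sel r T X Y) (sel r T X Y).card at hlines1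
  rw [hm.2.2.1] at hlines1
  have hreg : ∀ w, w ∉ [Var.prev, .cur, .k, .c, .out] → s₁.reg w = s.reg w := by
    intro w hw
    rw [hf1 w hw]
    simp at hw
    simp [hw]
  have htab : s₁.tab = s.tab := by rw [ht1]; simp
  refine WP.seq (WP.assign (2 * r * e) (by simp)
    (by simp [hreg .r (by decide), hreg .dy (by decide), hrr, hdy]) (by omega) ?_)
  refine WP.seq (WP.assign 0 (by simp) (by simp) (by omega) ?_)
  refine WP.seq (WP.assign (c * r ^ 2) (by simp)
    (by simp [hreg .s (by decide), hreg .R (by decide), hs, hR]) (by omega) ?_)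
  set F' : ℕ → Prop := fun i => (X, i + 1) ∈ alikeIn r T (blocks (r ^ 2) T) X K with hF'
  have hcardF' : (firstN r F' L).card = r := by
    classical
    rw [card_firstN]
    -- Similar blocks lie in one block column and differ in their row numbers; these start from 1,
    -- the loop from 0.
    refine min_eq_left (f4.trans (Finset.card_le_card_of_injOn (fun b => b.2 - 1) ?_ ?_))
    · rintro ⟨u, v⟩ hb
      have h1 := mem_alikeIn.1 (Finset.mem_coe.1 hb)
      have h2 := hbl _ h1.1
      simp only at h1 h2
      simp only [Finset.coe_filter, Finset.mem_range, Set.mem_ofPred_eq, hF']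
      refine ⟨by omega, ?_⟩
      rw [Nat.sub_add_cancel h2.2.1, ← h1.2.1]
      rw [← h1.2.1] at hb
      exact Finset.mem_coe.1 hb
    · rintro ⟨u, v⟩ hb ⟨u', v'⟩ hb' heq
      have h1 := mem_alikeIn.1 (Finset.mem_coe.1 hb)
      have h2 := mem_alikeIn.1 (Finset.mem_coe.1 hb')
      have h3 := hbl _ h1.1
      have h4 := hbl _ h2.1
      simp only at h1 h2 h3 h4 heq
      exact Prod.ext (h1.2.1.trans h2.2.1.symm) (by simp only; omega)
  refine WP.seq ((emitProg_spec (M := L) (r := r) (c := c * r ^ 2) (o := 2 * r * e)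
    (b := 0) F' (by decide) (by decide) (by simp [hreg .r (by decide), hrr])
    (by simp [hreg .lim (by decide), hlim]) (by simp) (by simp) (by simp)
    (Nat.mul_pos hc (by omega)) hB2 ho.2 ?_ (by decide)).mono ?_)
  · intro s' hf ht hcL
    have e1 : s'.reg .g = G := by rw [hf .g (by decide)]; simp [hreg .g (by decide), hg]
    have e2 : s'.reg .FX = X := by rw [hf .FX (by decide)]; simp [hreg .FX (by decide), hX]
    have e3 : s'.reg .FK = K := by rw [hf .FK (by decide)]; simp [hreg .FK (by decide), hK]
    refine ⟨by simp [e1, hG]; omega, by simp, ?_⟩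
    change _ ↔ (X, s'.reg .c + 1) ∈ _
    rw [← f2]
    simp [e1, e2, e3, ht, htab]
  rintro k₂ s₂ ⟨hk2, hf2, ht2, hl2, hlines2⟩
  rw [hcardF'] at hlines2
  refine WP.assign 0 (by simp) (by simp) (by omega) ⟨by omega, by simp, ?_⟩
  simp only [AState.low_set] at hl2 ⊢
  have hlines1' : Lines s₂.low (2 * r * d) (c * ((X - 1) * r ^ 2)) c (sel r T X Y) r := by
    have hlow : ∀ i, 2 * r * d ≤ i → i < 2 * r * d + 2 * r → s₂.low i = s₁.low i := by
      intro i h1 h2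
      refine hl2 i ?_
      -- The two output areas are disjoint, so the second pass does not overwrite the first.
      rcases hde with ⟨rfl, rfl⟩ | ⟨rfl, rfl⟩ <;> omega
    intro t ht
    obtain ⟨i, hi, a1, a2, a3⟩ := hlines1 t ht
    rw [hlow _ (by omega) (by omega), hlow (2 * r * d + 2 * t) (by omega) (by omega)]
    refine ⟨i, hi, a1, ?_, a3⟩
    rw [a2]
    split_ifs with h0
    · rfl
    · rw [hlow _ (by omega) (by omega)]
  exact ListsGrid.of_lines hr hc horig f3 hlines1' hlines2
    fun i hi => (mem_firstN.1 hi).2.1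

theorem AState.pts_swap (s : AState) (t d e m : ℕ) :
    s.pts t e d m = (s.pts t d e m).image Prod.swap := by
  simp only [AState.pts, Finset.image_image]
  rfl

theorem blocks_swap (R : ℕ) (S : Finset (ℕ × ℕ)) :
    blocks R (S.image Prod.swap) = (blocks R S).image Prod.swap := by
  simp only [blocks, Finset.image_image]
  rfl

theorem fillScan_spec {A G Bt m n' x y r d e : ℕ} {T : Finset (ℕ × ℕ)} (hr : 2 ≤ r)
    (ha : s.reg .a = A) (hb : s.reg .b = Bt) (hg : s.reg .g = G) (hn : s.reg .n = n')
    (hcnt : s.reg .cnt = m) (hrr : s.reg .r = r) (hR : s.reg .R = r ^ 2) (hdx : s.reg .dx = d)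
    (hdy : s.reg .dy = e) (hAG : A < G) (hBG : Bt < G) (hGE : G + 2 < P.E) (hd : d < P.Z)
    (he : e < P.Z) (hT : s.pts A d e n' = T) (hBl : s.pts Bt d e m = blocks (r ^ 2) T)
    (hm : m = (blocks (r ^ 2) T).card) (hsub : T ⊆ Finset.Icc 1 x ×ˢ Finset.Icc 1 y)
    (hxZ : x + y < P.Z) (hx1 : 1 ≤ x) (hy1 : 1 ≤ y) (hB : (r ^ 2) ^ r ≤ P.B)
    (hfresh : ∀ t, G ≤ t → ∀ u v, s.tab t u v = 0) :
    WP P (fillProg ;; scanProg) s fun k s' => k ≤ 3 * n' + m * (8 * r ^ 2 + 20) + 5 ∧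
      Frame [.j, .X, .Y, .k, .key, .c, .v, .found, .FX, .FY, .FK] s s' ∧ s'.low = s.low ∧
      (∀ t, t < G ∨ G + 3 ≤ t → s'.tab t = s.tab t) ∧
      ((s'.reg .found = 0 ∧ ¬ Dense r T) ∨ (s'.reg .found = 1 ∧ Found r G T s')) := by
  have hxu := up_le_self (R := r ^ 2) hx1
  have hyu := up_le_self (R := r ^ 2) hy1
  refine WP.seq ((fillProg_spec ha hg hn hR hdx hdy (by omega) (by omega) (by omega) hd he
    (by rw [hT]; exact hsub) (by omega) (hfresh G le_rfl)).mono ?_)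
  rintro k₁ s₁ ⟨hk1, hf1, hl1, ht1, hocc⟩
  rw [hT] at hocc
  have hBl1 : s₁.pts Bt d e m = blocks (r ^ 2) T := by
    rw [← hBl]; exact AState.pts_congr_tab (ht1 _ (by omega))
  refine (scanProg_spec (S := T) (x₀ := x + y) hr ((hf1 .b (by decide)).trans hb)
    ((hf1 .g (by decide)).trans hg) ((hf1 .cnt (by decide)).trans hcnt)
    ((hf1 .r (by decide)).trans hrr) ((hf1 .R (by decide)).trans hR)
    ((hf1 .dx (by decide)).trans hdx) ((hf1 .dy (by decide)).trans hdy) hBG hGE hd he ?_ hxZ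
    (by rw [hBl1, hm]) hB hocc ?_ ?_).mono ?_
  · rw [hBl1]
    intro b hb
    obtain ⟨z, hz, rfl⟩ := Finset.mem_image.1 hb
    have := hsub hz
    simp only [Finset.mem_product, Finset.mem_Icc] at this ⊢
    have h1 := up_mono (r ^ 2) this.1.2
    have h2 := up_mono (r ^ 2) this.2.2
    exact ⟨⟨one_le_up _ _, by omega⟩, one_le_up _ _, by omega⟩
  · intro u v; rw [ht1 _ (by omega), hfresh _ (by omega)]
  · intro u v; rw [ht1 _ (by omega), hfresh _ (by omega)]
  rintro k₂ s₂ ⟨hk2, hf2, hl2, ht2, htab, hfound⟩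
  rw [hBl1] at htab hfound
  refine ⟨by omega, ?_, by rw [hl2, hl1], ?_, ?_⟩
  · intro w hw
    rw [hf2 w hw, hf1 w (by simp at hw ⊢; tauto)]
  · intro t h
    rw [ht2 t (by omega) (by omega), ht1 t (by omega)]
  · rcases hfound with ⟨h1, h2⟩ | ⟨h1, h2, h3⟩
    · left
      refine ⟨h1, ?_⟩
      rintro ⟨X, K, h⟩
      have := h2 X K
      omega
    · right
      exact ⟨h1, fun u v => by rw [ht2 G (by omega) (by omega)]; exact hocc u v, htab, h2, h3⟩

/-- Transposing costs nothing: the same programs run with `dx` and `dy` exchanged, on three further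
unused tables. -/
theorem searchProg_spec {r p q A G N x y c : ℕ} {M : Finset (ℕ × ℕ)} (hr : 2 ≤ r)
    (hC : Contracted r p q M A G N x y c s)
    (hcnt : s.reg .cnt = (blocks (r ^ 2) (s.pts A 0 1 (N + 1))).card)
    (hpts : s.pts (G + 1) 0 1 (s.reg .cnt) = blocks (r ^ 2) (s.pts A 0 1 (N + 1)))
    (hle : s.reg .cnt ≤ N / r ^ 2) (hfresh : ∀ t, G + 2 ≤ t → ∀ u v, s.tab t u v = 0)
    (hE : 2 * (p + q) + 10 ≤ P.E) (hZ : p + q + 1 ≤ P.Z) (hB : (r ^ 2) ^ r ≤ P.B) :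
    WP P searchProg s fun k s' => k ≤ 62 * N + 40 ∧ s'.reg .r = r ∧ s'.reg .R = r ^ 2 ∧
      s'.reg .s = c ∧ ∃ G', s'.reg .g = G' ∧ G' + 1 < P.E ∧
      ((s'.reg .dx = 0 ∧ s'.reg .dy = 1 ∧ s'.reg .lim = up (r ^ 2) y ∧
        Found r G' (s.pts A 0 1 (N + 1)) s') ∨
       (s'.reg .dx = 1 ∧ s'.reg .dy = 0 ∧ s'.reg .lim = up (r ^ 2) x ∧
        Found r G' ((s.pts A 0 1 (N + 1)).image Prod.swap) s')) := by
  have hZB := P.Z_le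
  have hEB := P.E_le
  have hR4 : 4 ≤ r ^ 2 := by nlinarith
  obtain ⟨hx1, hy1, hxy⟩ := subset_bounds hC.subset hC.card
  have hxu := up_le_self (R := r ^ 2) hx1
  have hyu := up_le_self (R := r ^ 2) hy1
  have hxp := hC.x_le
  have hyq := hC.y_le
  have hlt := hC.lt
  have htb := hC.tables
  have htime : s.reg .cnt * (8 * r ^ 2 + 20) ≤ 28 * N := by
    have h1 : r ^ 2 * s.reg .cnt ≤ N := (Nat.mul_le_mul_left _ hle).trans (Nat.mul_div_le _ _)
    have h2 : 4 * s.reg .cnt ≤ r ^ 2 * s.reg .cnt := Nat.mul_le_mul_right _ hR4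
    have e : s.reg .cnt * (8 * r ^ 2 + 20) = 8 * (r ^ 2 * s.reg .cnt) + 20 * s.reg .cnt := by ring
    omega
  set S := s.pts A 0 1 (N + 1) with hS
  set m := s.reg .cnt with hm
  refine WP.seq (WP.assign (G + 1) (by simp) (by simp [hC.reg_g]) (by omega) ?_)
  refine WP.seq (WP.assign (G + 2) (by simp) (by simp [hC.reg_g]) (by omega) ?_)
  refine WP.seq (WP.assign 0 (by simp) (by simp) (by omega) ?_)
  refine WP.seq (WP.assign 1 (by simp) (by simp) (by omega) ?_)
  refine WP.seq (WP.assign (up (r ^ 2) y) (by simp) (by simp [hC.reg_q, hC.reg_R, up])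
    (by omega) ?_)
  refine WP.seq ((fillScan_spec (A := A) (G := G + 2) (Bt := G + 1) (m := m) (n' := N + 1) (d := 0)
    (e := 1) (T := S) hr (by simp [hC.reg_a]) (by simp) (by simp) (by simp [hC.reg_n])
    (by simp [hm]) (by simp [hC.reg_r]) (by simp [hC.reg_R]) (by simp) (by simp) (by omega)
    (by omega) (by omega) (by omega) (by omega) (by exact AState.pts_congr_tab rfl)
    (by rw [← hpts]; exact AState.pts_congr_tab rfl) hcnt hC.subset (by omega) hx1 hy1 hB
    (by simpa using hfresh)).mono ?_)
  rintro k₁ s₁ ⟨hk1, hf1, hl1, ht1, hres⟩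
  have hreg : ∀ w, w ∉ [Var.j, .X, .Y, .k, .key, .c, .v, .found, .FX, .FY, .FK, .b, .g, .dx, .dy,
      .lim] → s₁.reg w = s.reg w := by
    intro w hw
    rw [hf1 w (by simp at hw ⊢; tauto)]
    simp at hw
    simp [hw]
  have hg1 : s₁.reg .g = G + 2 := by rw [hf1 .g (by decide)]; simp
  simp only [AState.tab_set] at ht1
  rcases hres with ⟨hnf, hnd⟩ | ⟨hfd, hF⟩
  · refine WP.ifEq (by simp) (by simp) (fun _ => ?_) (fun h => absurd hnf (by simpa using h))
    -- Once the first search has failed, the counting argument guarantees success in the transpose.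
    have hdense := (dense_or_dense hr hC.subset hC.card hC.pos hC.le
      (by rw [← hcnt]; exact hle)).resolve_left hnd
    refine WP.seq (WP.assign (G + 5) (by simp) (by simp [hg1]) (by omega) ?_)
    refine WP.seq (WP.assign 1 (by simp) (by simp) (by omega) ?_)
    refine WP.seq (WP.assign 0 (by simp) (by simp) (by omega) ?_)
    refine WP.seq (WP.assign (up (r ^ 2) x) (by simp)
      (by simp [hreg .p (by decide), hreg .R (by decide), hC.reg_p, hC.reg_R, up]) (by omega) ?_)
    have hpts1 : ∀ (s' : AState) (t i : ℕ), s'.tab = s₁.tab → t < G + 2 →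
        s'.pts t 1 0 i = (s.pts t 0 1 i).image Prod.swap := by
      intro s' t i h ht
      rw [AState.pts_swap, AState.pts_congr_tab (s := s) (by rw [h, ht1 t (Or.inl ht)])]
    refine (fillScan_spec (A := A) (G := G + 5) (Bt := G + 1) (m := m) (n' := N + 1) (d := 1)
      (e := 0) (x := y) (y := x) (T := S.image Prod.swap) hr
      (by simp [hreg .a (by decide), hC.reg_a]) ?_ (by simp)
      (by simp [hreg .n (by decide), hC.reg_n]) (by simp [hreg .cnt (by decide), hm])
      (by simp [hreg .r (by decide), hC.reg_r]) (by simp [hreg .R (by decide), hC.reg_R])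
      (by simp) (by simp) (by omega) (by omega) (by omega) (by omega) (by omega)
      (by exact hpts1 _ _ _ rfl (by omega)) ?_ ?_ ?_ (by omega) hy1 hx1 hB ?_).mono ?_
    · simp [hf1 .b (by decide)]
    · rw [hpts1 _ (G + 1) m (by simp) (by omega), hpts, blocks_swap]
    · rw [blocks_swap, Finset.card_image_of_injective _ Prod.swap_injective, hcnt]
    · intro z hz
      obtain ⟨w, hw, rfl⟩ := Finset.mem_image.1 hz
      have := hC.subset hw
      simp only [Finset.mem_product, Finset.mem_Icc] at this ⊢
      exact ⟨this.2, this.1⟩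
    · intro t h u v
      simp only [AState.tab_set]
      rw [ht1 t (Or.inr (by omega)), hfresh t (by omega)]
    rintro k₂ s₂ ⟨hk2, hf2, hl2, ht2, hres2⟩
    have hreg2 : ∀ w, w ∉ [Var.j, .X, .Y, .k, .key, .c, .v, .found, .FX, .FY, .FK, .b, .g, .dx,
        .dy, .lim] → s₂.reg w = s.reg w := by
      intro w hw
      rw [hf2 w (by simp at hw ⊢; tauto), ← hreg w hw]
      simp at hw
      simp [hw]
    obtain ⟨-, hF2⟩ := hres2.resolve_left fun h => h.2 hdense
    refine ⟨by omega, by rw [hreg2 .r (by decide), hC.reg_r],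
      by rw [hreg2 .R (by decide), hC.reg_R], by rw [hreg2 .s (by decide), hC.reg_s], G + 5, ?_,
      by omega, Or.inr ⟨?_, ?_, ?_, hF2⟩⟩
    · rw [hf2 .g (by decide)]; simp
    · rw [hf2 .dx (by decide)]; simp
    · rw [hf2 .dy (by decide)]; simp
    · rw [hf2 .lim (by decide)]; simp
  · refine WP.ifEq (by simp) (by simp) (fun h => by simp [hfd] at h) (fun _ => ?_)
    refine WP.skip ⟨by omega, by rw [hreg .r (by decide), hC.reg_r],
      by rw [hreg .R (by decide), hC.reg_R], by rw [hreg .s (by decide), hC.reg_s], G + 2, hg1,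
      by omega, Or.inl ⟨?_, ?_, ?_, hF⟩⟩
    · rw [hf1 .dx (by decide)]; simp
    · rw [hf1 .dy (by decide)]; simp
    · rw [hf1 .lim (by decide)]; simp

/-- The algorithm lists an `r × r`-grid in linear time. -/
theorem gridProg_spec {r p q m : ℕ} {M : Finset (ℕ × ℕ)} (hr : 1 ≤ r)
    (hpq : 2 < p + q) (hM : M ⊆ Finset.Icc 1 p ×ˢ Finset.Icc 1 q) (hcard : M.card = m)
    (hlt : f r * (p + q - 2) < m) (hp : s.reg .p = p) (hq : s.reg .q = q) (hrr : s.reg .r = r)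
    (hn : s.reg .n = m) (hT : P.T = 2 * m) (hZ : P.Z = p + q + 1) (hE : P.E = 8 * P.Z)
    (hB : P.B = m ^ 6)
    (hlow : (Finset.range m).image (fun i => (s.low (2 * i), s.low (2 * i + 1))) = M)
    (hlowB : ∀ i < 2 * m, s.low i ≤ P.B) (htab : ∀ t u v, s.tab t u v = 0) :
    WP P gridProg s fun k s' => k ≤ 300 * m ∧ s'.reg .p = 0 ∧
      ListsGrid r M s'.low 0 (2 * r) := by
  refine WP.of_bounds fun hbd => ?_
  have hB2 := P.two_le
  have hZB := P.Z_le
  have hTB := P.T_le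
  have hC1 : 1 ≤ (r ^ 2).choose r := Nat.choose_pos (by nlinarith)
  have hm1 : m - 1 + 1 = m := by omega
  obtain ⟨hp1, hq1, -⟩ := subset_bounds (N := m - 1) hM (by omega)
  have hf1 : 1 ≤ f r := Nat.mul_pos (by positivity) hC1
  have hPm : p + q - 2 ≤ f r * (p + q - 2) := Nat.le_mul_of_pos_left _ hf1
  refine WP.ifLt (by simp) (by simp) (fun h => ?_) (fun h => ?_)
  · simp only [Expr.eval_var, Expr.eval_two, hrr] at h
    obtain rfl : r = 1 := by omega
    refine WP.seq (WP.putLow 0 1 (by simp) (by simp) (by simp) (by simp) (by omega) (by omega) ?_)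
    refine WP.seq (WP.putLow 1 p (by simp) (by simp) (by simp) (by simp [hp]) (by omega)
      (by omega) ?_)
    refine WP.seq (WP.putLow 2 1 (by simp) (by simp) (by simp) (by simp) (by omega) (by omega) ?_)
    refine WP.seq (WP.putLow 3 q (by simp) (by simp) (by simp) (by simp [hq]) (by omega)
      (by omega) ?_)
    refine WP.assign 0 (by simp) (by simp) (by omega) ?_
    obtain ⟨z, hz⟩ := Finset.card_pos.1 (show 0 < M.card by omega)
    have hz' := hM hz
    simp only [Finset.mem_product, Finset.mem_Icc] at hz'
    refine ⟨by omega, by simp, ?_, ?_, ?_⟩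
    · refine ⟨fun i hi => ?_, fun i hi => by omega⟩
      obtain rfl : i = 0 := by omega
      simp [hp1]
    · refine ⟨fun i hi => ?_, fun i hi => by omega⟩
      obtain rfl : i = 0 := by omega
      simp [hq1]
    · intro t ht t' ht'
      obtain rfl : t = 0 := by omega
      obtain rfl : t' = 0 := by omega
      exact ⟨z, hz, by simpa using hz'.1, by simpa using hz'.2⟩
  · simp only [Expr.eval_var, Expr.eval_two, hrr] at h
    have hf16 := sixteen_mul_le_f h
    have hrsq : r ≤ r ^ 2 := by nlinarith
    have hfm : f r ≤ m := by
      have := Nat.mul_le_mul_left (f r) (show 1 ≤ p + q - 2 by omega)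
      omega
    have hm6 : m ≤ P.B := by rw [hB]; exact Nat.le_self_pow (by omega) _
    have hm26 : m * m ≤ P.B := by
      rw [hB, ← sq]; exact Nat.pow_le_pow_right (by omega) (by omega)
    have h2m : 2 * m ≤ m * m := Nat.mul_le_mul_right _ (by omega)
    -- The hypothesis on `|M|` bounds the codes: `(r²)^r` is the square of `r ^ r ≤ C(r², r) ≤ f r ≤
    -- m`.
    have hpow : (r ^ 2) ^ r ≤ P.B := by
      have h1 : (r ^ 2).choose r ≤ f r := Nat.le_mul_of_pos_left _ (by positivity)
      have h2 := (pow_self_le_choose r).trans (h1.trans hfm)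
      calc (r ^ 2) ^ r = r ^ r * r ^ r := by rw [← pow_mul, ← pow_add]; congr 1; ring
        _ ≤ m * m := Nat.mul_le_mul h2 h2
        _ ≤ P.B := hm26
    have hPR : (p + q - 2) * r ^ 2 ≤ m := by
      have : (p + q - 2) * r ^ 2 ≤ (p + q - 2) * f r := Nat.mul_le_mul_left _ (by omega)
      rw [mul_comm (f r)] at hlt
      omega
    have hPR1 : (p + q - 2) * (r ^ 2 + 1) ≤ P.B := by
      rw [Nat.mul_add]; omega
    refine WP.seq (WP.assign (r ^ 2) (by simp) (by simp [hrr, sq]) (by omega) ?_)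
    refine WP.seq ((copyProg_spec (m := m) (by simp [hn]) hT.ge (by omega) (by omega)
      (by simpa using hlowB)).mono ?_)
    rintro k₁ s₁ ⟨hk1, hf1, hl1, ht1, hcopy⟩
    have hpts : s₁.pts 0 0 1 (m - 1 + 1) = M := by
      rw [← hlow, hm1, AState.pts]
      refine Finset.image_congr fun i hi => ?_
      obtain ⟨h1, h2⟩ := hcopy i (by simpa using hi)
      simp [AState.pt, h1, h2]
    refine WP.seq ((shrinkProg_spec (N₀ := m - 1) (p := p) (q := q) h
      (by rw [hf1 .n (by decide)]; simp [hn]; omega)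
      (by rw [hf1 .p (by decide)]; simp [hp]) (by rw [hf1 .q (by decide)]; simp [hq])
      (by rw [hf1 .r (by decide)]; simp [hrr]) (by rw [hf1 .R (by decide)]; simp) hpts
      (by omega) hM (by omega) (by omega) ?_ (by omega) (by omega) (by omega)).mono ?_)
    · intro t ht u v
      rw [ht1 t (by omega)]
      exact htab t u v
    rintro k₂ s₂ ⟨hk2, hl2, A, G, N, x, y, c, hN, hC, hcnt, hpt, hle, hfresh⟩
    refine WP.seq ((searchProg_spec h hC hcnt hpt hle hfresh (by omega) (by omega) hpow).mono ?_)
    rintro k₃ s₃ ⟨hk3, hr3, hR3, hs3, G', hg3, hG', hres⟩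
    obtain ⟨hx1, hy1, -⟩ := subset_bounds hC.subset hC.card
    have hxu := up_le_self (R := r ^ 2) hx1
    have hyu := up_le_self (R := r ^ 2) hy1
    have hxp := hC.x_le
    have hyq := hC.y_le
    rcases hres with ⟨hdx, hdy, hlim, hF⟩ | ⟨hdx, hdy, hlim, hF⟩
    · refine (outputProg_spec h hr3 hR3 hg3 hs3 hdx hdy hlim (Or.inl ⟨rfl, rfl⟩) rfl hC.one_le
        hC.subset hx1 hy1 hC.pos hC.scale hPR1 (by omega) hG' (by omega) hC.origin hF).mono ?_
      rintro k₄ s₄ ⟨hk4, hp4, hgrid⟩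
      exact ⟨by omega, hp4, by simpa using hgrid⟩
    · refine (outputProg_spec (M := M.image Prod.swap) (x := y) (y := x) (p := p + q - 2) h hr3 hR3
        hg3 hs3 hdx hdy hlim (Or.inr ⟨rfl, rfl⟩) rfl hC.one_le ?_ hy1 hx1
        (by have := hC.pos; omega) ?_ hPR1 (by omega) hG' (by omega) ?_ hF).mono ?_
      · intro z hz
        obtain ⟨w, hw, rfl⟩ := Finset.mem_image.1 hz
        have := hC.subset hw
        simp only [Finset.mem_product, Finset.mem_Icc] at this ⊢
        exact ⟨this.2, this.1⟩
      · rw [add_comm y x]; exact hC.scale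
      · intro z hz
        obtain ⟨w, hw, rfl⟩ := Finset.mem_image.1 hz
        obtain ⟨w', hw', h1, h2, h3, h4⟩ := hC.origin w hw
        exact ⟨w'.swap, Finset.mem_image_of_mem _ hw', h2, h1, h4, h3⟩
      rintro k₄ s₄ ⟨hk4, hp4, hgrid⟩
      exact ⟨by omega, hp4, ListsGrid.swap (by simpa using hgrid)⟩

end GridFinding

namespace GridFinding

/-! ### Memory layout, input encoding and the final theorem -/

/-- The whole program: compute the memory layout, then run `gridProg`. -/
def mainProg : Program :=
  .arith .add 61 3 3 ;; .const 64 1 ;; .arith .add 62 0 1 ;; .arith .add 62 62 64 ;;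
  .const 64 8 ;; .arith .mul 63 64 62 ;; gridProg

/-- The word at address `a` of the input. -/
def inputWord (L : List (ℕ × ℕ)) (a : ℕ) : ℕ := (L.flatMap fun z => [z.1, z.2]).getD a 0

theorem inputWord_eq (L : List (ℕ × ℕ)) (i : ℕ) :
    inputWord L (2 * i) = (L.getD i 0).1 ∧ inputWord L (2 * i + 1) = (L.getD i 0).2 := by
  induction L generalizing i with
  | nil => simp [inputWord]
  | cons z L ih =>
    cases i with
    | zero => simp [inputWord]
    | succ i =>
      have h := ih i
      simp only [inputWord] at h ⊢
      rw [show 2 * (i + 1) = 2 * i + 1 + 1 by ring]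
      simpa using h

theorem inputWord_of_le {L : List (ℕ × ℕ)} {a : ℕ} (h : 2 * L.length ≤ a) : inputWord L a = 0 := by
  refine List.getD_eq_default _ _ ?_
  simp only [List.length_flatMap, List.length_cons, List.length_nil, List.map_const',
    List.sum_replicate, smul_eq_mul]
  omega

theorem inputWord_le {p q : ℕ} {L : List (ℕ × ℕ)}
    (h : L.toFinset ⊆ Finset.Icc 1 p ×ˢ Finset.Icc 1 q) (a : ℕ) : inputWord L a ≤ p + q := by
  have key : ∀ i, (L.getD i 0).1 ≤ p ∧ (L.getD i 0).2 ≤ q := by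
    intro i
    rcases Nat.lt_or_ge i L.length with hi | hi
    · rw [List.getD_eq_getElem _ _ hi]
      have := h (List.mem_toFinset.2 (List.getElem_mem hi))
      simp only [Finset.mem_product, Finset.mem_Icc] at this
      exact ⟨this.1.2, this.2.2⟩
    · rw [List.getD_eq_default _ _ hi]
      simp
  obtain ⟨h1, h2⟩ := inputWord_eq L (a / 2)
  obtain ⟨k1, k2⟩ := key (a / 2)
  rcases Nat.mod_two_eq_zero_or_one a with h0 | h0
  · rw [show 2 * (a / 2) = a by omega] at h1; omega
  · rw [show 2 * (a / 2) + 1 = a by omega] at h2; omega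

theorem image_inputWord (L : List (ℕ × ℕ)) :
    (Finset.range L.length).image (fun i => (inputWord L (2 * i), inputWord L (2 * i + 1))) =
      L.toFinset := by
  ext z
  simp only [Finset.mem_image, Finset.mem_range, List.mem_toFinset, (inputWord_eq L _).1,
    (inputWord_eq L _).2, List.mem_iff_getElem]
  constructor
  · rintro ⟨i, hi, rfl⟩
    exact ⟨i, hi, by rw [List.getD_eq_getElem _ _ hi]⟩
  · rintro ⟨i, hi, rfl⟩
    exact ⟨i, hi, by rw [List.getD_eq_getElem _ _ hi]⟩

theorem le_f {r : ℕ} (hr : 1 ≤ r) : r ≤ f r := by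
  have h : 1 ≤ (r ^ 2).choose r := Nat.choose_pos (by nlinarith)
  calc r ≤ r ^ 4 := Nat.le_self_pow (by omega) r
    _ ≤ f r := Nat.le_mul_of_pos_right _ h

theorem mainProg_spec {p q r : ℕ} {M : Finset (ℕ × ℕ)} {L : List (ℕ × ℕ)} (hr : 1 ≤ r)
    (hpq : 2 < p + q) (hM : M ⊆ Finset.Icc 1 p ×ˢ Finset.Icc 1 q)
    (hlt : f r * (p + q - 2) < M.card) (hnd : L.Nodup) (hL : L.toFinset = M) :
    ∃ t τ, Runs (M.card ^ 384) mainProg (initState p q r L) t τ ∧ t ≤ 20000 * M.card ∧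
      ∃ (I J : Interval) (G : Gridding r r I J), G.IsGridOf M ∧ Describes τ G := by
  have hlen : L.length = M.card := by rw [← hL, List.toFinset_card_of_nodup hnd]
  set m := M.card with hm
  have hrf := le_f hr
  have hPm : p + q - 2 ≤ f r * (p + q - 2) := Nat.le_mul_of_pos_left _ (by omega)
  have hfm : f r ≤ f r * (p + q - 2) := Nat.le_mul_of_pos_right _ (by omega)
  have h2 : 2 ≤ m := by omega
  -- All layout parameters are below `16 * m`, because `p + q - 2 < m` and `m ≥ 2`.
  have hB5 : 16 * m ≤ m ^ 6 := by
    calc 16 * m = 2 ^ 4 * m ^ 1 := by ring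
      _ ≤ m ^ 4 * m ^ 1 := by gcongr
      _ = m ^ 5 := by ring
      _ ≤ m ^ 6 := Nat.pow_le_pow_right (by omega) (by omega)
  let P : Layout := ⟨2 * m, p + q + 1, 8 * (p + q + 1), m ^ 6, by omega, by omega, by omega,
    by omega⟩
  -- With `B = m ^ 6`, the word size `B ^ 64` is a fixed power of the number of points.
  have hW : P.W = m ^ 384 := by
    change (m ^ 6) ^ 64 = m ^ 384
    rw [← pow_mul]
  have hBW : ∀ {x}, x ≤ m ^ 6 → x ≤ P.W := fun h =>
    h.trans (show m ^ 6 ≤ (m ^ 6) ^ 64 from Nat.le_self_pow (by omega) _)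
  set σ := initState p q r L with hσ
  have hmem : ∀ a, σ.mem a = inputWord L a := fun a => rfl
  let σ' : State := ((((((σ.setReg 61 (m + m)).setReg 64 1).setReg 62 (p + q)).setReg 62
    (p + q + 1)).setReg 64 8).setReg 63 (8 * (p + q + 1)))
  have r0 : σ.reg 0 = p := rfl
  have r1 : σ.reg 1 = q := rfl
  have r3 : σ.reg 3 = m := hlen
  let s : AState := ⟨fun v => σ.reg v.idx, inputWord L, fun _ _ _ => 0⟩
  have hregle : ∀ i, σ.reg i ≤ m ^ 6 := by
    intro i
    match i with
    | 0 => rw [r0]; omega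
    | 1 => rw [r1]; omega
    | 2 => change r ≤ _; omega
    | 3 => rw [r3]; omega
    | i + 4 => change 0 ≤ _; omega
  have hrel : Rel P s σ' := by
    constructor
    · intro v
      have := v.idx_lt
      simp only [σ', State.setReg, Function.update_apply]
      repeat rw [if_neg (by omega)]
    · rfl
    · change m + m = 2 * m; omega
    · rfl
    · rfl
    · intro a _; exact hmem a
    · intro t u v _ _
      -- All memory beyond the input is zero, so every table starts empty at no cost.
      exact (hmem _).trans (inputWord_of_le (by rw [hlen]; exact Nat.le_add_right _ _))
    · intro v; exact hregle v.idx
    · intro a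
      have h1 := inputWord_le (by rw [hL]; exact hM) a
      rw [show σ'.mem a = inputWord L a from rfl]
      change _ ≤ m ^ 6
      omega
  obtain ⟨k, s', u, τ, hrun, hu, hrel', hk, hp, hgrid⟩ := gridProg_spec (P := P) (s := s) (m := m)
    hr hpq hM rfl hlt r0 r1 rfl r3 rfl rfl rfl rfl
    (by rw [← hL, ← image_inputWord, hlen])
    (fun i _ => (inputWord_le (by rw [hL]; exact hM) i).trans (show p + q ≤ m ^ 6 by omega))
    (fun _ _ _ => rfl) σ' hrel
  have hfinal : Runs P.W mainProg σ (1 + (1 + (1 + (1 + (1 + (1 + u)))))) τ := by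
    refine .seq (ρ := σ.setReg 61 (m + m)) ?_ (.seq (.const 64 1 _ (hBW (by omega))) (.seq
      (ρ := ((σ.setReg 61 (m + m)).setReg 64 1).setReg 62 (p + q)) ?_ (.seq
      (ρ := (((σ.setReg 61 (m + m)).setReg 64 1).setReg 62 (p + q)).setReg 62 (p + q + 1)) ?_
      (.seq (.const 64 8 _ (hBW (by omega))) (.seq (ρ := σ') ?_ hrun)))))
    · have := Runs.arith (W := P.W) .add 61 3 3 σ
        (hBW (by simp only [Op.eval, r3]; omega))
      simpa only [Op.eval, r3] using this
    · exact Runs.arith (W := P.W) .add 62 0 1 ((σ.setReg 61 (m + m)).setReg 64 1)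
        (hBW (show p + q ≤ _ by omega))
    · exact Runs.arith (W := P.W) .add 62 62 64
        (((σ.setReg 61 (m + m)).setReg 64 1).setReg 62 (p + q))
        (hBW (show p + q + 1 ≤ _ by omega))
    · exact Runs.arith (W := P.W) .mul 63 64 62
        (((((σ.setReg 61 (m + m)).setReg 64 1).setReg 62 (p + q)).setReg 62 (p + q + 1)).setReg
          64 8) (hBW (show 8 * (p + q + 1) ≤ _ by omega))
  rw [hW] at hfinal
  refine ⟨_, τ, hfinal, by omega, ?_⟩
  have h0 : τ.reg 0 = 0 := (hrel'.reg .p).trans hp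
  refine ListsGrid.exists_gridding hr h0 ?_
  -- The `4 * r` output words must fit into the `2 * m` words of the input area; for `r = 1` this is
  -- `m ≥ 2`.
  have h4r : 4 * r ≤ 2 * m ∨ r = 1 := by
    by_cases h1 : r = 1
    · exact Or.inr h1
    · left
      have := sixteen_mul_le_f (r := r) (by omega)
      nlinarith
  have h4r' : 4 * r ≤ P.T := by
    change 4 * r ≤ 2 * m
    rcases h4r with h | h <;> omega
  have e : ∀ a, a < 4 * r → τ.mem a = s'.low a := fun a ha => hrel'.low a (by omega)
  have hcongr : ∀ o, o + 2 * r ≤ 4 * r → ∀ t < r, τ.mem (o + 2 * t) = s'.low (o + 2 * t) ∧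
      τ.mem (o + 2 * t + 1) = s'.low (o + 2 * t + 1) := fun o ho t ht =>
    ⟨e _ (by omega), e _ (by omega)⟩
  have hchain : ∀ o, o + 2 * r ≤ 4 * r →
      Chain r (fun t => s'.low (o + 2 * t)) (fun t => s'.low (o + 2 * t + 1)) →
      Chain r (fun t => τ.mem (o + 2 * t)) (fun t => τ.mem (o + 2 * t + 1)) := by
    intro o ho h
    constructor
    · intro i hi
      have := h.1 i hi
      simpa only [hcongr o ho i hi] using this
    · intro i hi
      have := h.2 i hi
      simpa only [hcongr o ho i (by omega), hcongr o ho (i + 1) hi] using this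
  refine ⟨hchain 0 (by omega) hgrid.1, hchain (2 * r) (by omega) hgrid.2.1, ?_⟩
  intro t ht t' ht'
  have := hgrid.2.2 t ht t' ht'
  simpa only [hcongr 0 (by omega) t ht, hcongr (2 * r) (by omega) t' ht'] using this

end GridFinding

theorem theoremt :
    (∀ p q r : ℕ, 1 ≤ r → 2 < p + q →
      ∀ M : Finset (ℕ × ℕ), M ⊆ Finset.Icc 1 p ×ˢ Finset.Icc 1 q →
        GridFinding.f r * (p + q - 2) < M.card →
          GridFinding.ContainsGrid M r r) ∧
    (∃ (A : GridFinding.Program) (c k : ℕ),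
      ∀ p q r : ℕ, 1 ≤ r → 2 < p + q →
        ∀ M : Finset (ℕ × ℕ), M ⊆ Finset.Icc 1 p ×ˢ Finset.Icc 1 q →
          GridFinding.f r * (p + q - 2) < M.card →
            ∀ L : List (ℕ × ℕ), L.Nodup → L.toFinset = M →
              ∃ (t : ℕ) (τ : GridFinding.State),
                GridFinding.Runs (M.card ^ k) A (GridFinding.initState p q r L) t τ ∧
                t ≤ c * M.card ∧
                ∃ (I J : GridFinding.Interval) (G : GridFinding.Gridding r r I J),
                  G.IsGridOf M ∧ GridFinding.Describes τ G) := by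
  refine ⟨fun p q r hr hpq M hM hlt => ?_, GridFinding.mainProg, 20000, 384,
    fun p q r hr hpq M hM hlt L hnd hL => GridFinding.mainProg_spec hr hpq hM hlt hnd hL⟩
  -- Existence follows by running the algorithm on any enumeration of `M`.
  obtain ⟨-, -, -, -, I, J, G, hG, -⟩ := GridFinding.mainProg_spec hr hpq hM hlt
    M.nodup_toList M.toList_toFinset
  exact ⟨I, J, G, hG⟩
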